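/- A link $L=L_1\cup\dots\cup L_\mu$ ($\mu\ge1$) in ${\bf S}^3={\bf E}^3\cup\{\infty\}$ is assumed to be tame: some ambient isotopy of ${\bf S}^3$ carries $L_1,\dots,L_\mu$ to pairwise disjoint simple closed polygons in ${\bf E}^3$. For $n\ge 0$ place points $P_1,\dots,P_{2n}$ in this order, equally spaced, on a line in ${\bf E}^2$. A geometric $2n$-string braid is given by continuous maps $p_1,\dots,p_{2n}:[0,1]\to{\bf E}^2$ with $p_k(t)\ne p_{k'}(t)$ for all $k\ne k'$ and all $t$, with $p_k(0)=P_k$ for all $k$, and with $\{p_1(1),\dots,p_{2n}(1)\}=\{P_1,\dots,P_{2n}\}$; its strings are the arcs $\{(p_k(t),t)\mid t\in[0,1]\}\subset{\bf E}^2\times[0,1]$. Its plat is the union of all the strings with, for $i=1,\dots,n$, the top arc $\alpha_i$ and the bottom arc $\alpha'_i$: $\alpha_i$ is the vertical half circle in ${\bf E}^2\times(-\infty,0]$ joining $(P_{2i-1},0)$ to $(P_{2i},0)$, and $\alpha'_i$ is the vertical half circle in ${\bf E}^2\times[1,\infty)$ joining $(P_{2i-1},1)$ to $(P_{2i},1)$.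 A $2n$-plat presentation of $L$ is such a braid together with an ambient isotopy of ${\bf S}^3$ that carries $L$ to its plat; via the isotopy each arc of the plat belongs to exactly one component $L_j$. The bridge number $b(L)$ is the smallest positive integer $n$ such that $L$ has a $2n$-plat presentation. A $2n$-plat presentation of $L$ is called special if (1) there are integers $n_1,\dots,n_\mu\ge 0$ with $n_1+\dots+n_\mu=n$ such that, for each $j$, the top arcs belonging to $L_j$ are exactly the $\alpha_i$, and the bottom arcs belonging to $L_j$ are exactly the $\alpha'_i$, with $n_1+\dots+n_{j-1}<i\le n_1+\dots+n_j$; and (2) $p_{2i-1}(1)\in\{P_1,P_3,\dots,P_{2n-1}\}$ and $p_{2i}(1)\in\{P_2,P_4,\dots,P_{2n}\}$ for each $i=1,\dots,n$. Proposition. For every link $L$ in ${\bf S}^3$, with its components numbered in any given order, $b(L)$ is well defined, and $L$ admits a special $2n$-plat presentation for each $n\ge b(L)$. -/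

import Mathlib

open scoped unitInterval

/-! Links in the 3-sphere, plats, and the bridge number. -/

namespace PlatLink

/-- Euclidean 3-space, written as the product of the plane (identified with `ℂ`) and the line. -/
abbrev E3 : Type := ℂ × ℝ

/-- The 3-sphere, as Euclidean 3-space with one point at infinity. -/
abbrev S3 : Type := OnePoint E3

/-- A subset of Euclidean 3-space, regarded as a subset of the 3-sphere. -/
def toS3 (K : Set E3) : Set S3 := (fun x : E3 => (x : S3)) '' K

/-- An ambient isotopy of the 3-sphere: a jointly continuous family of homeomorphisms that starts
at the identity. -/
structure AmbientIsotopy where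
  /-- the homeomorphism at time `t` -/
  homeo : I → (S3 ≃ₜ S3)
  continuous_homeo : Continuous fun q : I × S3 => homeo q.1 q.2
  homeo_zero : homeo 0 = Homeomorph.refl S3

/-- The final homeomorphism of an ambient isotopy. -/
def AmbientIsotopy.final (H : AmbientIsotopy) : S3 ≃ₜ S3 := H.homeo 1

/-- `K` is a simple closed polygon in Euclidean 3-space: the union of the edges of a polygon with
at least three (cyclically ordered) vertices that does not meet itself, that is, the edges without
their final end points, traversed one after the other, are injective and pairwise disjoint. -/
def IsSimpleClosedPolygon (K : Set E3) : Prop :=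
  ∃ (m : ℕ) (p : Polygon E3 m), 3 ≤ m ∧
    (Function.Injective fun q : Fin m × Set.Ico (0 : ℝ) 1 => p.edgePath ℝ q.1 (q.2 : ℝ)) ∧
    K = p.boundary ℝ

/-- A (tame) link in the 3-sphere with `μ ≥ 1` components `L_1, …, L_μ`: a family of subsets of the
3-sphere that some ambient isotopy carries to a family of pairwise disjoint simple closed polygons
in Euclidean 3-space. -/
structure Link (μ : ℕ) where
  /-- the components -/
  component : Fin μ → Set S3
  pos : 0 < μ
  tame : ∃ (K : Fin μ → Set E3) (H : AmbientIsotopy),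
    (∀ j, IsSimpleClosedPolygon (K j)) ∧
    (Pairwise fun j j' => Disjoint (K j) (K j')) ∧
    ∀ j, H.final '' component j = toS3 (K j)

/-- The underlying set of a link. -/
def Link.carrier {μ : ℕ} (L : Link μ) : Set S3 := ⋃ j, L.component j

/-- The points `P_1, P_2, …` of the plane, numbered from `0`: they lie on a line at distance `1`
from one another. -/
def endpoint (k : ℕ) : ℂ := (k : ℂ)

/-- A geometric `m`-string braid on the points `P_1, …, P_m`; the `k`-th string is
`{(p_k(t), t) | t ∈ [0, 1]}`. -/
structure GeometricBraid (m : ℕ) where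
  /-- the motion of the `k`-th point in the plane -/
  path : Fin m → I → ℂ
  continuous_path : ∀ k, Continuous (path k)
  path_ne : ∀ t k k', k ≠ k' → path k t ≠ path k' t
  path_zero : ∀ k, path k 0 = endpoint k
  range_path_one : (Set.range fun k => path k 1) = Set.range fun k : Fin m => endpoint k

/-- The `k`-th string of a geometric braid. -/
def GeometricBraid.string {m : ℕ} (β : GeometricBraid m) (k : Fin m) : Set E3 :=
  Set.range fun t : I => (β.path k t, (t : ℝ))

/-- The top arc number `i` (counted from `0`): the vertical half circle that joins the points
`(P_{2i+1}, 0)` and `(P_{2i+2}, 0)` in the half space of non-positive heights. -/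
def topArc (i : ℕ) : Set E3 :=
  {q | q.1.im = 0 ∧ q.2 ≤ 0 ∧ (q.1.re - (2 * i + 1 / 2)) ^ 2 + q.2 ^ 2 = (1 / 2) ^ 2}

/-- The bottom arc number `i` (counted from `0`): the vertical half circle that joins the points
`(P_{2i+1}, 1)` and `(P_{2i+2}, 1)` in the half space of heights at least `1`. -/
def bottomArc (i : ℕ) : Set E3 :=
  {q | q.1.im = 0 ∧ 1 ≤ q.2 ∧ (q.1.re - (2 * i + 1 / 2)) ^ 2 + (q.2 - 1) ^ 2 = (1 / 2) ^ 2}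

/-- The `2n`-plat defined by a `2n`-string braid: the strings with all top and bottom arcs. -/
def GeometricBraid.plat {n : ℕ} (β : GeometricBraid (2 * n)) : Set E3 :=
  (⋃ k, β.string k) ∪ (⋃ i : Fin n, topArc i) ∪ ⋃ i : Fin n, bottomArc i

/-- A `2n`-plat presentation of a link: a `2n`-string braid and an ambient isotopy of the 3-sphere
that carries the link to the plat of the braid. -/
structure PlatPresentation {μ : ℕ} (L : Link μ) (n : ℕ) where
  /-- the braid -/
  braid : GeometricBraid (2 * n)
  /-- the isotopy from the link to the plat -/
  isotopy : AmbientIsotopy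
  image_eq : isotopy.final '' L.carrier = toS3 braid.plat

/-- The bridge number of a link: the smallest positive `n` such that the link has a `2n`-plat
presentation. -/
noncomputable def Link.bridgeNumber {μ : ℕ} (L : Link μ) : ℕ :=
  sInf {n : ℕ | 0 < n ∧ Nonempty (PlatPresentation L n)}

namespace PlatPresentation

variable {μ n : ℕ} {L : Link μ}

/-- The component of the plat that corresponds to the `j`-th component of the link. -/
def component (P : PlatPresentation L n) (j : Fin μ) : Set S3 :=
  P.isotopy.final '' L.component j

/-- The top and the bottom arcs that belong to the `j`-th component are those with the (0-based)
numbers `i` for which `n_1 + ⋯ + n_{j-1} ≤ i < n_1 + ⋯ + n_j`. -/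
def ArcsConsecutive (P : PlatPresentation L n) : Prop :=
  ∃ ν : Fin μ → ℕ, ∑ j, ν j = n ∧
    ∀ (j : Fin μ) (i : Fin n),
      (toS3 (topArc i) ⊆ P.component j ↔
        ∑ j' ∈ Finset.Iio j, ν j' ≤ (i : ℕ) ∧ (i : ℕ) < ∑ j' ∈ Finset.Iic j, ν j') ∧
      (toS3 (bottomArc i) ⊆ P.component j ↔
        ∑ j' ∈ Finset.Iio j, ν j' ≤ (i : ℕ) ∧ (i : ℕ) < ∑ j' ∈ Finset.Iic j, ν j')

/-- The strings that start at `P_1, P_3, …, P_{2n-1}` end in `{P_1, P_3, …, P_{2n-1}}`, and those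
that start at `P_2, P_4, …, P_{2n}` end in `{P_2, P_4, …, P_{2n}}` (the indices in the code are
one smaller). -/
def PreservesParity (P : PlatPresentation L n) : Prop :=
  ∀ i : Fin n,
    P.braid.path ⟨2 * (i : ℕ), by omega⟩ 1 ∈ Set.range (fun i' : Fin n => endpoint (2 * (i' : ℕ))) ∧
    P.braid.path ⟨2 * (i : ℕ) + 1, by omega⟩ 1 ∈ Set.range (fun i' : Fin n => endpoint (2 * (i' : ℕ) + 1))

/-- A special plat presentation. -/
def IsSpecial (P : PlatPresentation L n) : Prop :=
  P.ArcsConsecutive ∧ P.PreservesParity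

end PlatPresentation

end PlatLink

/-!
# Special plat presentations of links

The proof works with pointed plats (`IsPointedPlat`): finitely many strings over the levels from
`0` to `1` that are disjoint at the levels strictly between and that meet in pairs, like the sides
of a wedge, at the levels `0` and `1`. Up to a change of levels a plat is a pointed plat whose tips
lie at the centres of the arcs and whose strings are straight near the tips: a half circle over its
diameter and a wedge differ only in the heights of their points
(`GeometricBraid.exists_isPointedPlat`, `IsWedgePlat.image_plat`). Pointed plats carry no numbering of
the strings and prescribe no places for the tips, and this makes them easy to move.

All isotopies come from explicit families of homeomorphisms of Euclidean 3-space that are proper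
uniformly in the parameter (`isotopic_of_family`). The main tool replaces isotopy extension: strings
that are moved within their levels, by displacements whose differences are small in comparison with
the distances of the strings, are carried along by an ambient isotopy, since the displacements extend
level by level to a Lipschitz map of the plane with a small constant by McShane's formula
(`isotopic_of_small_displacement`). Such steps add up to homotopies of the strings
(`isotopic_of_homotopy`). The estimate is relative, so it allows strings to meet in a tip. With a
homotopy that uses a path in the complex numbers avoiding finitely many points, the tips can be put
at any places, with any two directions at each of them (`IsPointedPlat.exists_straight_zero`).

* Every link is isotopic to a pointed plat. The polygons are put into general position by shears, and
  they are subdivided where the first coordinate takes one of the finitely many values that it has at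
  the vertices. A vertical shear by a zigzag function of the first coordinate then folds the polygons
  like an accordion, such that every edge runs from the level `0` to the level `1`
  (`IsSimplePolygon.exists_isPointedPlat`). Hence the bridge number is attained.
* Two strings can be added to a pointed plat: a string that has been moved to the far right runs
  through a horizontal segment over which there is nothing else, and a vertical shear makes a zigzag
  of it (`IsPointedPlat.exists_add_two`).
* A pointed plat with `2n` strings yields a special `2n`-plat presentation
  (`Link.exists_isSpecial`). The strings of every component form cycles in which meetings at the
  levels `0` and `1` alternate. So the strings can be coloured with two colours such that strings
  that meet have different colours (`exists_two_colouring`). The strings of one colour, sorted by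
  their components, are sent to the places `P_1, P_3, …` at both ends, and each of the others is
  placed next to the string that it meets; as every string keeps its colour, parity is preserved, and
  both the top and the bottom arcs come out sorted by their components.
-/

namespace PlatLink

open Set Filter Topology

/-! ### Ambient isotopies -/

/-- Two families of subsets of the 3-sphere are isotopic if one ambient isotopy carries each member
of the first family onto the corresponding member of the second. -/
def Isotopic {ι : Type*} (X Y : ι → Set S3) : Prop :=
  ∃ H : AmbientIsotopy, ∀ i, H.final '' X i = Y i

/-- Two ambient isotopies, performed at the same time. -/
noncomputable def AmbientIsotopy.comp (H G : AmbientIsotopy) : AmbientIsotopy where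
  homeo t := (H.homeo t).trans (G.homeo t)
  continuous_homeo :=
    G.continuous_homeo.comp (continuous_fst.prodMk H.continuous_homeo)
  homeo_zero := by rw [H.homeo_zero, G.homeo_zero]; rfl

/-- The inverse homeomorphisms of an ambient isotopy; their joint continuity comes from the
compactness of `I × S3`. -/
noncomputable def AmbientIsotopy.inv (H : AmbientIsotopy) : AmbientIsotopy where
  homeo t := (H.homeo t).symm
  continuous_homeo := by
    let e : I × S3 ≃ I × S3 :=
      { toFun := fun q => (q.1, H.homeo q.1 q.2)
        invFun := fun q => (q.1, (H.homeo q.1).symm q.2)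
        left_inv := fun q => by simp
        right_inv := fun q => by simp }
    have he : Continuous e := continuous_fst.prodMk H.continuous_homeo
    exact continuous_snd.comp (he.homeoOfEquivCompactToT2).symm.continuous
  homeo_zero := by rw [H.homeo_zero]; rfl

/-- The conjugate of an ambient isotopy by a homeomorphism of the 3-sphere. -/
noncomputable def AmbientIsotopy.conj (H : AmbientIsotopy) (ρ : S3 ≃ₜ S3) : AmbientIsotopy where
  homeo t := (ρ.symm.trans (H.homeo t)).trans ρ
  continuous_homeo :=
    ρ.continuous.comp (H.continuous_homeo.comp
      (continuous_fst.prodMk (ρ.symm.continuous.comp continuous_snd)))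
  homeo_zero := by rw [H.homeo_zero]; ext x; simp

/-- The constant ambient isotopy. -/
noncomputable def AmbientIsotopy.const : AmbientIsotopy where
  homeo _ := Homeomorph.refl S3
  continuous_homeo := continuous_snd
  homeo_zero := rfl

namespace Isotopic

variable {ι : Type*} {X Y Z : ι → Set S3}

theorem refl (X : ι → Set S3) : Isotopic X X :=
  ⟨AmbientIsotopy.const, fun i => by
    simp [AmbientIsotopy.final, AmbientIsotopy.const]⟩

theorem trans (h : Isotopic X Y) (h' : Isotopic Y Z) : Isotopic X Z := by
  obtain ⟨H, hH⟩ := h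
  obtain ⟨G, hG⟩ := h'
  refine ⟨H.comp G, fun i => ?_⟩
  rw [← hG i, ← hH i, ← image_comp]
  rfl

theorem conj (h : Isotopic X Y) (ρ : S3 ≃ₜ S3) :
    Isotopic (fun i => ρ '' X i) (fun i => ρ '' Y i) := by
  obtain ⟨H, hH⟩ := h
  refine ⟨H.conj ρ, fun i => ?_⟩
  change _ '' (ρ '' X i) = ρ '' Y i
  rw [← hH i, ← image_comp, ← image_comp]
  congr 1
  ext x
  simp [AmbientIsotopy.final, AmbientIsotopy.conj]

theorem iUnion (h : Isotopic X Y) :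
    Isotopic (fun _ : Unit => ⋃ i, X i) (fun _ => ⋃ i, Y i) := by
  obtain ⟨H, hH⟩ := h
  exact ⟨H, fun _ => by simp only [image_iUnion, hH]⟩

end Isotopic

theorem toS3_iUnion {ι : Sort*} (X : ι → Set E3) : toS3 (⋃ i, X i) = ⋃ i, toS3 (X i) := by
  simp [toS3, image_iUnion]

theorem continuous_onePoint_map {f : ℝ → E3 → E3}
    (hf : Continuous fun q : ℝ × E3 => f q.1 q.2) {C : ℝ}
    (hC : ∀ s ∈ Icc (0 : ℝ) 1, ∀ x, ‖x‖ ≤ C * (1 + ‖f s x‖)) :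
    Continuous fun q : I × S3 => OnePoint.map (f q.1) q.2 := by
  rw [continuous_iff_continuousAt]
  rintro ⟨s, x⟩
  induction x using OnePoint.rec with
  | infty =>
    rw [ContinuousAt, nhds_prod_eq]
    simp only [OnePoint.map_infty]
    rw [OnePoint.hasBasis_nhds_infty.tendsto_right_iff]
    rintro K ⟨-, hK⟩
    obtain ⟨R, hR⟩ := hK.isBounded.exists_norm_le
    have hmem : ((fun x : E3 => (x : S3)) '' (Metric.closedBall 0 (|C| * (1 + |R|)))ᶜ ∪ {OnePoint.infty})
        ∈ 𝓝 (OnePoint.infty : S3) :=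
      OnePoint.hasBasis_nhds_infty.mem_of_mem
        ⟨Metric.isClosed_closedBall, isCompact_closedBall _ _⟩
    filter_upwards [prod_mem_prod univ_mem hmem] with q hq
    obtain ⟨-, hq⟩ := hq
    rcases hq with ⟨y, hy, hyq⟩ | hq
    · left
      refine ⟨f q.1 y, ?_, by rw [← hyq]; rfl⟩
      intro hmemK
      apply hy
      rw [mem_closedBall_zero_iff]
      have h1 := hC q.1 q.1.2 y
      have h2 := hR _ hmemK
      calc ‖y‖ ≤ C * (1 + ‖f q.1 y‖) := h1
        _ ≤ |C| * (1 + ‖f q.1 y‖) := by gcongr; exact le_abs_self C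
        _ ≤ |C| * (1 + |R|) := by gcongr; exact h2.trans (le_abs_self R)
    · right
      simp only [mem_singleton_iff] at hq
      simp [hq]
  | coe x =>
    have hemb : IsOpenEmbedding (Prod.map id (fun x : E3 => (x : S3)) : I × E3 → I × S3) :=
      IsOpenEmbedding.id.prodMap OnePoint.isOpenEmbedding_coe
    have := hemb.continuousAt_iff (x := (s, x)) (g := fun q : I × S3 => OnePoint.map (f q.1) q.2)
    refine this.1 (Continuous.continuousAt ?_)
    change Continuous fun q : I × E3 => ((f q.1 q.2 : E3) : S3)
    exact OnePoint.continuous_coe.comp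
      (hf.comp ((continuous_subtype_val.comp continuous_fst).prodMk continuous_snd))

/-- A jointly continuous family of bijections of Euclidean 3-space that starts at the identity and
is proper, uniformly in the parameter, extends to an ambient isotopy of the 3-sphere. -/
theorem isotopic_of_family {ι : Type*} (X : ι → Set E3) (f : ℝ → E3 → E3)
    (hf : Continuous fun q : ℝ × E3 => f q.1 q.2)
    (hbij : ∀ s ∈ Icc (0 : ℝ) 1, Function.Bijective (f s)) (h0 : ∀ x, f 0 x = x) (C : ℝ)
    (hC : ∀ s ∈ Icc (0 : ℝ) 1, ∀ x, ‖x‖ ≤ C * (1 + ‖f s x‖)) :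
    Isotopic (fun i => toS3 (X i)) (fun i => toS3 (f 1 '' X i)) := by
  have hcont := continuous_onePoint_map hf hC
  have hb (s : I) : Function.Bijective (OnePoint.map (f s) : S3 → S3) := by
    constructor
    · exact Option.map_injective (hbij s s.2).1
    · intro y
      induction y using OnePoint.rec with
      | infty => exact ⟨OnePoint.infty, rfl⟩
      | coe y =>
        obtain ⟨x, rfl⟩ := (hbij s s.2).2 y
        exact ⟨(x : S3), rfl⟩
  let e (s : I) : S3 ≃ₜ S3 :=
    Continuous.homeoOfEquivCompactToT2 (f := Equiv.ofBijective _ (hb s))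
      (hcont.comp (Continuous.prodMk_right s))
  refine ⟨⟨e, hcont, ?_⟩, fun i => ?_⟩
  · ext x
    change OnePoint.map (f ((0 : I) : ℝ)) x = x
    have : f ((0 : I) : ℝ) = id := funext h0
    rw [this, OnePoint.map_id]; rfl
  · change (OnePoint.map (f ((1 : I) : ℝ))) '' toS3 (X i) = _
    simp only [toS3, ← image_comp]
    rfl

/-! ### Families of strings and their homotopies -/

/-- The string over the levels between `0` and `1` that is described by a motion in the plane. -/
def strand (q : ℝ → ℂ) : Set E3 := (fun t : ℝ => ((q t, t) : E3)) '' Icc 0 1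

/-- The McShane extension, with Lipschitz constant `1/4`, of the function that takes the values
`w k` at the points `q k`. -/
noncomputable def mcShane {K : Type*} [Fintype K] [Nonempty K] (q : K → ℂ) (w : K → ℝ) (z : ℂ) : ℝ :=
  Finset.univ.inf' Finset.univ_nonempty fun k => w k + (1 / 4) * ‖z - q k‖

section McShane

variable {K : Type*} [Fintype K] [Nonempty K]

theorem mcShane_le (q : K → ℂ) (w : K → ℝ) (z z' : ℂ) :
    mcShane q w z ≤ mcShane q w z' + (1 / 4) * ‖z - z'‖ := by
  obtain ⟨k, -, hk⟩ := Finset.exists_mem_eq_inf' (s := (Finset.univ : Finset K))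
    Finset.univ_nonempty fun k => w k + (1 / 4) * ‖z' - q k‖
  have h1 : mcShane q w z' = w k + (1 / 4) * ‖z' - q k‖ := hk
  have h2 : mcShane q w z ≤ w k + (1 / 4) * ‖z - q k‖ := Finset.inf'_le _ (Finset.mem_univ k)
  have h3 : ‖z - q k‖ ≤ ‖z - z'‖ + ‖z' - q k‖ := norm_sub_le_norm_sub_add_norm_sub _ _ _
  linarith

theorem abs_mcShane_sub_le (q : K → ℂ) (w : K → ℝ) (z z' : ℂ) :
    |mcShane q w z - mcShane q w z'| ≤ (1 / 4) * ‖z - z'‖ := by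
  have h1 := mcShane_le q w z z'
  have h2 := mcShane_le q w z' z
  rw [norm_sub_rev] at h2
  rw [abs_le]
  constructor <;> linarith

theorem mcShane_apply (q : K → ℂ) (w : K → ℝ)
    (h : ∀ k l, |w k - w l| ≤ (1 / 4) * ‖q k - q l‖) (k : K) : mcShane q w (q k) = w k := by
  apply le_antisymm
  · have : mcShane q w (q k) ≤ w k + (1 / 4) * ‖q k - q k‖ := Finset.inf'_le _ (Finset.mem_univ k)
    simpa using this
  · refine Finset.le_inf' _ _ fun l _ => ?_
    have := (abs_le.1 (h k l)).2
    linarith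

theorem continuous_mcShane {T : Type*} [TopologicalSpace T] {q : T → K → ℂ} {w : T → K → ℝ}
    {z : T → ℂ} (hq : ∀ k, Continuous fun t => q t k) (hw : ∀ k, Continuous fun t => w t k)
    (hz : Continuous z) : Continuous fun t => mcShane (q t) (w t) (z t) := by
  unfold mcShane
  refine Continuous.finset_inf'_apply _ fun k _ => ?_
  exact (hw k).add (continuous_const.mul (hz.sub (hq k)).norm)

end McShane

theorem bijective_add_of_lipschitz {g : ℂ → ℂ} (hg : ∀ z z', ‖g z - g z'‖ ≤ (1 / 2) * ‖z - z'‖) :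
    Function.Bijective fun z => z + g z := by
  have hlip (c : ℂ) : LipschitzWith (1 / 2) fun z => c - g z := by
    refine LipschitzWith.of_dist_le_mul fun z z' => ?_
    have := hg z' z
    rw [dist_eq_norm, dist_eq_norm, sub_sub_sub_cancel_left, norm_sub_rev z z']
    simpa using this
  constructor
  · intro z z' h
    have h1 : z - z' = g z' - g z := by
      have h' : z + g z = z' + g z' := h
      linear_combination h'
    have h2 := hg z' z
    rw [← h1, norm_sub_rev z' z] at h2
    have : ‖z - z'‖ = 0 := by linarith [norm_nonneg (z - z')]
    exact sub_eq_zero.1 (norm_eq_zero.1 this)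
  · intro c
    have hc : ContractingWith (1 / 2) fun z => c - g z := ⟨by
      rw [← NNReal.coe_lt_coe]; norm_num, hlip c⟩
    refine ⟨ContractingWith.fixedPoint _ hc, ?_⟩
    have : c - g (ContractingWith.fixedPoint _ hc) = ContractingWith.fixedPoint _ hc :=
      hc.fixedPoint_isFixedPt
    linear_combination -this

/-- Strings may be moved within their levels, as long as the displacements of any two of them
differ by little in comparison with the distance of the two strings. Strings may meet. -/
theorem isotopic_of_small_displacement {K : Type*} [Fintype K] [Nonempty K] (q q' : K → ℝ → ℂ)
    (hq : ∀ k, Continuous (q k)) (hq' : ∀ k, Continuous (q' k))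
    (h : ∀ t ∈ Icc (0 : ℝ) 1, ∀ k l,
      ‖(q' k t - q k t) - (q' l t - q l t)‖ ≤ (1 / 4) * ‖q k t - q l t‖) :
    Isotopic (fun k => toS3 (strand (q k))) (fun k => toS3 (strand (q' k))) := by
  -- outside the levels of the strings, the map of the nearest level is used
  let c : ℝ → ℝ := fun t => projIcc (0 : ℝ) 1 zero_le_one t
  have hc : Continuous c := continuous_subtype_val.comp continuous_projIcc
  have hcI (t : ℝ) : c t ∈ Icc (0 : ℝ) 1 := (projIcc (0 : ℝ) 1 zero_le_one t).2
  have hcid (t : ℝ) (ht : t ∈ Icc (0 : ℝ) 1) : c t = t := by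
    simp only [c]; rw [projIcc_of_mem _ ht]
  let Q : ℝ → K → ℂ := fun t k => q k (c t)
  let W : ℝ → K → ℂ := fun t k => q' k (c t) - q k (c t)
  have hQ (k) : Continuous fun t => Q t k := (hq k).comp hc
  have hW (k) : Continuous fun t => W t k := ((hq' k).comp hc).sub ((hq k).comp hc)
  let a : ℝ → ℂ → ℝ := fun t z => mcShane (Q t) (fun k => (W t k).re) z
  let b : ℝ → ℂ → ℝ := fun t z => mcShane (Q t) (fun k => (W t k).im) z
  let g : ℝ → ℂ → ℂ := fun t z => (a t z : ℂ) + (b t z : ℂ) * Complex.I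
  have ha : Continuous fun x : E3 => a x.2 x.1 :=
    continuous_mcShane (fun k => (hQ k).comp continuous_snd)
      (fun k => Complex.continuous_re.comp ((hW k).comp continuous_snd)) continuous_fst
  have hb : Continuous fun x : E3 => b x.2 x.1 :=
    continuous_mcShane (fun k => (hQ k).comp continuous_snd)
      (fun k => Complex.continuous_im.comp ((hW k).comp continuous_snd)) continuous_fst
  have hg : Continuous fun x : E3 => g x.2 x.1 :=
    (Complex.continuous_ofReal.comp ha).add
      ((Complex.continuous_ofReal.comp hb).mul continuous_const)
  have hglip (t : ℝ) (z z' : ℂ) : ‖g t z - g t z'‖ ≤ (1 / 2) * ‖z - z'‖ := by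
    have h1 := abs_mcShane_sub_le (Q t) (fun k => (W t k).re) z z'
    have h2 := abs_mcShane_sub_le (Q t) (fun k => (W t k).im) z z'
    have h3 : g t z - g t z' = ((a t z - a t z' : ℝ) : ℂ) + ((b t z - b t z' : ℝ) : ℂ) * Complex.I := by
      simp only [g]; push_cast; ring
    calc ‖g t z - g t z'‖ ≤ ‖((a t z - a t z' : ℝ) : ℂ)‖ + ‖((b t z - b t z' : ℝ) : ℂ) * Complex.I‖ := by
          rw [h3]; exact norm_add_le _ _
      _ = |a t z - a t z'| + |b t z - b t z'| := by
          rw [norm_mul, Complex.norm_I, mul_one, Complex.norm_real, Complex.norm_real]; rfl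
      _ ≤ (1 / 2) * ‖z - z'‖ := by linarith
  have hgq (t : ℝ) (ht : t ∈ Icc (0 : ℝ) 1) (k : K) : g t (q k t) = q' k t - q k t := by
    have e1 : Q t k = q k t := by simp only [Q]; rw [hcid t ht]
    have e2 : W t k = q' k t - q k t := by simp only [W]; rw [hcid t ht]
    have hd (k l : K) : ‖W t k - W t l‖ ≤ (1 / 4) * ‖Q t k - Q t l‖ := h (c t) (hcI t) k l
    have h1 : a t (Q t k) = (W t k).re := mcShane_apply (Q t) _
      (fun k l => le_trans (by rw [← Complex.sub_re]; exact Complex.abs_re_le_norm _) (hd k l)) k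
    have h2 : b t (Q t k) = (W t k).im := mcShane_apply (Q t) _
      (fun k l => le_trans (by rw [← Complex.sub_im]; exact Complex.abs_im_le_norm _) (hd k l)) k
    rw [← e2, ← e1]
    simp only [g]
    rw [h1, h2, Complex.re_add_im]
  obtain ⟨B, hB⟩ : ∃ B, ∀ t, ‖g t 0‖ ≤ B := by
    have hcont : ContinuousOn (fun t => g t 0) (Icc (0 : ℝ) 1) :=
      (hg.comp (continuous_const.prodMk continuous_id)).continuousOn
    obtain ⟨B, hB⟩ := isCompact_Icc.exists_bound_of_continuousOn hcont
    refine ⟨B, fun t => ?_⟩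
    have : g t 0 = g (c t) 0 := by
      simp only [g, a, b, Q, W, hcid _ (hcI t)]
    rw [this]
    exact hB _ (hcI t)
  have hB0 : 0 ≤ B := (norm_nonneg _).trans (hB 0)
  have main := isotopic_of_family (fun k => strand (q k))
    (fun s x => ((x.1 + (s : ℂ) * g x.2 x.1, x.2) : E3)) ?_ ?_ ?_ (2 + 2 * B) ?_
  · convert main using 3 with k
    simp only [strand, ← image_comp]
    refine image_congr fun t ht => ?_
    simp only [Function.comp_apply, Complex.ofReal_one, one_mul]
    rw [hgq t ht k]
    simp
  · exact ((continuous_fst.comp continuous_snd).add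
      ((Complex.continuous_ofReal.comp continuous_fst).mul (hg.comp continuous_snd))).prodMk
      (continuous_snd.comp continuous_snd)
  · intro s hs
    have hbij (t : ℝ) : Function.Bijective fun z => z + (s : ℂ) * g t z := by
      apply bijective_add_of_lipschitz (g := fun z => (s : ℂ) * g t z)
      intro z z'
      rw [← mul_sub, norm_mul, Complex.norm_real, Real.norm_of_nonneg hs.1]
      calc s * ‖g t z - g t z'‖ ≤ 1 * ‖g t z - g t z'‖ := by gcongr; exact hs.2
        _ ≤ _ := by rw [one_mul]; exact hglip t z z'
    constructor
    · rintro ⟨z, t⟩ ⟨z', t'⟩ hzz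
      obtain ⟨h1, rfl⟩ := Prod.mk.inj hzz
      exact Prod.ext ((hbij t).1 h1) rfl
    · rintro ⟨y, t⟩
      obtain ⟨z, hz⟩ := (hbij t).2 y
      exact ⟨(z, t), Prod.ext hz rfl⟩
  · intro x; simp
  · rintro s hs ⟨z, t⟩
    have h1 : ‖(s : ℂ) * g t z‖ ≤ B + (1 / 2) * ‖z‖ := by
      rw [norm_mul, Complex.norm_real, Real.norm_of_nonneg hs.1]
      have h2 := hglip t z 0
      rw [sub_zero] at h2
      have h3 : ‖g t z‖ ≤ ‖g t z - g t 0‖ + ‖g t 0‖ := by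
        simpa using norm_add_le (g t z - g t 0) (g t 0)
      calc s * ‖g t z‖ ≤ 1 * ‖g t z‖ := by gcongr; exact hs.2
        _ ≤ _ := by linarith [hB t]
    have h4 : ‖z‖ ≤ ‖z + (s : ℂ) * g t z‖ + ‖(s : ℂ) * g t z‖ := by
      simpa using norm_sub_le (z + (s : ℂ) * g t z) ((s : ℂ) * g t z)
    have h5 : ‖z + (s : ℂ) * g t z‖ ≤ ‖((z + (s : ℂ) * g t z, t) : E3)‖ := norm_fst_le (_, _)
    have h6 : ‖t‖ ≤ ‖((z + (s : ℂ) * g t z, t) : E3)‖ := norm_snd_le (_, _)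
    have h7 : ‖((z, t) : E3)‖ = max ‖z‖ ‖t‖ := rfl
    have h8 := norm_nonneg ((z + (s : ℂ) * g t z, t) : E3)
    rw [h7]
    refine max_le ?_ ?_ <;> nlinarith

/-- A homotopy of strings, during which the difference of any two strings is the product of a fixed
function of the level with a function that has no zero, is realized by an ambient isotopy. The
fixed factor allows two strings to meet at a level, if they do so all the time. -/
theorem isotopic_of_homotopy {K : Type*} [Fintype K] [Nonempty K] (Q : K → ℝ → ℝ → ℂ)
    (hQ : ∀ k, Continuous fun p : ℝ × ℝ => Q k p.1 p.2) (a b : ℝ)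
    (hconst : ∀ k, ∀ s ∈ Icc (0 : ℝ) 1, ∀ t ∈ Icc (0 : ℝ) 1, t ∉ Icc a b → Q k s t = Q k 0 t)
    (hdiff : ∀ k l, k ≠ l → ∃ (r : ℝ → ℝ) (D : ℝ → ℝ → ℂ), (Continuous fun p : ℝ × ℝ => D p.1 p.2) ∧
      ∀ s ∈ Icc (0 : ℝ) 1, ∀ t ∈ Icc a b, D s t ≠ 0 ∧ Q k s t - Q l s t = r t * D s t) :
    Isotopic (fun k => toS3 (strand (Q k 0))) (fun k => toS3 (strand (Q k 1))) := by
  classical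
  have hpair (k l : K) : ∃ η > 0, ∀ s ∈ Icc (0 : ℝ) 1, ∀ s' ∈ Icc (0 : ℝ) 1, |s - s'| < η →
      ∀ t ∈ Icc (0 : ℝ) 1, ‖(Q k s' t - Q k s t) - (Q l s' t - Q l s t)‖ ≤ (1 / 4) * ‖Q k s t - Q l s t‖ := by
    by_cases hkl : k = l
    · subst hkl
      exact ⟨1, one_pos, fun s _ s' _ _ t _ => by simp⟩
    obtain ⟨r, D, hD, hrD⟩ := hdiff k l hkl
    have hcomp : IsCompact (Icc (0 : ℝ) 1 ×ˢ Icc a b) := isCompact_Icc.prod isCompact_Icc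
    obtain ⟨m, hm, hmD⟩ : ∃ m > 0, ∀ p ∈ Icc (0 : ℝ) 1 ×ˢ Icc a b, m ≤ ‖D p.1 p.2‖ := by
      rcases (Icc (0 : ℝ) 1 ×ˢ Icc a b).eq_empty_or_nonempty with he | hne
      · exact ⟨1, one_pos, fun p hp => by rw [he] at hp; exact hp.elim⟩
      · obtain ⟨p, hp, hmin⟩ := hcomp.exists_isMinOn hne hD.norm.continuousOn
        exact ⟨‖D p.1 p.2‖, norm_pos_iff.2 (hrD p.1 hp.1 p.2 hp.2).1, fun p' hp' => hmin hp'⟩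
    have huc := hcomp.uniformContinuousOn_of_continuous hD.continuousOn
    rw [Metric.uniformContinuousOn_iff] at huc
    obtain ⟨η, hη, hη'⟩ := huc (m / 4) (by positivity)
    refine ⟨η, hη, fun s hs s' hs' hss t ht01 => ?_⟩
    by_cases ht : t ∈ Icc a b
    · have h1 : (Q k s' t - Q k s t) - (Q l s' t - Q l s t) = r t * (D s' t - D s t) := by
        have e1 := (hrD s hs t ht).2
        have e2 := (hrD s' hs' t ht).2
        linear_combination e2 - e1
      rw [h1, (hrD s hs t ht).2, norm_mul, norm_mul]
      have h2 : ‖D s' t - D s t‖ ≤ m / 4 := by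
        have := hη' (s', t) ⟨hs', ht⟩ (s, t) ⟨hs, ht⟩ (by
          rw [Prod.dist_eq, dist_self, Real.dist_eq, abs_sub_comm]
          exact max_lt hss hη)
        rw [dist_eq_norm] at this
        exact this.le
      have h3 := hmD (s, t) ⟨hs, ht⟩
      simp only at h3
      calc ‖(r t : ℂ)‖ * ‖D s' t - D s t‖ ≤ ‖(r t : ℂ)‖ * (1 / 4 * ‖D s t‖) := by
            gcongr; linarith
        _ = _ := by ring
    · rw [hconst k s hs t ht01 ht, hconst l s hs t ht01 ht, hconst k s' hs' t ht01 ht,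
        hconst l s' hs' t ht01 ht]
      simp
  choose η hη hη' using hpair
  obtain ⟨ε, hε, hεη⟩ : ∃ ε > 0, ∀ k l, ε ≤ η k l := by
    let m := (Finset.univ : Finset (K × K)).inf' Finset.univ_nonempty fun p => η p.1 p.2
    refine ⟨m, ?_, fun k l => Finset.inf'_le _ (Finset.mem_univ (k, l))⟩
    exact (Finset.lt_inf'_iff _).2 fun p _ => hη _ _
  obtain ⟨N, hN⟩ := exists_nat_one_div_lt hε
  have hN0 : (0 : ℝ) < N + 1 := by positivity
  have step (j : ℕ) (hj : j ≤ N + 1) :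
      Isotopic (fun k => toS3 (strand (Q k 0))) (fun k => toS3 (strand (Q k (j / (N + 1))))) := by
    induction j with
    | zero => simpa using Isotopic.refl _
    | succ j ih =>
      refine (ih (by omega)).trans ?_
      have hjN : (j : ℝ) + 1 ≤ N + 1 := by exact_mod_cast hj
      have hs : (j : ℝ) / (N + 1) ∈ Icc (0 : ℝ) 1 :=
        ⟨by positivity, by rw [div_le_one hN0]; linarith⟩
      have hs' : ((j + 1 : ℕ) : ℝ) / (N + 1) ∈ Icc (0 : ℝ) 1 :=
        ⟨by positivity, by rw [div_le_one hN0]; push_cast; linarith⟩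
      refine isotopic_of_small_displacement _ _
        (fun k => (hQ k).comp (continuous_const.prodMk continuous_id))
        (fun k => (hQ k).comp (continuous_const.prodMk continuous_id)) fun t ht k l => ?_
      refine hη' k l _ hs _ hs' ?_ t ht
      have : (j : ℝ) / (N + 1) - ((j + 1 : ℕ) : ℝ) / (N + 1) = -(1 / (N + 1)) := by
        push_cast; ring
      rw [this, abs_neg, abs_of_pos (by positivity)]
      exact hN.trans_le (hεη k l)
  have := step (N + 1) le_rfl
  have h1 : (((N + 1 : ℕ) : ℝ)) / (N + 1) = 1 := by push_cast; field_simp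
  rwa [h1] at this

/-! ### Pointed plats -/

/-- A pointed plat: strings over the levels from `0` to `1` that are disjoint at the levels strictly
between, that meet in pairs at the levels `0` and `1`, and that are straight near these levels. -/
structure IsPointedPlat {K : Type*} (q : K → ℝ → ℂ) : Prop where
  continuous : ∀ k, Continuous (q k)
  ne : ∀ t ∈ Ioo (0 : ℝ) 1, ∀ k l, k ≠ l → q k t ≠ q l t
  linear_zero : ∃ δ > 0, ∃ w : K → ℂ, ∀ k, ∀ t ∈ Icc (0 : ℝ) δ, q k t = q k 0 + t * w k
  linear_one : ∃ δ > 0, ∃ w : K → ℂ, ∀ k, ∀ t ∈ Icc (0 : ℝ) δ, q k (1 - t) = q k 1 + t * w k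
  meet_zero : ∀ k, ∃ l, l ≠ k ∧ ∀ m, q m 0 = q k 0 ↔ m = k ∨ m = l
  meet_one : ∀ k, ∃ l, l ≠ k ∧ ∀ m, q m 1 = q k 1 ↔ m = k ∨ m = l

/-- The reflection of Euclidean 3-space that exchanges the levels `0` and `1`, extended to the
3-sphere. -/
noncomputable def levelReflection : S3 ≃ₜ S3 :=
  ((Homeomorph.refl ℂ).prodCongr (Homeomorph.subLeft (1 : ℝ))).onePointCongr

theorem levelReflection_strand (q : ℝ → ℂ) :
    levelReflection '' toS3 (strand q) = toS3 (strand fun t => q (1 - t)) := by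
  simp only [toS3, strand, ← image_comp]
  ext x
  constructor
  · rintro ⟨t, ht, rfl⟩
    refine ⟨1 - t, ⟨by linarith [ht.2], by linarith [ht.1]⟩, ?_⟩
    simp only [Function.comp_apply, sub_sub_cancel]
    rfl
  · rintro ⟨t, ht, rfl⟩
    exact ⟨1 - t, ⟨by linarith [ht.2], by linarith [ht.1]⟩, by
      simp only [Function.comp_apply]
      change ((q (1 - t), 1 - (1 - t)) : E3) = (((q (1 - t), t) : E3) : S3)
      rw [sub_sub_cancel]⟩

theorem Isotopic.flip {K : Type*} {q q' : K → ℝ → ℂ}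
    (h : Isotopic (fun k => toS3 (strand (q k))) fun k => toS3 (strand (q' k))) :
    Isotopic (fun k => toS3 (strand fun t => q k (1 - t)))
      fun k => toS3 (strand fun t => q' k (1 - t)) := by
  have := h.conj levelReflection
  simpa only [levelReflection_strand] using this

namespace IsPointedPlat

variable {K : Type*} {q : K → ℝ → ℂ}

theorem flip (h : IsPointedPlat q) : IsPointedPlat fun k t => q k (1 - t) where
  continuous k := (h.continuous k).comp (continuous_const.sub continuous_id)
  ne t ht k l hkl := h.ne (1 - t) ⟨by linarith [ht.2], by linarith [ht.1]⟩ k l hkl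
  linear_zero := by simpa using h.linear_one
  linear_one := by simpa using h.linear_zero
  meet_zero := by simpa using h.meet_one
  meet_one := by simpa using h.meet_zero

theorem reindex (h : IsPointedPlat q) {J : Type*} (e : J ≃ K) :
    IsPointedPlat fun j => q (e j) where
  continuous j := h.continuous (e j)
  ne t ht j j' hj := h.ne t ht _ _ (e.injective.ne hj)
  linear_zero := by
    obtain ⟨δ, hδ, w, hw⟩ := h.linear_zero
    exact ⟨δ, hδ, fun j => w (e j), fun j => hw (e j)⟩
  linear_one := by
    obtain ⟨δ, hδ, w, hw⟩ := h.linear_one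
    exact ⟨δ, hδ, fun j => w (e j), fun j => hw (e j)⟩
  meet_zero j := by
    obtain ⟨l, hl, hm⟩ := h.meet_zero (e j)
    refine ⟨e.symm l, fun h' => hl (by rw [← h', e.apply_symm_apply]), fun m => ?_⟩
    rw [hm, e.apply_eq_iff_eq, e.eq_symm_apply]
  meet_one j := by
    obtain ⟨l, hl, hm⟩ := h.meet_one (e j)
    refine ⟨e.symm l, fun h' => hl (by rw [← h', e.apply_symm_apply]), fun m => ?_⟩
    rw [hm, e.apply_eq_iff_eq, e.eq_symm_apply]

end IsPointedPlat

/-- Finitely many pairs of non-zero complex numbers are joined by paths in the non-zero complex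
numbers, with a common parameter: the parameter runs through the complex plane and avoids the
finitely many bad values. -/
theorem exists_path_avoiding {P : Type*} [Finite P] (x y : P → ℂ) (hx : ∀ p, x p ≠ 0)
    (hy : ∀ p, y p ≠ 0) :
    ∃ γ : ℝ → ℂ, Continuous γ ∧ γ 0 = 0 ∧ γ 1 = 1 ∧ ∀ p t, x p + γ t * (y p - x p) ≠ 0 := by
  let F : Set ℂ := ⋃ p, {z | x p + z * (y p - x p) = 0}
  have hF : F.Countable := by
    refine Set.Finite.countable (Set.finite_iUnion fun p => ?_)
    refine (Set.finite_singleton (-x p / (y p - x p))).subset fun z hz => ?_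
    have hz' : x p + z * (y p - x p) = 0 := hz
    have hne : y p - x p ≠ 0 := by
      intro h0
      rw [h0, mul_zero, add_zero] at hz'
      exact hx p hz'
    rw [mem_singleton_iff, eq_div_iff hne]
    linear_combination hz'
  have hrank : 1 < Module.rank ℝ ℂ := by rw [Complex.rank_real_complex]; norm_num
  have hjoin := (hF.isPathConnected_compl_of_one_lt_rank hrank).joinedIn 0
    (by simp [F, hx]) 1 (by simp [F, hy])
  obtain ⟨γ, hγ⟩ := hjoin
  refine ⟨γ.extend, γ.continuous_extend, by simp, by simp, fun p t h0 => ?_⟩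
  have hmem : γ.extend t ∈ Fᶜ := by
    exact hγ (projIcc 0 1 zero_le_one t)
  exact hmem (mem_iUnion.2 ⟨p, h0⟩)

/-- The tips of a pointed plat at the level `0` may be put at any places that are far from one
another, with any two directions at each tip and any opening angle. -/
theorem IsPointedPlat.exists_straight_zero {K : Type*} [Fintype K] [Nonempty K] {q : K → ℝ → ℂ}
    (h : IsPointedPlat q) (c e : K → ℂ) (he : ∀ k, ‖e k‖ = 1)
    (hc : ∀ k l, q k 0 = q l 0 → c k = c l) (hc2 : ∀ k l, q k 0 ≠ q l 0 → 2 ≤ ‖c k - c l‖)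
    (hee : ∀ k l, k ≠ l → q k 0 = q l 0 → e k ≠ e l) :
    ∃ q' : K → ℝ → ℂ, IsPointedPlat q' ∧ (∀ k, ∀ t ≥ 1 / 2, q' k t = q k t) ∧
      (∃ δ ∈ Ioo (0 : ℝ) (1 / 2), ∀ k, ∀ t ∈ Icc 0 δ, q' k t = c k + (t / (2 * δ) : ℝ) * e k) ∧
      Isotopic (fun k => toS3 (strand (q k))) fun k => toS3 (strand (q' k)) := by
  classical
  obtain ⟨δ₁, hδ₁, w, hw⟩ := h.linear_zero
  set a : K → ℂ := fun k => q k 0 with ha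
  obtain ⟨η, hη, hηa⟩ : ∃ η > 0, ∀ k l, a k ≠ a l → η ≤ ‖a k - a l‖ := by
    let f : K × K → ℝ := fun p => if a p.1 = a p.2 then 1 else ‖a p.1 - a p.2‖
    refine ⟨Finset.univ.inf' Finset.univ_nonempty f, ?_, fun k l hkl => ?_⟩
    · rw [gt_iff_lt, Finset.lt_inf'_iff]
      intro p _
      simp only [f]
      split_ifs with hp
      · exact one_pos
      · exact norm_pos_iff.2 (sub_ne_zero.2 hp)
    · have := Finset.inf'_le f (Finset.mem_univ (k, l))
      simp only [f, hkl, if_false] at this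
      exact this
  let M : ℝ := Finset.univ.sup' Finset.univ_nonempty fun k => ‖w k‖
  have hM (k) : ‖w k‖ ≤ M := Finset.le_sup' (fun k => ‖w k‖) (Finset.mem_univ k)
  have hM0 : 0 ≤ M := (norm_nonneg _).trans (hM (Classical.arbitrary K))
  obtain ⟨δ₀, hδ₀, hδ₀1, hδ₀2, hδ₀M⟩ : ∃ δ₀ > 0, δ₀ ≤ δ₁ ∧ δ₀ ≤ 1 / 2 ∧ 3 * δ₀ * M ≤ η := by
    refine ⟨min (min δ₁ (1 / 2)) (η / (3 * (M + 1))), by positivity,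
      (min_le_left _ _).trans (min_le_left _ _), (min_le_left _ _).trans (min_le_right _ _), ?_⟩
    have : min (min δ₁ (1 / 2)) (η / (3 * (M + 1))) ≤ η / (3 * (M + 1)) := min_le_right _ _
    calc _ ≤ 3 * (η / (3 * (M + 1))) * M := by gcongr
      _ = η * (M / (M + 1)) := by field_simp
      _ ≤ η * 1 := by
        gcongr
        rw [div_le_one (by linarith)]; linarith
      _ = η := mul_one η
  have hww (k l : K) (hkl : k ≠ l) (hal : a k = a l) : w k ≠ w l := by
    intro hwkl
    have hI : δ₀ ∈ Icc 0 δ₁ := ⟨hδ₀.le, hδ₀1⟩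
    apply h.ne δ₀ ⟨hδ₀, by linarith⟩ k l hkl
    rw [hw k _ hI, hw l _ hI, hwkl]
    change a k + _ = a l + _
    rw [hal]
  let δ : ℝ := 3 / 4 * δ₀
  have hδ : 0 < δ := by positivity
  let κ : ℝ := 1 / (2 * δ)
  have hκ : 0 < κ := by positivity
  have hκδ : 3 * δ₀ * κ = 2 := by simp only [κ, δ]; field_simp; norm_num
  let v : K → ℂ := fun k => κ * e k
  have hvn (k) : ‖v k‖ = κ := by
    simp only [v]; rw [norm_mul, he, mul_one, Complex.norm_real, Real.norm_of_nonneg hκ.le]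
  obtain ⟨γ, hγc, hγ0, hγ1, hγ⟩ := exists_path_avoiding
    (fun p : K × K => if p.1 = p.2 then (1 : ℂ) else
      if a p.1 = a p.2 then w p.1 - w p.2 else a p.1 - a p.2)
    (fun p : K × K => if p.1 = p.2 then (1 : ℂ) else
      if a p.1 = a p.2 then v p.1 - v p.2 else c p.1 - c p.2)
    (by
      intro p
      split_ifs with h1 h2
      · exact one_ne_zero
      · exact sub_ne_zero.2 (hww _ _ h1 h2)
      · exact sub_ne_zero.2 h2)
    (by
      intro p
      split_ifs with h1 h2
      · exact one_ne_zero
      · simp only [v]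
        rw [← mul_sub]
        exact mul_ne_zero (by exact_mod_cast hκ.ne') (sub_ne_zero.2 (hee _ _ h1 h2))
      · intro h3
        have := hc2 _ _ h2
        rw [h3, norm_zero] at this
        linarith)
  -- the places of the tips and the directions of the strings during the motion
  let A : K → ℝ → ℂ := fun k θ => a k + γ θ * (c k - a k)
  let V : K → ℝ → ℂ := fun k θ => w k + γ θ * (v k - w k)
  have hAc (k) : Continuous (A k) := by fun_prop
  have hVc (k) : Continuous (V k) := by fun_prop
  have hA (k l : K) (hal : a k ≠ a l) (θ : ℝ) : A k θ ≠ A l θ := by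
    have h1 := hγ (k, l) θ
    have hkl : k ≠ l := fun h' => hal (by rw [h'])
    simp only [hkl, hal, if_false] at h1
    refine fun h2 => h1 ?_
    simp only [A] at h2
    linear_combination h2
  have hV (k l : K) (hkl : k ≠ l) (hal : a k = a l) (θ : ℝ) : V k θ - V l θ ≠ 0 := by
    have h1 := hγ (k, l) θ
    simp only [hkl, hal, if_false, if_true] at h1
    refine fun h2 => h1 ?_
    simp only [V] at h2
    linear_combination h2
  let m : ℝ → ℝ := fun θ => Finset.univ.sup' Finset.univ_nonempty fun k => ‖V k θ‖
  have hmV (k θ) : ‖V k θ‖ ≤ m θ := Finset.le_sup' (fun k => ‖V k θ‖) (Finset.mem_univ k)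
  have hmc : Continuous m := Continuous.finset_sup'_apply _ fun k _ => (hVc k).norm
  have hm (θ) : 0 < m θ := by
    let k := Classical.arbitrary K
    obtain ⟨l, hlk, hl⟩ := h.meet_zero k
    have h1 := hV l k hlk ((hl l).2 (Or.inr rfl)) θ
    by_contra hneg
    have h2 : V l θ = 0 := norm_le_zero_iff.1 ((hmV l θ).trans (not_lt.1 hneg))
    have h3 : V k θ = 0 := norm_le_zero_iff.1 ((hmV k θ).trans (not_lt.1 hneg))
    exact h1 (by rw [h2, h3, sub_zero])
  -- the factor that keeps the strings at different tips apart
  let ε : ℝ → ℝ := fun θ => Finset.univ.inf' Finset.univ_nonempty fun p : K × K =>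
    if a p.1 = a p.2 then 1 else min 1 (‖A p.1 θ - A p.2 θ‖ / (3 * δ₀ * m θ))
  have hεc : Continuous ε := by
    refine Continuous.finset_inf'_apply _ fun p _ => ?_
    split_ifs
    · exact continuous_const
    · refine continuous_const.min (((hAc _).sub (hAc _)).norm.div (continuous_const.mul hmc) ?_)
      intro θ
      have := hm θ
      positivity
  have hε (θ) : 0 < ε θ := by
    refine (Finset.lt_inf'_iff _).2 fun p _ => ?_
    split_ifs with hp
    · exact one_pos
    · have h1 := hm θ
      have h2 : 0 < ‖A p.1 θ - A p.2 θ‖ := norm_pos_iff.2 (sub_ne_zero.2 (hA _ _ hp θ))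
      positivity
  have hεle (k l : K) (hal : a k ≠ a l) (θ : ℝ) : ε θ * (3 * δ₀ * m θ) ≤ ‖A k θ - A l θ‖ := by
    have h1 : ε θ ≤ _ := Finset.inf'_le _ (Finset.mem_univ (k, l))
    simp only [hal, if_false] at h1
    have h2 := h1.trans (min_le_right _ _)
    have := hm θ
    rwa [le_div_iff₀ (by positivity)] at h2
  have hεone (θ : ℝ) (hθ : ∀ k l, a k ≠ a l → 3 * δ₀ * m θ ≤ ‖A k θ - A l θ‖) : ε θ = 1 := by
    have hm' := hm θ
    have key : ∀ p : K × K, (if a p.1 = a p.2 then (1 : ℝ)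
        else min 1 (‖A p.1 θ - A p.2 θ‖ / (3 * δ₀ * m θ))) = 1 := by
      intro p
      split_ifs with hp
      · rfl
      · rw [min_eq_left]
        rw [le_div_iff₀ (by positivity), one_mul]
        exact hθ _ _ hp
    simp only [ε, key]
    exact Finset.inf'_const _ _
  have hA0 (k) : A k 0 = a k := by simp [A, hγ0]
  have hA1 (k) : A k 1 = c k := by simp [A, hγ1]
  have hV0 (k) : V k 0 = w k := by simp [V, hγ0]
  have hV1 (k) : V k 1 = v k := by simp [V, hγ1]
  have hε0 : ε 0 = 1 := by
    apply hεone
    intro k l hkl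
    rw [hA0, hA0]
    have : m 0 ≤ M := by
      simp only [m, hV0]; rfl
    calc 3 * δ₀ * m 0 ≤ 3 * δ₀ * M := by gcongr
      _ ≤ _ := hδ₀M.trans (hηa k l hkl)
  have hε1 : ε 1 = 1 := by
    apply hεone
    intro k l hkl
    rw [hA1, hA1]
    have : m 1 = κ := by
      simp only [m, hV1, hvn]
      exact Finset.sup'_const _ _
    rw [this, hκδ]
    exact hc2 k l hkl
  let W : K → ℝ → ℂ := fun k θ => ε θ * V k θ
  have hWc (k) : Continuous (W k) := by fun_prop
  have hW0 (k) : W k 0 = w k := by simp [W, hε0, hV0]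
  have hW1 (k) : W k 1 = v k := by simp [W, hε1, hV1]
  let th : ℝ → ℝ := fun t => max 0 (min 1 ((δ₀ - t) / (δ₀ - δ)))
  have hthc : Continuous th := by
    refine continuous_const.max (continuous_const.min ?_)
    exact (continuous_const.sub continuous_id).div_const _
  have hδδ : 0 < δ₀ - δ := by simp only [δ]; linarith
  have hth0 (t : ℝ) (ht : δ₀ ≤ t) : th t = 0 := by
    refine max_eq_left ((min_le_right _ _).trans ?_)
    exact div_nonpos_of_nonpos_of_nonneg (by linarith) hδδ.le
  have hth1 (t : ℝ) (ht : t ≤ δ) : th t = 1 := by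
    have : 1 ≤ (δ₀ - t) / (δ₀ - δ) := by rw [le_div_iff₀ hδδ]; linarith
    simp only [th]
    rw [min_eq_left this, max_eq_right zero_le_one]
  let Q : K → ℝ → ℝ → ℂ := fun k s t =>
    q k t + γ (s * th t) * (c k - a k) + t * (W k (s * th t) - w k)
  have hQc (k) : Continuous fun p : ℝ × ℝ => Q k p.1 p.2 := by
    have h1 : Continuous fun p : ℝ × ℝ => p.1 * th p.2 :=
      continuous_fst.mul (hthc.comp continuous_snd)
    have h2 := (h.continuous k).comp (continuous_snd (X := ℝ) (Y := ℝ))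
    exact (h2.add ((hγc.comp h1).mul continuous_const)).add
      ((Complex.continuous_ofReal.comp continuous_snd).mul
        (((hWc k).comp h1).sub continuous_const))
  have hQ0 (k) : Q k 0 = q k := by
    funext t
    simp [Q, hγ0, hW0]
  have hQq (k s t) (ht : δ₀ ≤ t) : Q k s t = q k t := by
    simp [Q, hth0 t ht, hγ0, hW0]
  have hQA (k s t) (ht : t ∈ Icc 0 δ₀) : Q k s t = A k (s * th t) + t * W k (s * th t) := by
    simp only [Q, A]
    rw [hw k t ⟨ht.1, ht.2.trans hδ₀1⟩]
    ring
  have hfar (k l : K) (hal : a k ≠ a l) (s t : ℝ) (ht : t ∈ Icc 0 δ₀) : Q k s t ≠ Q l s t := by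
    rw [hQA k s t ht, hQA l s t ht]
    intro heq
    set θ := s * th t
    have h1 : A k θ - A l θ = t * (W l θ - W k θ) := by linear_combination heq
    have h2 := hεle k l hal θ
    have hWn (j : K) : ‖W j θ‖ ≤ ε θ * m θ := by
      simp only [W]
      rw [norm_mul, Complex.norm_real, Real.norm_of_nonneg (hε θ).le]
      exact mul_le_mul_of_nonneg_left (hmV j θ) (hε θ).le
    have h3 : ‖A k θ - A l θ‖ ≤ δ₀ * (ε θ * m θ + ε θ * m θ) := by
      rw [h1, norm_mul, Complex.norm_real, Real.norm_of_nonneg ht.1]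
      exact mul_le_mul ht.2 ((norm_sub_le _ _).trans (add_le_add (hWn l) (hWn k)))
        (norm_nonneg _) hδ₀.le
    have h4 : 0 < δ₀ * (ε θ * m θ) := mul_pos hδ₀ (mul_pos (hε θ) (hm θ))
    nlinarith
  have hclose (k l : K) (hal : a k = a l) (s t : ℝ) (ht : t ∈ Icc 0 δ₀) :
      Q k s t - Q l s t = t * (ε (s * th t) * (V k (s * th t) - V l (s * th t))) := by
    rw [hQA k s t ht, hQA l s t ht]
    simp only [A, W, hal, hc k l hal]
    ring
  have hQne (k l : K) (hkl : k ≠ l) (s t : ℝ) (ht : t ∈ Icc 0 δ₀) (ht0 : t ≠ 0) :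
      Q k s t ≠ Q l s t := by
    by_cases hal : a k = a l
    · rw [← sub_ne_zero, hclose k l hal s t ht]
      refine mul_ne_zero (by exact_mod_cast ht0) (mul_ne_zero ?_ (hV k l hkl hal _))
      exact_mod_cast (hε _).ne'
    · exact hfar k l hal s t ht
  have hiso := isotopic_of_homotopy Q hQc 0 δ₀
    (fun k s _ t ht ht' => by
      have h1 : δ₀ ≤ t := by
        by_contra hlt
        exact ht' ⟨ht.1, (not_le.1 hlt).le⟩
      rw [hQq k s t h1, hQq k 0 t h1])
    (fun k l hkl => by
      by_cases hal : a k = a l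
      · refine ⟨fun t => t, fun s t => ε (s * th t) * (V k (s * th t) - V l (s * th t)), ?_, ?_⟩
        · have h1 : Continuous fun p : ℝ × ℝ => p.1 * th p.2 :=
            continuous_fst.mul (hthc.comp continuous_snd)
          exact (Complex.continuous_ofReal.comp (hεc.comp h1)).mul
            (((hVc k).comp h1).sub ((hVc l).comp h1))
        · intro s _ t ht
          refine ⟨mul_ne_zero ?_ (hV k l hkl hal _), hclose k l hal s t ht⟩
          exact_mod_cast (hε _).ne'
      · refine ⟨fun _ => 1, fun s t => Q k s t - Q l s t, (hQc k).sub (hQc l), ?_⟩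
        intro s _ t ht
        exact ⟨sub_ne_zero.2 (hfar k l hal s t ht), by simp⟩)
  have hQ1 (k t) (ht : t ∈ Icc 0 δ) : Q k 1 t = c k + (t / (2 * δ) : ℝ) * e k := by
    rw [hQA k 1 t ⟨ht.1, ht.2.trans (by linarith)⟩, hth1 t ht.2, one_mul, hA1, hW1]
    simp only [v, κ]
    push_cast
    ring
  have hQ10 (k) : Q k 1 0 = c k := by
    rw [hQ1 k 0 ⟨le_rfl, hδ.le⟩]; simp
  have hceq (k l : K) : c k = c l ↔ q k 0 = q l 0 := by
    refine ⟨fun h1 => ?_, hc k l⟩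
    by_contra h2
    have := hc2 k l h2
    rw [h1, sub_self, norm_zero] at this
    linarith
  refine ⟨fun k => Q k 1, ⟨?_, ?_, ?_, ?_, ?_, ?_⟩, ?_, ?_, ?_⟩
  · exact fun k => (hQc k).comp (continuous_const.prodMk continuous_id)
  · intro t ht k l hkl
    rcases le_total δ₀ t with h1 | h1
    · rw [hQq k 1 t h1, hQq l 1 t h1]
      exact h.ne t ht k l hkl
    · exact hQne k l hkl 1 t ⟨ht.1.le, h1⟩ ht.1.ne'
  · refine ⟨δ, hδ, v, fun k t ht => ?_⟩
    rw [hQ1 k t ht, hQ10]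
    simp only [v, κ]
    push_cast
    ring
  · obtain ⟨δ₂, hδ₂, w₂, hw₂⟩ := h.linear_one
    refine ⟨min δ₂ (1 / 2), by positivity, w₂, fun k t ht => ?_⟩
    have h1 : t ≤ 1 / 2 := ht.2.trans (min_le_right _ _)
    rw [hQq k 1 _ (by linarith), hQq k 1 _ (by linarith),
      hw₂ k t ⟨ht.1, ht.2.trans (min_le_left _ _)⟩]
  · intro k
    obtain ⟨l, hl, hm⟩ := h.meet_zero k
    refine ⟨l, hl, fun m => ?_⟩
    rw [hQ10, hQ10, hceq, hm]
  · intro k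
    obtain ⟨l, hl, hm⟩ := h.meet_one k
    refine ⟨l, hl, fun m => ?_⟩
    rw [hQq _ 1 _ (by linarith), hQq _ 1 _ (by linarith), hm]
  · intro k t ht
    exact hQq k 1 t (by linarith)
  · exact ⟨δ, ⟨hδ, by simp only [δ]; linarith⟩, hQ1⟩
  · simpa only [hQ0] using hiso

/-! ### Plats as pointed plats -/

/-- The change of levels that turns half circles into straight wedges of heights `δ₁` and `δ₂`: it
maps the levels `[-1/2, 0]` of the top arcs to `[0, δ₁]`, the levels `[0, 1]` of the braid to
`[δ₁, 1 - δ₂]` and the levels `[1, 3/2]` of the bottom arcs to `[1 - δ₂, 1]`. -/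
noncomputable def levelMap (δ₁ δ₂ t : ℝ) : ℝ :=
  min (t + 1 / 2) 0 + 2 * δ₁ * √(1 / 4 - (max (-1 / 2) (min t 0)) ^ 2) +
    (1 - δ₁ - δ₂) * max 0 (min t 1) +
    δ₂ * (1 - 2 * √(1 / 4 - (max 1 (min t (3 / 2)) - 1) ^ 2)) + max (t - 3 / 2) 0

theorem sqrt_quarter : √(1 / 4 : ℝ) = 1 / 2 := by
  rw [show (1 / 4 : ℝ) = (1 / 2) ^ 2 by norm_num, Real.sqrt_sq (by norm_num)]

section LevelMap

variable {δ₁ δ₂ : ℝ}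

theorem levelMap_of_le {t : ℝ} (h : t ≤ -1 / 2) : levelMap δ₁ δ₂ t = t + 1 / 2 := by
  have e1 : min (t + 1 / 2) 0 = t + 1 / 2 := min_eq_left (by linarith)
  have e2 : max (-1 / 2) (min t 0) = -1 / 2 := by
    rw [min_eq_left (by linarith), max_eq_left h]
  have e3 : max 0 (min t 1) = 0 := by rw [min_eq_left (by linarith), max_eq_left (by linarith)]
  have e4 : max 1 (min t (3 / 2)) = 1 := by
    rw [min_eq_left (by linarith), max_eq_left (by linarith)]
  have e5 : max (t - 3 / 2) 0 = 0 := max_eq_right (by linarith)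
  rw [levelMap, e1, e2, e3, e4, e5]
  norm_num [sqrt_quarter]

theorem levelMap_top {t : ℝ} (h : t ∈ Icc (-1 / 2 : ℝ) 0) :
    levelMap δ₁ δ₂ t = 2 * δ₁ * √(1 / 4 - t ^ 2) := by
  have e1 : min (t + 1 / 2) 0 = 0 := min_eq_right (by linarith [h.1])
  have e2 : max (-1 / 2) (min t 0) = t := by
    rw [min_eq_left h.2, max_eq_right h.1]
  have e3 : max 0 (min t 1) = 0 := by
    rw [min_eq_left (by linarith [h.2]), max_eq_left h.2]
  have e4 : max 1 (min t (3 / 2)) = 1 := by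
    rw [min_eq_left (by linarith [h.2]), max_eq_left (by linarith [h.2])]
  have e5 : max (t - 3 / 2) 0 = 0 := max_eq_right (by linarith [h.2])
  rw [levelMap, e1, e2, e3, e4, e5, sub_self, zero_pow two_ne_zero, sub_zero, sqrt_quarter]
  ring

theorem levelMap_braid {t : ℝ} (h : t ∈ Icc (0 : ℝ) 1) :
    levelMap δ₁ δ₂ t = δ₁ + (1 - δ₁ - δ₂) * t := by
  have e1 : min (t + 1 / 2) 0 = 0 := min_eq_right (by linarith [h.1])
  have e2 : max (-1 / 2) (min t 0) = 0 := by
    rw [min_eq_right h.1, max_eq_right (by norm_num)]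
  have e3 : max 0 (min t 1) = t := by
    rw [min_eq_left h.2, max_eq_right h.1]
  have e4 : max 1 (min t (3 / 2)) = 1 := by
    rw [min_eq_left (by linarith [h.2]), max_eq_left h.2]
  have e5 : max (t - 3 / 2) 0 = 0 := max_eq_right (by linarith [h.2])
  rw [levelMap, e1, e2, e3, e4, e5, sub_self, zero_pow two_ne_zero, sub_zero, sqrt_quarter]
  ring

theorem levelMap_bottom {t : ℝ} (h : t ∈ Icc (1 : ℝ) (3 / 2)) :
    levelMap δ₁ δ₂ t = 1 - 2 * δ₂ * √(1 / 4 - (t - 1) ^ 2) := by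
  have e1 : min (t + 1 / 2) 0 = 0 := min_eq_right (by linarith [h.1])
  have e2 : max (-1 / 2) (min t 0) = 0 := by
    rw [min_eq_right (by linarith [h.1]), max_eq_right (by norm_num)]
  have e3 : max 0 (min t 1) = 1 := by
    rw [min_eq_right h.1, max_eq_right (by norm_num)]
  have e4 : max 1 (min t (3 / 2)) = t := by
    rw [min_eq_left h.2, max_eq_right h.1]
  have e5 : max (t - 3 / 2) 0 = 0 := max_eq_right (by linarith [h.2])
  rw [levelMap, e1, e2, e3, e4, e5, zero_pow two_ne_zero, sub_zero, sqrt_quarter]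
  ring

theorem levelMap_of_ge {t : ℝ} (h : 3 / 2 ≤ t) : levelMap δ₁ δ₂ t = t - 1 / 2 := by
  have e1 : min (t + 1 / 2) 0 = 0 := min_eq_right (by linarith)
  have e2 : max (-1 / 2) (min t 0) = 0 := by
    rw [min_eq_right (by linarith), max_eq_right (by norm_num)]
  have e3 : max 0 (min t 1) = 1 := by
    rw [min_eq_right (by linarith), max_eq_right (by norm_num)]
  have e4 : max 1 (min t (3 / 2)) = 3 / 2 := by
    rw [min_eq_right h, max_eq_right (by norm_num)]
  have e5 : max (t - 3 / 2) 0 = t - 3 / 2 := max_eq_left (by linarith)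
  have e6 : √(1 / 4 - (3 / 2 - 1 : ℝ) ^ 2) = 0 := by norm_num
  rw [levelMap, e1, e2, e3, e4, e5, e6, zero_pow two_ne_zero, sub_zero, sqrt_quarter]
  ring

theorem continuous_levelMap : Continuous (levelMap δ₁ δ₂) := by
  unfold levelMap
  fun_prop

theorem strictMono_levelMap (h₁ : 0 < δ₁) (h₂ : 0 < δ₂) (h : δ₁ + δ₂ < 1) :
    StrictMono (levelMap δ₁ δ₂) := by
  intro t t' htt
  unfold levelMap
  have m1 : min (t + 1 / 2) 0 ≤ min (t' + 1 / 2) 0 := by gcongr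
  have m3 : max 0 (min t 1) ≤ max 0 (min t' 1) := by gcongr
  have m5 : max (t - 3 / 2) 0 ≤ max (t' - 3 / 2) 0 := by gcongr
  have m2 : max (-1 / 2) (min t 0) ≤ max (-1 / 2) (min t' 0) := by gcongr
  have m4 : max 1 (min t (3 / 2)) ≤ max 1 (min t' (3 / 2)) := by gcongr
  have l2 : -1 / 2 ≤ max (-1 / 2) (min t 0) := le_max_left _ _
  have u2 : max (-1 / 2) (min t' 0) ≤ 0 := max_le (by norm_num) (min_le_right _ _)
  have l4 : 1 ≤ max 1 (min t (3 / 2)) := le_max_left _ _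
  have u4 : max 1 (min t' (3 / 2)) ≤ 3 / 2 := max_le (by norm_num) (min_le_right _ _)
  set u := max (-1 / 2) (min t 0)
  set u' := max (-1 / 2) (min t' 0)
  set v := max 1 (min t (3 / 2))
  set v' := max 1 (min t' (3 / 2))
  have s2 : √(1 / 4 - u ^ 2) ≤ √(1 / 4 - u' ^ 2) := Real.sqrt_le_sqrt (by nlinarith)
  have s4 : √(1 / 4 - (v' - 1) ^ 2) ≤ √(1 / 4 - (v - 1) ^ 2) := Real.sqrt_le_sqrt (by nlinarith)
  have p2 := mul_le_mul_of_nonneg_left s2 h₁.le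
  have p4 := mul_le_mul_of_nonneg_left s4 h₂.le
  have p3 := mul_le_mul_of_nonneg_left m3 (by linarith : 0 ≤ 1 - δ₁ - δ₂)
  -- one of the five summands is strictly increasing on the interval that contains `t` on its left
  rcases lt_or_ge t (-1 / 2) with c1 | c1
  · have : min (t + 1 / 2) 0 < min (t' + 1 / 2) 0 := by
      rw [min_eq_left (by linarith)]
      exact lt_min (by linarith) (by linarith)
    linarith
  rcases lt_or_ge t 0 with c2 | c2
  · have hu : u = t := by simp only [u]; rw [min_eq_left c2.le, max_eq_right c1]
    have hu' : u < u' := by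
      rw [hu]
      exact (lt_min htt c2).trans_le (le_max_right _ _)
    have : √(1 / 4 - u ^ 2) < √(1 / 4 - u' ^ 2) := Real.sqrt_lt_sqrt (by nlinarith) (by nlinarith)
    have := mul_lt_mul_of_pos_left this h₁
    linarith
  rcases lt_or_ge t 1 with c3 | c3
  · have : max 0 (min t 1) < max 0 (min t' 1) := by
      rw [min_eq_left c3.le, max_eq_right c2]
      exact (lt_min htt c3).trans_le (le_max_right _ _)
    have := mul_lt_mul_of_pos_left this (by linarith : 0 < 1 - δ₁ - δ₂)
    linarith
  rcases lt_or_ge t (3 / 2) with c4 | c4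
  · have hv : v = t := by simp only [v]; rw [min_eq_left c4.le, max_eq_right c3]
    have hv' : v < v' := by
      rw [hv]
      exact (lt_min htt c4).trans_le (le_max_right _ _)
    have : √(1 / 4 - (v' - 1) ^ 2) < √(1 / 4 - (v - 1) ^ 2) :=
      Real.sqrt_lt_sqrt (by nlinarith) (by nlinarith)
    have := mul_lt_mul_of_pos_left this h₂
    linarith
  · have : max (t - 3 / 2) 0 < max (t' - 3 / 2) 0 := by
      rw [max_eq_left (by linarith), max_eq_left (by linarith)]
      linarith
    linarith

theorem abs_levelMap_sub_le (h₁ : 0 < δ₁) (h₂ : 0 < δ₂) (h : δ₁ + δ₂ < 1) (t : ℝ) :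
    |levelMap δ₁ δ₂ t - t| ≤ 3 / 2 := by
  rcases le_total t (-1 / 2) with c1 | c1
  · rw [levelMap_of_le c1, abs_le]; constructor <;> linarith
  rcases le_total (3 / 2) t with c2 | c2
  · rw [levelMap_of_ge c2, abs_le]; constructor <;> linarith
  have m := (strictMono_levelMap h₁ h₂ h).monotone
  have e1 := m c1
  have e2 := m c2
  rw [levelMap_of_le le_rfl] at e1
  rw [levelMap_of_ge le_rfl] at e2
  rw [abs_le]; constructor <;> linarith

end LevelMap

/-- A strictly increasing change of levels is realized by an ambient isotopy, which moves linearly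
from the identity. -/
theorem isotopic_of_levels {ι : Type*} (X : ι → Set E3) (χ : ℝ → ℝ) (hc : Continuous χ)
    (hm : StrictMono χ) (C : ℝ) (hC : ∀ t, |χ t - t| ≤ C) :
    Isotopic (fun i => toS3 (X i)) fun i => toS3 ((fun x : E3 => ((x.1, χ x.2) : E3)) '' X i) := by
  have hC0 : 0 ≤ C := (abs_nonneg _).trans (hC 0)
  have main := isotopic_of_family X (fun s x => ((x.1, x.2 + s * (χ x.2 - x.2)) : E3)) ?_ ?_ ?_
    (1 + C) ?_
  · convert main using 4
    rw [one_mul, add_sub_cancel]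
  · exact (continuous_fst.comp continuous_snd).prodMk ((continuous_snd.comp continuous_snd).add
      (continuous_fst.mul ((hc.comp (continuous_snd.comp continuous_snd)).sub
        (continuous_snd.comp continuous_snd))))
  · intro s hs
    have hsm : StrictMono fun t => t + s * (χ t - t) := by
      intro t t' htt
      have h1 := hm htt
      have h2 : t + s * (χ t - t) = (1 - s) * t + s * χ t := by ring
      have h3 : t' + s * (χ t' - t') = (1 - s) * t' + s * χ t' := by ring
      simp only [h2, h3]
      rcases hs.1.eq_or_lt with h0 | h0
      · rw [← h0]; simpa using htt
      · have h4 := mul_lt_mul_of_pos_left h1 h0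
        have h5 := mul_le_mul_of_nonneg_left htt.le (sub_nonneg.2 hs.2)
        linarith
    have hsc : Continuous fun t => t + s * (χ t - t) := by fun_prop
    have habs (t : ℝ) : |s * (χ t - t)| ≤ C := by
      rw [abs_mul, abs_of_nonneg hs.1]
      calc s * |χ t - t| ≤ 1 * |χ t - t| := by gcongr; exact hs.2
        _ ≤ C := by rw [one_mul]; exact hC t
    constructor
    · rintro ⟨z, t⟩ ⟨z', t'⟩ hzz
      obtain ⟨h1, h2⟩ := Prod.mk.inj hzz
      exact Prod.ext h1 (hsm.injective h2)
    · rintro ⟨z, y⟩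
      obtain ⟨t, ht⟩ := mem_range_of_exists_le_of_exists_ge (c := y) hsc
        ⟨y - C, by linarith [(abs_le.1 (habs (y - C))).2]⟩
        ⟨y + C, by linarith [(abs_le.1 (habs (y + C))).1]⟩
      exact ⟨(z, t), Prod.ext rfl ht⟩
  · intro x; simp
  · rintro s hs ⟨z, t⟩
    have h1 : ‖((z, t) : E3)‖ = max ‖z‖ ‖t‖ := rfl
    have h2 : ‖((z, t + s * (χ t - t)) : E3)‖ = max ‖z‖ ‖t + s * (χ t - t)‖ := rfl
    have h3 : ‖t‖ ≤ ‖t + s * (χ t - t)‖ + C := by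
      have : ‖t‖ ≤ ‖t + s * (χ t - t)‖ + ‖s * (χ t - t)‖ := by
        simpa using norm_sub_le (t + s * (χ t - t)) (s * (χ t - t))
      refine this.trans (add_le_add_right ?_ _)
      rw [norm_mul, Real.norm_of_nonneg hs.1]
      calc s * ‖χ t - t‖ ≤ 1 * ‖χ t - t‖ := by gcongr; exact hs.2
        _ ≤ C := by rw [one_mul]; exact hC t
    rw [h1, h2]
    have h4 := le_max_left ‖z‖ ‖t + s * (χ t - t)‖
    have h5 := le_max_right ‖z‖ ‖t + s * (χ t - t)‖
    have h6 := norm_nonneg z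
    refine max_le ?_ ?_ <;> nlinarith

/-- The centre of the arc that ends at the point with the number `k`. -/
noncomputable def arcCenter (k : ℕ) : ℝ := 2 * ((k / 2 : ℕ) : ℝ) + 1 / 2

/-- The side of the arc on which the point with the number `k` lies. -/
noncomputable def arcSide (k : ℕ) : ℝ := if k % 2 = 0 then -1 else 1

theorem arcCenter_even (i : ℕ) : arcCenter (2 * i) = 2 * i + 1 / 2 := by
  rw [arcCenter, Nat.mul_div_cancel_left i two_pos]

theorem arcCenter_odd (i : ℕ) : arcCenter (2 * i + 1) = 2 * i + 1 / 2 := by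
  rw [arcCenter, show (2 * i + 1) / 2 = i by omega]

theorem arcSide_even (i : ℕ) : arcSide (2 * i) = -1 := by
  rw [arcSide, if_pos (by omega)]

theorem arcSide_odd (i : ℕ) : arcSide (2 * i + 1) = 1 := by
  rw [arcSide, if_neg (by omega)]

theorem arcSide_sq (k : ℕ) : arcSide k ^ 2 = 1 := by
  rw [arcSide]; split_ifs <;> norm_num

theorem arcCenter_add_arcSide (k : ℕ) : arcCenter k + 1 / 2 * arcSide k = k := by
  rcases Nat.even_or_odd' k with ⟨i, rfl | rfl⟩
  · rw [arcCenter_even, arcSide_even]; push_cast; ring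
  · rw [arcCenter_odd, arcSide_odd]; push_cast; ring

theorem arcCenter_eq_iff {k l : ℕ} : arcCenter k = arcCenter l ↔ k / 2 = l / 2 := by
  rw [arcCenter, arcCenter]
  constructor
  · intro h
    have : ((k / 2 : ℕ) : ℝ) = ((l / 2 : ℕ) : ℝ) := by linarith
    exact_mod_cast this
  · intro h; rw [h]

theorem two_le_arcCenter_sub {k l : ℕ} (h : k / 2 ≠ l / 2) : 2 ≤ |arcCenter k - arcCenter l| := by
  rw [arcCenter, arcCenter]
  generalize k / 2 = a at h ⊢
  generalize l / 2 = b at h ⊢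
  have e : (2 * (a : ℝ) + 1 / 2) - (2 * (b : ℝ) + 1 / 2) = 2 * (((a : ℤ) - (b : ℤ) : ℤ) : ℝ) := by
    push_cast; ring
  have : 1 ≤ |(a : ℤ) - (b : ℤ)| := Int.one_le_abs (by omega)
  have h2 : (1 : ℝ) ≤ |(((a : ℤ) - (b : ℤ) : ℤ) : ℝ)| := by
    rw [← Int.cast_abs]; exact_mod_cast this
  rw [e, abs_mul, abs_two]
  linarith

theorem arc_injective {r : ℝ} (hr : 0 < r) (hr' : r ≤ 1 / 2) {k l : ℕ}
    (h : arcCenter k + r * arcSide k = arcCenter l + r * arcSide l) : k = l := by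
  by_cases hkl : k / 2 = l / 2
  · have h1 : arcSide k = arcSide l := by
      rw [arcCenter_eq_iff.2 hkl] at h
      exact mul_left_cancel₀ hr.ne' (by linarith)
    simp only [arcSide] at h1
    split_ifs at h1 <;> first | omega | norm_num at h1
  · have h1 := two_le_arcCenter_sub hkl
    have h2 : arcCenter k - arcCenter l = r * (arcSide l - arcSide k) := by linarith
    have h3 : |arcSide l - arcSide k| ≤ 2 := by
      simp only [arcSide]
      split_ifs <;> norm_num
    rw [h2, abs_mul, abs_of_pos hr] at h1
    nlinarith

theorem exists_mate {n : ℕ} (k : Fin (2 * n)) :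
    ∃ l : Fin (2 * n), l ≠ k ∧ ∀ m : Fin (2 * n), (m : ℕ) / 2 = k / 2 ↔ m = k ∨ m = l := by
  have hk := k.2
  refine ⟨⟨if (k : ℕ) % 2 = 0 then k + 1 else k - 1, by split_ifs <;> omega⟩, ?_, fun m => ?_⟩
  · intro h
    have := congrArg Fin.val h
    simp only at this
    split_ifs at this <;> omega
  · rw [Fin.ext_iff, Fin.ext_iff]
    simp only
    split_ifs <;> omega

/-- Strings that are wedges, with their tips at the centres of the arcs, near the levels `0` and
`1`, and that are a braid in between; `bot k` is the number of the lower end point of the string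
with the number `k`. -/
structure IsWedgePlat {n : ℕ} (q : Fin (2 * n) → ℝ → ℂ) (δ₁ δ₂ : ℝ) (β : GeometricBraid (2 * n))
    (bot : Fin (2 * n) → Fin (2 * n)) : Prop where
  pos₁ : 0 < δ₁
  pos₂ : 0 < δ₂
  add_lt : δ₁ + δ₂ < 1
  surjective : Function.Surjective bot
  top_eq : ∀ k, ∀ t ∈ Icc 0 δ₁, q k t = ((arcCenter k + t / (2 * δ₁) * arcSide k : ℝ) : ℂ)
  braid_eq : ∀ k, ∀ t : I, q k (δ₁ + (1 - δ₁ - δ₂) * t) = β.path k t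
  bottom_eq : ∀ k, ∀ t ∈ Icc 0 δ₂,
    q k (1 - t) = ((arcCenter (bot k) + t / (2 * δ₂) * arcSide (bot k) : ℝ) : ℂ)

/-- The change of levels, as a map of Euclidean 3-space. -/
noncomputable def levelChange (δ₁ δ₂ : ℝ) (x : E3) : E3 := (x.1, levelMap δ₁ δ₂ x.2)

theorem mem_strand {q : ℝ → ℂ} {t : ℝ} (ht : t ∈ Icc (0 : ℝ) 1) : ((q t, t) : E3) ∈ strand q :=
  ⟨t, ht, rfl⟩

/-- A point at distance `1/2` from the centre of an arc, at the level `-s` relative to it. -/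
theorem exists_side {i : ℕ} {x s : ℝ} (h : (x - (2 * i + 1 / 2)) ^ 2 + s ^ 2 = (1 / 2) ^ 2) :
    ∃ k, (k = 2 * i ∨ k = 2 * i + 1) ∧ x = arcCenter k + √(1 / 4 - s ^ 2) * arcSide k := by
  have h1 : √(1 / 4 - s ^ 2) = |x - (2 * i + 1 / 2)| := by
    rw [← Real.sqrt_sq_eq_abs]; congr 1; linarith
  rw [h1]
  rcases le_total x (2 * i + 1 / 2) with c | c
  · refine ⟨2 * i, Or.inl rfl, ?_⟩
    rw [arcCenter_even, arcSide_even, abs_of_nonpos (by linarith)]; ring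
  · refine ⟨2 * i + 1, Or.inr rfl, ?_⟩
    rw [arcCenter_odd, arcSide_odd, abs_of_nonneg (by linarith)]; ring

namespace IsWedgePlat

variable {n : ℕ} {q : Fin (2 * n) → ℝ → ℂ} {δ₁ δ₂ : ℝ} {β : GeometricBraid (2 * n)}
  {bot : Fin (2 * n) → Fin (2 * n)}

theorem image_topArc_subset (h : IsWedgePlat q δ₁ δ₂ β bot) (i : Fin n) :
    levelChange δ₁ δ₂ '' topArc i ⊆ ⋃ k : {k : Fin (2 * n) // (k : ℕ) / 2 = i}, strand (q k) := by
  rintro _ ⟨⟨z, t⟩, ⟨hz, ht, hzt⟩, rfl⟩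
  simp only at hz ht hzt
  obtain ⟨k, hk, hx⟩ := exists_side hzt
  have hi := i.2
  have hpos := h.pos₁
  have hlt := h.add_lt
  have hpos₂ := h.pos₂
  have ht2 : t ∈ Icc (-1 / 2 : ℝ) 0 := ⟨by nlinarith, ht⟩
  have hs : √(1 / 4 - t ^ 2) ≤ 1 / 2 := by
    rw [← sqrt_quarter]; exact Real.sqrt_le_sqrt (by nlinarith)
  have hs0 := Real.sqrt_nonneg (1 / 4 - t ^ 2)
  refine mem_iUnion.2 ⟨⟨⟨k, by omega⟩, by simp only; omega⟩, ?_⟩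
  have hmem : 2 * δ₁ * √(1 / 4 - t ^ 2) ∈ Icc 0 δ₁ := ⟨by positivity, by nlinarith⟩
  have : levelChange δ₁ δ₂ (z, t) =
      (q ⟨k, by omega⟩ (2 * δ₁ * √(1 / 4 - t ^ 2)), 2 * δ₁ * √(1 / 4 - t ^ 2)) := by
    rw [h.top_eq _ _ hmem, levelChange, levelMap_top ht2]
    refine Prod.ext ?_ rfl
    simp only
    rw [mul_div_cancel_left₀ _ (by positivity)]
    apply Complex.ext
    · rw [Complex.ofReal_re, hx]
    · rw [Complex.ofReal_im, hz]
  rw [this]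
  exact mem_strand ⟨hmem.1, hmem.2.trans (by linarith)⟩

theorem image_bottomArc_subset (h : IsWedgePlat q δ₁ δ₂ β bot) (i : Fin n) :
    levelChange δ₁ δ₂ '' bottomArc i ⊆
      ⋃ k : {k : Fin (2 * n) // (bot k : ℕ) / 2 = i}, strand (q k) := by
  rintro _ ⟨⟨z, t⟩, ⟨hz, ht, hzt⟩, rfl⟩
  simp only at hz ht hzt
  obtain ⟨k, hk, hx⟩ := exists_side hzt
  have hi := i.2
  have hpos := h.pos₁
  have hlt := h.add_lt
  have hpos₂ := h.pos₂
  have ht2 : t ∈ Icc (1 : ℝ) (3 / 2) := ⟨ht, by nlinarith⟩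
  have hs : √(1 / 4 - (t - 1) ^ 2) ≤ 1 / 2 := by
    rw [← sqrt_quarter]; exact Real.sqrt_le_sqrt (by nlinarith)
  have hs0 := Real.sqrt_nonneg (1 / 4 - (t - 1) ^ 2)
  obtain ⟨j, hj⟩ := h.surjective ⟨k, by omega⟩
  refine mem_iUnion.2 ⟨⟨j, by rw [hj]; simp only; omega⟩, ?_⟩
  have hmem : 2 * δ₂ * √(1 / 4 - (t - 1) ^ 2) ∈ Icc 0 δ₂ := ⟨by positivity, by nlinarith⟩
  have : levelChange δ₁ δ₂ (z, t) =
      (q j (1 - 2 * δ₂ * √(1 / 4 - (t - 1) ^ 2)), 1 - 2 * δ₂ * √(1 / 4 - (t - 1) ^ 2)) := by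
    rw [h.bottom_eq _ _ hmem, levelChange, levelMap_bottom ht2]
    refine Prod.ext ?_ rfl
    simp only
    rw [mul_div_cancel_left₀ _ (by positivity), hj]
    apply Complex.ext
    · rw [Complex.ofReal_re, hx]
    · rw [Complex.ofReal_im, hz]
  rw [this]
  exact mem_strand ⟨by linarith [hmem.2], by linarith [hmem.1]⟩

theorem image_string_subset (h : IsWedgePlat q δ₁ δ₂ β bot) (k : Fin (2 * n)) :
    levelChange δ₁ δ₂ '' β.string k ⊆ strand (q k) := by
  rintro _ ⟨_, ⟨t, rfl⟩, rfl⟩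
  have hpos := h.pos₁
  have hlt := h.add_lt
  have hpos₂ := h.pos₂
  have ht := t.2
  simp only [levelChange]
  rw [levelMap_braid ht, ← h.braid_eq]
  exact mem_strand ⟨by nlinarith [ht.1], by nlinarith [ht.2]⟩

theorem mem_image_topArc (h : IsWedgePlat q δ₁ δ₂ β bot) (k : Fin (2 * n)) {t : ℝ}
    (ht : t ∈ Icc 0 δ₁) : ((q k t, t) : E3) ∈ levelChange δ₁ δ₂ '' topArc ((k : ℕ) / 2) := by
  have hpos := h.pos₁
  have h1 : t / (2 * δ₁) ≤ 1 / 2 := by rw [div_le_iff₀ (by positivity)]; linarith [ht.2]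
  have h0 : 0 ≤ t / (2 * δ₁) := div_nonneg ht.1 (by positivity)
  have hsq : √(1 / 4 - (t / (2 * δ₁)) ^ 2) ^ 2 = 1 / 4 - (t / (2 * δ₁)) ^ 2 :=
    Real.sq_sqrt (by nlinarith)
  have hs0 := Real.sqrt_nonneg (1 / 4 - (t / (2 * δ₁)) ^ 2)
  have hs : √(1 / 4 - (t / (2 * δ₁)) ^ 2) ≤ 1 / 2 := by
    rw [← sqrt_quarter]; exact Real.sqrt_le_sqrt (by nlinarith)
  refine ⟨(q k t, -√(1 / 4 - (t / (2 * δ₁)) ^ 2)), ⟨?_, by simp, ?_⟩, ?_⟩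
  · rw [h.top_eq k t ht]; exact Complex.ofReal_im _
  · rw [h.top_eq k t ht]
    simp only [Complex.ofReal_re, neg_sq, hsq]
    have : arcCenter k = 2 * (((k : ℕ) / 2 : ℕ) : ℝ) + 1 / 2 := rfl
    rw [this, add_sub_cancel_left, mul_pow, arcSide_sq]
    ring
  · rw [levelChange, levelMap_top ⟨by linarith, by linarith⟩]
    refine Prod.ext rfl ?_
    simp only [neg_sq, hsq]
    rw [sub_sub_cancel, Real.sqrt_sq h0]
    field_simp

theorem mem_image_bottomArc (h : IsWedgePlat q δ₁ δ₂ β bot) (k : Fin (2 * n)) {t : ℝ}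
    (ht : t ∈ Icc 0 δ₂) :
    ((q k (1 - t), 1 - t) : E3) ∈ levelChange δ₁ δ₂ '' bottomArc ((bot k : ℕ) / 2) := by
  have hpos := h.pos₂
  have h1 : t / (2 * δ₂) ≤ 1 / 2 := by rw [div_le_iff₀ (by positivity)]; linarith [ht.2]
  have h0 : 0 ≤ t / (2 * δ₂) := div_nonneg ht.1 (by positivity)
  have hsq : √(1 / 4 - (t / (2 * δ₂)) ^ 2) ^ 2 = 1 / 4 - (t / (2 * δ₂)) ^ 2 :=
    Real.sq_sqrt (by nlinarith)
  have hs0 := Real.sqrt_nonneg (1 / 4 - (t / (2 * δ₂)) ^ 2)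
  have hs : √(1 / 4 - (t / (2 * δ₂)) ^ 2) ≤ 1 / 2 := by
    rw [← sqrt_quarter]; exact Real.sqrt_le_sqrt (by nlinarith)
  refine ⟨(q k (1 - t), 1 + √(1 / 4 - (t / (2 * δ₂)) ^ 2)), ⟨?_, by simp, ?_⟩, ?_⟩
  · rw [h.bottom_eq k t ht]; exact Complex.ofReal_im _
  · rw [h.bottom_eq k t ht]
    simp only [Complex.ofReal_re, add_sub_cancel_left, hsq]
    have : arcCenter (bot k) = 2 * (((bot k : ℕ) / 2 : ℕ) : ℝ) + 1 / 2 := rfl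
    rw [this, add_sub_cancel_left, mul_pow, arcSide_sq]
    ring
  · rw [levelChange, levelMap_bottom ⟨by linarith, by linarith⟩]
    refine Prod.ext rfl ?_
    simp only [add_sub_cancel_left, hsq]
    rw [sub_sub_cancel, Real.sqrt_sq h0]
    field_simp

theorem image_plat (h : IsWedgePlat q δ₁ δ₂ β bot) :
    levelChange δ₁ δ₂ '' β.plat = ⋃ k, strand (q k) := by
  have hpos := h.pos₁
  have hlt := h.add_lt
  have hpos₂ := h.pos₂
  apply Subset.antisymm
  · rw [GeometricBraid.plat, image_union, image_union, image_iUnion, image_iUnion, image_iUnion]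
    refine union_subset (union_subset ?_ ?_) ?_
    · exact iUnion_mono h.image_string_subset
    · exact iUnion_subset fun i => (h.image_topArc_subset i).trans
        (iUnion_subset fun k => subset_iUnion (fun k => strand (q k)) k.1)
    · exact iUnion_subset fun i => (h.image_bottomArc_subset i).trans
        (iUnion_subset fun k => subset_iUnion (fun k => strand (q k)) k.1)
  · refine iUnion_subset fun k => ?_
    rintro _ ⟨t, ht, rfl⟩
    simp only
    rcases le_total t δ₁ with c1 | c1
    · refine image_mono ?_ (h.mem_image_topArc k ⟨ht.1, c1⟩)
      refine subset_union_of_subset_left (subset_union_of_subset_right ?_ _) _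
      have hk := k.2
      exact subset_iUnion (fun i : Fin n => topArc i) ⟨(k : ℕ) / 2, by omega⟩
    rcases le_total t (1 - δ₂) with c2 | c2
    · have h3 : 0 < 1 - δ₁ - δ₂ := by linarith
      have hu : (t - δ₁) / (1 - δ₁ - δ₂) ∈ Icc (0 : ℝ) 1 :=
        ⟨div_nonneg (by linarith) h3.le, by rw [div_le_one h3]; linarith⟩
      have h4 : δ₁ + (1 - δ₁ - δ₂) * ((t - δ₁) / (1 - δ₁ - δ₂)) = t := by field_simp; ring
      have h5 := h.braid_eq k ⟨_, hu⟩
      simp only [h4] at h5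
      refine ⟨(β.path k ⟨_, hu⟩, (t - δ₁) / (1 - δ₁ - δ₂)), ?_, ?_⟩
      · exact Or.inl (Or.inl (mem_iUnion.2 ⟨k, ⟨_, hu⟩, rfl⟩))
      · rw [levelChange, levelMap_braid hu]
        exact Prod.ext h5.symm h4
    · have := h.mem_image_bottomArc k (t := 1 - t) ⟨by linarith [ht.2], by linarith⟩
      rw [sub_sub_cancel] at this
      refine image_mono ?_ this
      refine subset_union_of_subset_right ?_ _
      have hk := (bot k).2
      exact subset_iUnion (fun i : Fin n => bottomArc i) ⟨(bot k : ℕ) / 2, by omega⟩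

end IsWedgePlat

theorem isotopic_levelChange {ι : Type*} (X : ι → Set E3) {δ₁ δ₂ : ℝ} (h₁ : 0 < δ₁) (h₂ : 0 < δ₂)
    (h : δ₁ + δ₂ < 1) :
    Isotopic (fun i => toS3 (X i)) fun i => toS3 (levelChange δ₁ δ₂ '' X i) :=
  isotopic_of_levels X _ continuous_levelMap (strictMono_levelMap h₁ h₂ h) _
    (abs_levelMap_sub_le h₁ h₂ h)

/-- Every plat is isotopic to a pointed plat with the same number of strings. -/
theorem GeometricBraid.exists_isPointedPlat {n : ℕ} (β : GeometricBraid (2 * n)) :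
    ∃ q : Fin (2 * n) → ℝ → ℂ, IsPointedPlat q ∧
      Isotopic (fun _ : Unit => toS3 β.plat) fun _ => ⋃ k, toS3 (strand (q k)) := by
  have hbot (k) : ∃ l : Fin (2 * n), β.path k 1 = endpoint l := by
    have : β.path k 1 ∈ Set.range fun k : Fin (2 * n) => endpoint k := by
      rw [← β.range_path_one]; exact ⟨k, rfl⟩
    obtain ⟨l, hl⟩ := this
    exact ⟨l, hl.symm⟩
  choose bot hbot using hbot
  have hinj : Function.Injective bot := by
    intro k l hkl
    by_contra hne
    exact β.path_ne 1 k l hne (by rw [hbot, hbot, hkl])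
  have hend (k : ℕ) : endpoint k = ((arcCenter k + 1 / 2 * arcSide k : ℝ) : ℂ) := by
    rw [arcCenter_add_arcSide, endpoint]; simp
  let q : Fin (2 * n) → ℝ → ℂ := fun k t =>
    β.path k (projIcc 0 1 zero_le_one (3 * t - 1)) +
      ((3 / 2 * min (t - 1 / 3) 0 * arcSide k + 3 / 2 * min (2 / 3 - t) 0 * arcSide (bot k) : ℝ) : ℂ)
  have hq0 (k : Fin (2 * n)) (t : ℝ) (ht : t ≤ 1 / 3) :
      q k t = ((arcCenter k + 3 / 2 * t * arcSide k : ℝ) : ℂ) := by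
    have e1 : projIcc (0 : ℝ) 1 zero_le_one (3 * t - 1) = 0 :=
      projIcc_of_le_left zero_le_one (by linarith)
    simp only [q]
    rw [e1, β.path_zero, hend, min_eq_left (by linarith), min_eq_right (by linarith),
      ← Complex.ofReal_add]
    congr 1; ring
  have hqm (k : Fin (2 * n)) (t : ℝ) (ht : t ∈ Icc (1 / 3 : ℝ) (2 / 3)) :
      q k t = β.path k (projIcc 0 1 zero_le_one (3 * t - 1)) := by
    simp only [q]
    rw [min_eq_right (by linarith [ht.1]), min_eq_right (by linarith [ht.2])]
    simp
  have hq1 (k : Fin (2 * n)) (t : ℝ) (ht : 2 / 3 ≤ t) :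
      q k t = ((arcCenter (bot k) + 3 / 2 * (1 - t) * arcSide (bot k) : ℝ) : ℂ) := by
    have e1 : projIcc (0 : ℝ) 1 zero_le_one (3 * t - 1) = 1 :=
      projIcc_of_right_le zero_le_one (by linarith)
    simp only [q]
    rw [e1, hbot, hend, min_eq_right (by linarith), min_eq_left (by linarith),
      ← Complex.ofReal_add]
    congr 1; ring
  have hw : IsWedgePlat q (1 / 3) (1 / 3) β bot := by
    refine ⟨by norm_num, by norm_num, by norm_num, Finite.surjective_of_injective hinj, ?_, ?_, ?_⟩
    · intro k t ht
      rw [hq0 k t ht.2]; congr 1; ring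
    · intro k t
      have ht := t.2
      rw [hqm k _ ⟨by linarith [ht.1], by linarith [ht.2]⟩]
      congr 1
      rw [show 3 * (1 / 3 + (1 - 1 / 3 - 1 / 3) * (t : ℝ)) - 1 = t by ring, projIcc_val]
    · intro k t ht
      rw [hq1 k _ (by linarith [ht.2])]; congr 1; ring
  refine ⟨q, ⟨?_, ?_, ?_, ?_, ?_, ?_⟩, ?_⟩
  · intro k
    refine ((β.continuous_path k).comp (continuous_projIcc.comp (by fun_prop))).add ?_
    exact Complex.continuous_ofReal.comp (by fun_prop)
  · intro t ht k l hkl heq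
    rcases le_total t (1 / 3) with c1 | c1
    · rw [hq0 k t c1, hq0 l t c1] at heq
      have := arc_injective (by linarith [ht.1]) (by linarith) (Complex.ofReal_injective heq)
      exact hkl (Fin.ext this)
    rcases le_total t (2 / 3) with c2 | c2
    · rw [hqm k t ⟨c1, c2⟩, hqm l t ⟨c1, c2⟩] at heq
      exact β.path_ne _ k l hkl heq
    · rw [hq1 k t c2, hq1 l t c2] at heq
      have := arc_injective (by linarith [ht.2]) (by linarith) (Complex.ofReal_injective heq)
      exact hkl (hinj (Fin.ext this))
  · refine ⟨1 / 3, by norm_num, fun k => ((3 / 2 * arcSide k : ℝ) : ℂ), fun k t ht => ?_⟩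
    rw [hq0 k t ht.2, hq0 k 0 (by norm_num)]
    push_cast; ring
  · refine ⟨1 / 3, by norm_num, fun k => ((3 / 2 * arcSide (bot k) : ℝ) : ℂ), fun k t ht => ?_⟩
    rw [hq1 k _ (by linarith [ht.2]), hq1 k 1 (by norm_num)]
    push_cast; ring
  · intro k
    obtain ⟨l, hl, hm⟩ := exists_mate k
    refine ⟨l, hl, fun m => ?_⟩
    rw [hq0 m 0 (by norm_num), hq0 k 0 (by norm_num), ← hm m, ← arcCenter_eq_iff]
    simp
  · intro k
    obtain ⟨l, hl, hm⟩ := exists_mate (bot k)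
    obtain ⟨j, rfl⟩ := Finite.surjective_of_injective hinj l
    refine ⟨j, fun h => hl (by rw [h]), fun m => ?_⟩
    rw [hq1 m 1 (by norm_num), hq1 k 1 (by norm_num), ← hinj.eq_iff, ← hinj.eq_iff (b := j),
      ← hm (bot m), ← arcCenter_eq_iff]
    simp
  · have := isotopic_levelChange (fun _ : Unit => β.plat) hw.pos₁ hw.pos₂ hw.add_lt
    simpa only [hw.image_plat, toS3_iUnion] using this

/-! ### Adding a bridge -/

theorem IsPointedPlat.of_eq_near_ends {K : Type*} {q q' : K → ℝ → ℂ} (h : IsPointedPlat q)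
    (hc : ∀ k, Continuous (q' k)) (hne : ∀ t ∈ Ioo (0 : ℝ) 1, ∀ k l, k ≠ l → q' k t ≠ q' l t)
    {ε : ℝ} (hε : 0 < ε) (h0 : ∀ k, ∀ t ∈ Icc 0 ε, q' k t = q k t)
    (h1 : ∀ k, ∀ t ∈ Icc 0 ε, q' k (1 - t) = q k (1 - t)) : IsPointedPlat q' := by
  have e0 (k) : q' k 0 = q k 0 := h0 k 0 ⟨le_rfl, hε.le⟩
  have e1 (k) : q' k 1 = q k 1 := by simpa using h1 k 0 ⟨le_rfl, hε.le⟩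
  refine ⟨hc, hne, ?_, ?_, by simpa only [e0] using h.meet_zero, by simpa only [e1] using h.meet_one⟩
  · obtain ⟨δ, hδ, w, hw⟩ := h.linear_zero
    refine ⟨min δ ε, lt_min hδ hε, w, fun k t ht => ?_⟩
    rw [h0 k t ⟨ht.1, ht.2.trans (min_le_right _ _)⟩, e0,
      hw k t ⟨ht.1, ht.2.trans (min_le_left _ _)⟩]
  · obtain ⟨δ, hδ, w, hw⟩ := h.linear_one
    refine ⟨min δ ε, lt_min hδ hε, w, fun k t ht => ?_⟩
    rw [h1 k t ⟨ht.1, ht.2.trans (min_le_right _ _)⟩, e1,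
      hw k t ⟨ht.1, ht.2.trans (min_le_left _ _)⟩]

/-- The strings of a pointed plat may be kept vertical at the levels between `1/4` and `3/4`, by a
change of the times at which they run through the configurations. -/
theorem IsPointedPlat.exists_vertical {K : Type*} [Fintype K] [Nonempty K] {q : K → ℝ → ℂ}
    (h : IsPointedPlat q) :
    ∃ q' : K → ℝ → ℂ, IsPointedPlat q' ∧
      (∀ k, ∀ t ∈ Icc (1 / 4 : ℝ) (3 / 4), q' k t = q' k (1 / 2)) ∧
      Isotopic (fun k => toS3 (strand (q k))) fun k => toS3 (strand (q' k)) := by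
  let g : ℝ → ℝ := fun t => 1 / 2 + min (max (t - 1 / 2) 0) (max 0 (3 * (t - 1 / 2) - 3 / 4)) +
    max (min (t - 1 / 2) 0) (min 0 (3 * (t - 1 / 2) + 3 / 4))
  have hg : Continuous g := by fun_prop
  have hgm (t : ℝ) (ht : t ∈ Icc (1 / 4 : ℝ) (3 / 4)) : g t = 1 / 2 := by
    have e1 : max 0 (3 * (t - 1 / 2) - 3 / 4) = 0 := max_eq_left (by linarith [ht.2])
    have e2 : min 0 (3 * (t - 1 / 2) + 3 / 4) = 0 := min_eq_left (by linarith [ht.1])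
    simp only [g]
    rw [e1, e2, min_eq_right (le_max_right _ _), max_eq_right (min_le_right _ _)]
    norm_num
  have hg0 (t : ℝ) (ht : t ≤ 1 / 8) : g t = t := by
    simp only [g]
    rw [max_eq_right (by linarith : t - 1 / 2 ≤ 0), min_eq_left (by linarith : t - 1 / 2 ≤ 0),
      min_eq_left (le_max_left _ _), min_eq_right (by linarith : 3 * (t - 1 / 2) + 3 / 4 ≤ 0),
      max_eq_left (by linarith)]
    ring
  have hg1 (t : ℝ) (ht : 7 / 8 ≤ t) : g t = t := by
    simp only [g]
    rw [max_eq_left (by linarith : 0 ≤ t - 1 / 2), min_eq_right (by linarith : 0 ≤ t - 1 / 2),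
      max_eq_left (min_le_left _ _), max_eq_right (by linarith : 0 ≤ 3 * (t - 1 / 2) - 3 / 4),
      min_eq_left (by linarith)]
    ring
  have hgI (t : ℝ) (ht : t ∈ Ioo (0 : ℝ) 1) : g t ∈ Ioo (0 : ℝ) 1 := by
    have a1 : 0 ≤ min (max (t - 1 / 2) 0) (max 0 (3 * (t - 1 / 2) - 3 / 4)) :=
      le_min (le_max_right _ _) (le_max_left _ _)
    have a2 : min (max (t - 1 / 2) 0) (max 0 (3 * (t - 1 / 2) - 3 / 4)) < 1 / 2 :=
      (min_le_left _ _).trans_lt (max_lt (by linarith [ht.2]) (by norm_num))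
    have b1 : max (min (t - 1 / 2) 0) (min 0 (3 * (t - 1 / 2) + 3 / 4)) ≤ 0 :=
      max_le (min_le_right _ _) (min_le_left _ _)
    have b2 : -1 / 2 < max (min (t - 1 / 2) 0) (min 0 (3 * (t - 1 / 2) + 3 / 4)) :=
      (lt_min (by linarith [ht.1]) (by norm_num)).trans_le (le_max_left _ _)
    constructor <;> simp only [g] <;> linarith
  let Q : K → ℝ → ℝ → ℂ := fun k s t => q k ((1 - s) * t + s * g t)
  have hQc (k) : Continuous fun p : ℝ × ℝ => Q k p.1 p.2 :=
    (h.continuous k).comp (by fun_prop)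
  have hQend (k s t) (ht : t ≤ 1 / 8 ∨ 7 / 8 ≤ t) : Q k s t = q k t := by
    have : g t = t := ht.elim (hg0 t) (hg1 t)
    simp only [Q]
    rw [this]
    congr 1; ring
  have hQne (k l) (hkl : k ≠ l) (s) (hs : s ∈ Icc (0 : ℝ) 1) (t) (ht : t ∈ Ioo (0 : ℝ) 1) :
      Q k s t ≠ Q l s t := by
    refine h.ne _ ?_ k l hkl
    have := convex_Ioo (0 : ℝ) 1 ht (hgI t ht) (sub_nonneg.2 hs.2) hs.1 (by ring)
    simpa using this
  have hiso := isotopic_of_homotopy Q hQc (1 / 8) (7 / 8)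
    (fun k s _ t _ ht => by
      have h1 : t ≤ 1 / 8 ∨ 7 / 8 ≤ t := by
        by_contra hcon
        push Not at hcon
        exact ht ⟨hcon.1.le, hcon.2.le⟩
      rw [hQend k s t h1, hQend k 0 t h1])
    (fun k l hkl => ⟨fun _ => 1, fun s t => Q k s t - Q l s t, (hQc k).sub (hQc l),
      fun s hs t ht => ⟨sub_ne_zero.2 (hQne k l hkl s hs t
        ⟨by linarith [ht.1], by linarith [ht.2]⟩), by simp⟩⟩)
  refine ⟨fun k => Q k 1, ?_, ?_, ?_⟩
  · exact h.of_eq_near_ends (fun k => (hQc k).comp (continuous_const.prodMk continuous_id))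
      (fun t ht k l hkl => hQne k l hkl 1 ⟨zero_le_one, le_rfl⟩ t ht) (by norm_num : (0 : ℝ) < 1 / 8)
      (fun k t ht => hQend k 1 t (Or.inl ht.2))
      (fun k t ht => hQend k 1 _ (Or.inr (by linarith [ht.2])))
  · intro k t ht
    simp only [Q]
    rw [hgm t ht, hgm (1 / 2) (by constructor <;> norm_num)]
    congr 1; ring
  · have : (fun k => Q k 0) = q := by
      funext k t; simp [Q]
    simpa only [← this] using hiso

/-- A closed path that leaves `0` to the right, runs along the real axis as far as `N + 3` and
returns on the other side of the strip between `N` and `N + 3`. -/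
theorem exists_excursion {N : ℝ} (hN : 0 < N) :
    ∃ E : ℝ → ℂ, Continuous E ∧ (∀ t, t ≤ 1 / 4 ∨ 3 / 4 ≤ t → E t = 0) ∧
      (∀ t, E t = 0 ∨ 0 < (E t).re) ∧ (∀ t ≤ 3 / 8, (E t).re ≤ N) ∧
      (∀ t ∈ Icc (3 / 8 : ℝ) (1 / 2), E t = ((N + 24 * (t - 3 / 8) : ℝ) : ℂ)) ∧
      ∀ t ≥ 1 / 2, N + 3 ≤ (E t).re ∨ (E t).im = 1 ∨ (E t).re ≤ N := by
  let r : ℝ → ℝ → ℝ → ℝ := fun a b t => max 0 (min 1 ((t - a) * b))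
  have r0 (a b t : ℝ) (hb : 0 < b) (h : t ≤ a) : r a b t = 0 := by
    simp only [r]
    have : (t - a) * b ≤ 0 := mul_nonpos_of_nonpos_of_nonneg (by linarith) hb.le
    rw [min_eq_right (by linarith), max_eq_left this]
  have r1 (a b t : ℝ) (h : 1 ≤ (t - a) * b) : r a b t = 1 := by
    simp only [r]
    rw [min_eq_left h, max_eq_right zero_le_one]
  have rm (a b t : ℝ) (h : 0 ≤ (t - a) * b) (h' : (t - a) * b ≤ 1) : r a b t = (t - a) * b := by
    simp only [r]
    rw [min_eq_right h', max_eq_right h]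
  have rc (a b : ℝ) : Continuous (r a b) := by fun_prop
  let X : ℝ → ℝ := fun t => N * r (1 / 4) 8 t + 3 * r (3 / 8) 8 t - 3 * r (9 / 16) 8 t
    - N * r (11 / 16) 16 t
  let Y : ℝ → ℝ := fun t => r (1 / 2) 16 t - r (11 / 16) 16 t
  have hX1 (t : ℝ) (h : t ≤ 1 / 4) : X t = 0 := by
    simp only [X]
    rw [r0 _ _ _ _ h, r0 _ _ _ _ (by linarith), r0 _ _ _ _ (by linarith), r0 _ _ _ _ (by linarith)]
    · ring
    all_goals norm_num
  have hX2 (t : ℝ) (h : 1 / 4 ≤ t) (h' : t ≤ 3 / 8) : X t = N * ((t - 1 / 4) * 8) := by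
    simp only [X]
    rw [rm _ _ _ (by linarith) (by linarith), r0 _ _ _ _ (by linarith), r0 _ _ _ _ (by linarith),
      r0 _ _ _ _ (by linarith)]
    · ring
    all_goals norm_num
  have hX3 (t : ℝ) (h : 3 / 8 ≤ t) (h' : t ≤ 1 / 2) : X t = N + 24 * (t - 3 / 8) := by
    simp only [X]
    rw [r1 _ _ _ (by linarith), rm _ _ _ (by linarith) (by linarith), r0 _ _ _ _ (by linarith),
      r0 _ _ _ _ (by linarith)]
    · ring
    all_goals norm_num
  have hX4 (t : ℝ) (h : 1 / 2 ≤ t) (h' : t ≤ 9 / 16) : X t = N + 3 := by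
    simp only [X]
    rw [r1 _ _ _ (by linarith), r1 _ _ _ (by linarith), r0 _ _ _ _ (by linarith),
      r0 _ _ _ _ (by linarith)]
    · ring
    all_goals norm_num
  have hX5 (t : ℝ) (h : 9 / 16 ≤ t) (h' : t ≤ 11 / 16) : X t = N + 3 - 24 * (t - 9 / 16) := by
    simp only [X]
    rw [r1 _ _ _ (by linarith), r1 _ _ _ (by linarith), rm _ _ _ (by linarith) (by linarith),
      r0 _ _ _ _ (by linarith)]
    · ring
    all_goals norm_num
  have hX6 (t : ℝ) (h : 11 / 16 ≤ t) (h' : t ≤ 3 / 4) : X t = N * (1 - (t - 11 / 16) * 16) := by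
    simp only [X]
    rw [r1 _ _ _ (by linarith), r1 _ _ _ (by linarith), r1 _ _ _ (by linarith),
      rm _ _ _ (by linarith) (by linarith)]
    ring
  have hX7 (t : ℝ) (h : 3 / 4 ≤ t) : X t = 0 := by
    simp only [X]
    rw [r1 _ _ _ (by linarith), r1 _ _ _ (by linarith), r1 _ _ _ (by linarith),
      r1 _ _ _ (by linarith)]
    ring
  have hY1 (t : ℝ) (h : t ≤ 1 / 2) : Y t = 0 := by
    simp only [Y]
    rw [r0 _ _ _ (by norm_num) h, r0 _ _ _ (by norm_num) (by linarith), sub_zero]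
  have hY5 (t : ℝ) (h : 9 / 16 ≤ t) (h' : t ≤ 11 / 16) : Y t = 1 := by
    simp only [Y]
    rw [r1 _ _ _ (by linarith), r0 _ _ _ (by norm_num) h', sub_zero]
  have hY7 (t : ℝ) (h : 3 / 4 ≤ t) : Y t = 0 := by
    simp only [Y]
    rw [r1 _ _ _ (by linarith), r1 _ _ _ (by linarith), sub_self]
  have hE0 (t : ℝ) (ht : t ≤ 1 / 4 ∨ 3 / 4 ≤ t) : (⟨X t, Y t⟩ : ℂ) = 0 := by
    rcases ht with ht | ht
    · rw [hX1 t ht, hY1 t (by linarith)]; rfl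
    · rw [hX7 t ht, hY7 t ht]; rfl
  refine ⟨fun t => ⟨X t, Y t⟩, ?_, hE0, ?_, ?_, ?_, ?_⟩
  · have : (fun t => (⟨X t, Y t⟩ : ℂ)) = fun t => (X t : ℂ) + (Y t : ℂ) * Complex.I := by
      funext t; apply Complex.ext <;> simp
    rw [this]
    have hXc : Continuous X := by fun_prop
    have hYc : Continuous Y := by fun_prop
    fun_prop
  · intro t
    by_cases h0 : t ≤ 1 / 4 ∨ 3 / 4 ≤ t
    · exact Or.inl (hE0 t h0)
    right
    push Not at h0
    simp only
    rcases le_total t (3 / 8) with c | c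
    · rw [hX2 t h0.1.le c]
      exact mul_pos hN (by linarith)
    rcases le_total t (1 / 2) with c2 | c2
    · rw [hX3 t c c2]; linarith
    rcases le_total t (9 / 16) with c3 | c3
    · rw [hX4 t c2 c3]; linarith
    rcases le_total t (11 / 16) with c4 | c4
    · rw [hX5 t c3 c4]; linarith
    · rw [hX6 t c4 h0.2.le]
      exact mul_pos hN (by linarith)
  · intro t ht
    simp only
    rcases le_total t (1 / 4) with c | c
    · rw [hX1 t c]; exact hN.le
    · rw [hX2 t c ht]; nlinarith
  · intro t ht
    simp only
    rw [hX3 t ht.1 ht.2, hY1 t ht.2]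
    rfl
  · intro t ht
    simp only
    rcases le_total t (9 / 16) with c3 | c3
    · left; rw [hX4 t ht c3]
    rcases le_total t (11 / 16) with c4 | c4
    · right; left; exact hY5 t c3 c4
    rcases le_total t (3 / 4) with c5 | c5
    · right; right; rw [hX6 t c4 c5]; nlinarith
    · right; right; rw [hX7 t c5]; exact hN.le

/-- A vertical shear of Euclidean 3-space by a bounded amount. -/
theorem isotopic_of_vertical_shear {ι : Type*} (X : ι → Set E3) (G : ℂ → ℝ) (hG : Continuous G)
    (C : ℝ) (hC : ∀ z, |G z| ≤ C) :
    Isotopic (fun i => toS3 (X i)) fun i => toS3 ((fun x : E3 => ((x.1, x.2 + G x.1) : E3)) '' X i) := by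
  have hC0 : 0 ≤ C := (abs_nonneg _).trans (hC 0)
  have main := isotopic_of_family X (fun s x => ((x.1, x.2 + s * G x.1) : E3)) ?_ ?_ ?_ (1 + C) ?_
  · simpa only [one_mul] using main
  · exact (continuous_fst.comp continuous_snd).prodMk ((continuous_snd.comp continuous_snd).add
      (continuous_fst.mul (hG.comp (continuous_fst.comp continuous_snd))))
  · intro s _
    constructor
    · rintro ⟨z, t⟩ ⟨z', t'⟩ hzz
      obtain ⟨h1, h2⟩ := Prod.mk.inj hzz
      simp only at h1 h2
      subst h1
      exact Prod.ext rfl (add_right_cancel h2)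
    · rintro ⟨z, y⟩
      exact ⟨(z, y - s * G z), Prod.ext rfl (by simp)⟩
  · intro x; simp
  · rintro s hs ⟨z, t⟩
    have h1 : ‖((z, t) : E3)‖ = max ‖z‖ ‖t‖ := rfl
    have h2 : ‖((z, t + s * G z) : E3)‖ = max ‖z‖ ‖t + s * G z‖ := rfl
    have h3 : ‖t‖ ≤ ‖t + s * G z‖ + C := by
      have : ‖t‖ ≤ ‖t + s * G z‖ + ‖s * G z‖ := by
        simpa using norm_sub_le (t + s * G z) (s * G z)
      refine this.trans (add_le_add_right ?_ _)
      rw [norm_mul, Real.norm_of_nonneg hs.1]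
      calc s * ‖G z‖ ≤ 1 * ‖G z‖ := by gcongr; exact hs.2
        _ ≤ C := by rw [one_mul]; exact hC z
    simp only
    rw [h1, h2]
    have h4 := le_max_left ‖z‖ ‖t + s * G z‖
    have h5 := le_max_right ‖z‖ ‖t + s * G z‖
    have h6 := norm_nonneg z
    refine max_le ?_ ?_ <;> nlinarith

/-- If one string of a pointed plat runs through a straight horizontal segment over a part of the
plane over which there is nothing else, then a zigzag of this string adds two strings. -/
theorem IsPointedPlat.exists_zigzag {K : Type*} {q : K → ℝ → ℂ}
    (h : IsPointedPlat q) (k₀ : K) (p : ℂ)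
    (hfar : ∀ k ≠ k₀, ∀ t ∈ Icc (0 : ℝ) 1, (q k t).re < p.re)
    (hfar₀ : ∀ t ∈ Icc (0 : ℝ) (3 / 8), (q k₀ t).re ≤ p.re)
    (hseg : ∀ t ∈ Icc (3 / 8 : ℝ) (1 / 2), q k₀ t = p + ((24 * (t - 3 / 8) : ℝ) : ℂ))
    (hback : ∀ t ∈ Icc (1 / 2 : ℝ) 1,
      p.re + 3 ≤ (q k₀ t).re ∨ (q k₀ t).im = p.im + 1 ∨ (q k₀ t).re ≤ p.re) :
    ∃ q' : Option (Option K) → ℝ → ℂ, IsPointedPlat q' ∧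
      Isotopic (fun _ : Unit => ⋃ k, toS3 (strand (q k))) fun _ => ⋃ k, toS3 (strand (q' k)) := by
  classical
  let hat : ℝ → ℝ := fun u => max 0 (1 - |u|)
  have hat0 (u : ℝ) (hu : 1 ≤ |u|) : hat u = 0 := max_eq_left (by linarith)
  have hat1 (u : ℝ) (hu : |u| ≤ 1) : hat u = 1 - |u| := max_eq_right (by linarith)
  have hatb (u : ℝ) : hat u ∈ Icc (0 : ℝ) 1 :=
    ⟨le_max_left _ _, max_le zero_le_one (by linarith [abs_nonneg u])⟩
  -- the shear turns the segment, over the levels `3/8` to `1/2`, into a path that goes through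
  -- the levels `3/8`, `1`, `0`, `1/2`
  let g : ℝ → ℝ := fun x => 7 / 12 * hat (x - 1) - 11 / 24 * hat (x - 2)
  let G : ℂ → ℝ := fun z => g (z.re - p.re) * hat (z.im - p.im)
  have hGc : Continuous G := by fun_prop
  have hGb (z : ℂ) : |G z| ≤ 2 := by
    have a1 := hatb (z.re - p.re - 1)
    have a2 := hatb (z.re - p.re - 2)
    have a3 := hatb (z.im - p.im)
    have h1 : |g (z.re - p.re)| ≤ 2 := by
      rw [abs_le]; constructor <;> simp only [g] <;> linarith [a1.1, a1.2, a2.1, a2.2]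
    simp only [G]
    rw [abs_mul, abs_of_nonneg a3.1]
    nlinarith [abs_nonneg (g (z.re - p.re)), a3.1, a3.2]
  have hg0 (x : ℝ) (hx : x ≤ 0 ∨ 3 ≤ x) : g x = 0 := by
    have e1 : hat (x - 1) = 0 := hat0 _ (by rw [le_abs]; rcases hx with hx | hx <;> [right; left] <;> linarith)
    have e2 : hat (x - 2) = 0 := hat0 _ (by rw [le_abs]; rcases hx with hx | hx <;> [right; left] <;> linarith)
    simp only [g]
    rw [e1, e2]; ring
  have hg1 (x : ℝ) (hx : x ∈ Icc (0 : ℝ) 1) : g x = 7 / 12 * x := by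
    have e1 : hat (x - 1) = x := by
      rw [hat1 _ (abs_le.2 ⟨by linarith [hx.1], by linarith [hx.2]⟩), abs_of_nonpos (by linarith [hx.2])]
      ring
    have e2 : hat (x - 2) = 0 := hat0 _ (by rw [le_abs]; right; linarith [hx.2])
    simp only [g]; rw [e1, e2]; ring
  have hg2 (x : ℝ) (hx : x ∈ Icc (1 : ℝ) 2) : g x = 7 / 12 * (2 - x) - 11 / 24 * (x - 1) := by
    have e1 : hat (x - 1) = 2 - x := by
      rw [hat1 _ (abs_le.2 ⟨by linarith [hx.1], by linarith [hx.2]⟩), abs_of_nonneg (by linarith [hx.1])]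
      ring
    have e2 : hat (x - 2) = x - 1 := by
      rw [hat1 _ (abs_le.2 ⟨by linarith [hx.1], by linarith [hx.2]⟩), abs_of_nonpos (by linarith [hx.2])]
      ring
    simp only [g]; rw [e1, e2]
  have hg3 (x : ℝ) (hx : x ∈ Icc (2 : ℝ) 3) : g x = -(11 / 24 * (3 - x)) := by
    have e1 : hat (x - 1) = 0 := hat0 _ (by rw [le_abs]; left; linarith [hx.1])
    have e2 : hat (x - 2) = 3 - x := by
      rw [hat1 _ (abs_le.2 ⟨by linarith [hx.1], by linarith [hx.2]⟩), abs_of_nonneg (by linarith [hx.1])]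
      ring
    simp only [g]; rw [e1, e2]; ring
  have hG0 (z : ℂ) (hz : p.re + 3 ≤ z.re ∨ z.im = p.im + 1 ∨ z.re ≤ p.re) : G z = 0 := by
    simp only [G]
    rcases hz with hz | hz | hz
    · rw [hg0 _ (Or.inr (by linarith)), zero_mul]
    · rw [hat0 _ (by rw [hz]; simp), mul_zero]
    · rw [hg0 _ (Or.inl (by linarith)), zero_mul]
  have hGx (x : ℝ) : G (p + (x : ℂ)) = g x := by
    have : hat 0 = 1 := by rw [hat1 0 (by simp)]; simp
    simp [G, this]
  let qA : ℝ → ℂ := fun t => if t ≤ 3 / 8 then q k₀ t else p + ((8 / 5 * (t - 3 / 8) : ℝ) : ℂ)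
  let qB : ℝ → ℂ := fun t => p + ((2 - t : ℝ) : ℂ)
  let qC : ℝ → ℂ := fun t => if t ≤ 1 / 2 then p + ((2 + 2 * t : ℝ) : ℂ) else q k₀ t
  have hA1 (t : ℝ) (ht : t ≤ 3 / 8) : qA t = q k₀ t := if_pos ht
  have hA2 (t : ℝ) (ht : 3 / 8 ≤ t) : qA t = p + ((8 / 5 * (t - 3 / 8) : ℝ) : ℂ) := by
    rcases ht.eq_or_lt with h1 | h1
    · rw [← h1, hA1 _ le_rfl, hseg _ ⟨le_rfl, by norm_num⟩]; norm_num
    · exact if_neg (not_le.2 h1)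
  have hC1 (t : ℝ) (ht : t ≤ 1 / 2) : qC t = p + ((2 + 2 * t : ℝ) : ℂ) := if_pos ht
  have hC2 (t : ℝ) (ht : 1 / 2 ≤ t) : qC t = q k₀ t := by
    rcases ht.eq_or_lt with h1 | h1
    · rw [← h1, hC1 _ le_rfl, hseg _ ⟨by norm_num, le_rfl⟩]; norm_num
    · exact if_neg (not_le.2 h1)
  have hAc : Continuous qA := by
    refine Continuous.if_le (h.continuous k₀) (by fun_prop) continuous_id continuous_const ?_
    intro t ht
    have ht' : t = 3 / 8 := ht
    rw [ht', hseg _ ⟨le_rfl, by norm_num⟩]; norm_num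
  have hCc : Continuous qC := by
    refine Continuous.if_le (by fun_prop) (h.continuous k₀) continuous_id continuous_const ?_
    intro t ht
    have ht' : t = 1 / 2 := ht
    rw [ht', hseg _ ⟨by norm_num, le_rfl⟩]; norm_num
  let q' : Option (Option K) → ℝ → ℂ
    | none => qB
    | some none => qC
    | some (some k) => if k = k₀ then qA else q k
  have q'B : q' none = qB := rfl
  have q'C : q' (some none) = qC := rfl
  have q'A : q' (some (some k₀)) = qA := if_pos rfl
  have q'k (k : K) (hk : k ≠ k₀) : q' (some (some k)) = q k := if_neg hk
  have q'zero (k : K) : q' (some (some k)) 0 = q k 0 := by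
    by_cases hk : k = k₀
    · subst hk; rw [q'A, hA1 _ (by norm_num)]
    · rw [q'k k hk]
  have hend0 (k : K) : (q k 0).re < p.re := by
    by_cases hk : k = k₀
    · obtain ⟨l, hl, hm⟩ := h.meet_zero k
      rw [← (hm l).2 (Or.inr rfl)]
      exact hfar l (hk ▸ hl) 0 ⟨le_rfl, zero_le_one⟩
    · exact hfar k hk 0 ⟨le_rfl, zero_le_one⟩
  have hend1 (k : K) : (q k 1).re < p.re := by
    by_cases hk : k = k₀
    · obtain ⟨l, hl, hm⟩ := h.meet_one k
      rw [← (hm l).2 (Or.inr rfl)]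
      exact hfar l (hk ▸ hl) 1 ⟨zero_le_one, le_rfl⟩
    · exact hfar k hk 1 ⟨zero_le_one, le_rfl⟩
  -- real and imaginary parts of an equation between two points
  have hreal (z w : ℂ) (hzw : z = w) : z.re = w.re ∧ z.im = w.im := by rw [hzw]; exact ⟨rfl, rfl⟩
  have hAk (t : ℝ) (ht : t ∈ Ioo (0 : ℝ) 1) (k : K) (hk : k ≠ k₀) : qA t ≠ q k t := by
    intro heq
    rcases le_total t (3 / 8) with c | c
    · rw [hA1 t c] at heq
      exact h.ne t ht _ _ hk heq.symm
    · rw [hA2 t c] at heq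
      have h1 := (hreal _ _ heq).1
      have h2 := hfar k hk t ⟨ht.1.le, ht.2.le⟩
      simp only [Complex.add_re, Complex.ofReal_re] at h1
      linarith
  have hBk (t : ℝ) (ht : t ∈ Ioo (0 : ℝ) 1) (k : K) (hk : k ≠ k₀) : qB t ≠ q k t := by
    intro heq
    have h1 := (hreal _ _ heq).1
    have h2 := hfar k hk t ⟨ht.1.le, ht.2.le⟩
    simp only [qB, Complex.add_re, Complex.ofReal_re] at h1
    linarith [ht.2]
  have hCk (t : ℝ) (ht : t ∈ Ioo (0 : ℝ) 1) (k : K) (hk : k ≠ k₀) : qC t ≠ q k t := by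
    intro heq
    rcases le_total t (1 / 2) with c | c
    · rw [hC1 t c] at heq
      have h1 := (hreal _ _ heq).1
      have h2 := hfar k hk t ⟨ht.1.le, ht.2.le⟩
      simp only [Complex.add_re, Complex.ofReal_re] at h1
      linarith [ht.1]
    · rw [hC2 t c] at heq
      exact h.ne t ht _ _ hk heq.symm
  have hAB (t : ℝ) (ht : t ∈ Ioo (0 : ℝ) 1) : qA t ≠ qB t := by
    intro heq
    rcases le_total t (3 / 8) with c | c
    · rw [hA1 t c] at heq
      have h1 := (hreal _ _ heq).1
      have h2 := hfar₀ t ⟨ht.1.le, c⟩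
      simp only [qB, Complex.add_re, Complex.ofReal_re] at h1
      linarith
    · rw [hA2 t c] at heq
      have h1 := (hreal _ _ heq).1
      simp only [qB, Complex.add_re, Complex.ofReal_re] at h1
      linarith [ht.2]
  have hAC (t : ℝ) (ht : t ∈ Ioo (0 : ℝ) 1) : qA t ≠ qC t := by
    intro heq
    rcases le_total t (1 / 2) with c | c
    · rw [hC1 t c] at heq
      rcases le_total t (3 / 8) with c' | c'
      · rw [hA1 t c'] at heq
        have h1 := (hreal _ _ heq).1
        have h2 := hfar₀ t ⟨ht.1.le, c'⟩
        simp only [Complex.add_re, Complex.ofReal_re] at h1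
        linarith [ht.1]
      · rw [hA2 t c'] at heq
        have h1 := (hreal _ _ heq).1
        simp only [Complex.add_re, Complex.ofReal_re] at h1
        linarith
    · rw [hC2 t c, hA2 t (by linarith)] at heq
      obtain ⟨h1, h2⟩ := hreal _ _ heq
      simp only [Complex.add_re, Complex.ofReal_re, Complex.add_im, Complex.ofReal_im] at h1 h2
      rcases hback t ⟨c, ht.2.le⟩ with h3 | h3 | h3 <;> linarith [ht.2]
  have hBC (t : ℝ) (ht : t ∈ Ioo (0 : ℝ) 1) : qB t ≠ qC t := by
    intro heq
    rcases le_total t (1 / 2) with c | c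
    · rw [hC1 t c] at heq
      have h1 := (hreal _ _ heq).1
      simp only [qB, Complex.add_re, Complex.ofReal_re] at h1
      linarith [ht.1]
    · rw [hC2 t c] at heq
      obtain ⟨h1, h2⟩ := hreal _ _ heq
      simp only [qB, Complex.add_re, Complex.ofReal_re, Complex.add_im, Complex.ofReal_im] at h1 h2
      rcases hback t ⟨c, ht.2.le⟩ with h3 | h3 | h3 <;> linarith [ht.2]
  have hB0 : qB 0 = p + 2 := by simp [qB]
  have hC0 : qC 0 = p + 2 := by rw [hC1 0 (by norm_num)]; norm_num
  have hA1' : qA 1 = p + 1 := by rw [hA2 1 (by norm_num)]; norm_num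
  have hB1 : qB 1 = p + 1 := by simp only [qB]; norm_num
  have hC1' : qC 1 = q k₀ 1 := hC2 1 (by norm_num)
  have hne2 (k : K) : q k 0 ≠ p + 2 := by
    intro heq
    have h1 := (hreal _ _ heq).1
    simp only [Complex.add_re, Complex.re_ofNat] at h1
    linarith [hend0 k]
  have hne1 (k : K) : q k 1 ≠ p + 1 := by
    intro heq
    have h1 := (hreal _ _ heq).1
    simp only [Complex.add_re, Complex.one_re] at h1
    linarith [hend1 k]
  refine ⟨q', ⟨?_, ?_, ?_, ?_, ?_, ?_⟩, ?_⟩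
  · rintro (_ | _ | k)
    · change Continuous qB
      fun_prop
    · exact hCc
    · by_cases hk : k = k₀
      · subst hk; rw [q'A]; exact hAc
      · rw [q'k k hk]; exact h.continuous k
  · rintro t ht (_ | _ | k) (_ | _ | l) hkl
    · exact absurd rfl hkl
    · exact hBC t ht
    · by_cases hl : l = k₀
      · subst hl; rw [q'A]; exact (hAB t ht).symm
      · rw [q'k l hl]; exact hBk t ht l hl
    · exact (hBC t ht).symm
    · exact absurd rfl hkl
    · by_cases hl : l = k₀
      · subst hl; rw [q'A]; exact (hAC t ht).symm
      · rw [q'k l hl]; exact hCk t ht l hl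
    · by_cases hk : k = k₀
      · subst hk; rw [q'A]; exact hAB t ht
      · rw [q'k k hk]; exact (hBk t ht k hk).symm
    · by_cases hk : k = k₀
      · subst hk; rw [q'A]; exact hAC t ht
      · rw [q'k k hk]; exact (hCk t ht k hk).symm
    · have hkl' : k ≠ l := fun h' => hkl (by rw [h'])
      by_cases hk : k = k₀
      · subst hk; rw [q'A, q'k l hkl'.symm]; exact hAk t ht l hkl'.symm
      · by_cases hl : l = k₀
        · subst hl; rw [q'A, q'k k hk]; exact (hAk t ht k hk).symm
        · rw [q'k k hk, q'k l hl]; exact h.ne t ht k l hkl'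
  · obtain ⟨δ, hδ, w, hw⟩ := h.linear_zero
    refine ⟨min δ (3 / 8), by positivity, fun k => match k with
      | none => -1
      | some none => 2
      | some (some k) => w k, ?_⟩
    rintro (_ | _ | k) t ht
    · simp only [q'B, qB]; push_cast; ring
    · have := ht.2.trans (min_le_right _ _)
      simp only [q'C]
      rw [hC0, hC1 t (by linarith)]; push_cast; ring
    · have h1 := ht.2.trans (min_le_right _ _)
      have h2 := hw k t ⟨ht.1, ht.2.trans (min_le_left _ _)⟩
      rw [q'zero]
      simp only
      rw [← h2]
      by_cases hk : k = k₀
      · subst hk; rw [q'A, hA1 t h1]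
      · rw [q'k k hk]
  · obtain ⟨δ, hδ, w, hw⟩ := h.linear_one
    refine ⟨min δ (1 / 2), by positivity, fun k => match k with
      | none => 1
      | some none => w k₀
      | some (some k) => if k = k₀ then -(8 / 5) else w k, ?_⟩
    rintro (_ | _ | k) t ht
    · simp only [q'B, qB]; push_cast; ring
    · have := ht.2.trans (min_le_right _ _)
      simp only [q'C]
      rw [hC1', hC2 _ (by linarith), hw k₀ t ⟨ht.1, ht.2.trans (min_le_left _ _)⟩]
    · have h1 := ht.2.trans (min_le_right _ _)
      by_cases hk : k = k₀
      · subst hk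
        rw [q'A, hA2 _ (by linarith), hA1']
        simp only [if_true]
        push_cast; ring
      · rw [q'k k hk, hw k t ⟨ht.1, ht.2.trans (min_le_left _ _)⟩]
        simp only [hk, if_false]
  · rintro (_ | _ | k)
    · refine ⟨some none, by simp, ?_⟩
      rintro (_ | _ | m)
      · simp
      · simp [q'B, q'C, hB0, hC0]
      · rw [q'zero, q'B, hB0]
        simp [hne2]
    · refine ⟨none, by simp, ?_⟩
      rintro (_ | _ | m)
      · simp [q'B, q'C, hB0, hC0]
      · simp
      · rw [q'zero, q'C, hC0]
        simp [hne2]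
    · obtain ⟨l, hl, hm⟩ := h.meet_zero k
      refine ⟨some (some l), by simpa using hl, ?_⟩
      rintro (_ | _ | m)
      · rw [q'zero, q'B, hB0]
        simp [(hne2 k).symm]
      · rw [q'zero, q'C, hC0]
        simp [(hne2 k).symm]
      · rw [q'zero, q'zero, hm]
        simp
  · -- at the level `1`, the string `some none` takes the place of the string `k₀`
    rintro (_ | _ | k)
    · refine ⟨some (some k₀), by simp, ?_⟩
      rintro (_ | _ | m)
      · simp
      · rw [q'C, q'B, hB1, hC1']
        simp [hne1]
      · by_cases hm : m = k₀
        · subst hm; rw [q'A, q'B, hA1', hB1]; simp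
        · rw [q'k m hm, q'B, hB1]
          simp [hne1, hm]
    · obtain ⟨l, hl, hm⟩ := h.meet_one k₀
      refine ⟨some (some l), by simp, ?_⟩
      rintro (_ | _ | m)
      · rw [q'C, q'B, hB1, hC1']
        simp [(hne1 k₀).symm]
      · simp
      · by_cases hmk : m = k₀
        · subst hmk
          rw [q'A, q'C, hA1', hC1']
          simp [(hne1 m).symm, hl.symm]
        · rw [q'k m hmk, q'C, hC1', hm]
          simp [hmk]
    · by_cases hk : k = k₀
      · subst hk
        refine ⟨none, by simp, ?_⟩
        rintro (_ | _ | m)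
        · simp [q'A, q'B, hA1', hB1]
        · rw [q'A, q'C, hA1', hC1']
          simp [hne1]
        · by_cases hm : m = k
          · subst hm; simp
          · rw [q'k m hm, q'A, hA1']
            simp [hne1, hm]
      · obtain ⟨l, hl, hm⟩ := h.meet_one k
        rw [q'k k hk]
        by_cases hlk : l = k₀
        · subst hlk
          refine ⟨some none, by simp, ?_⟩
          rintro (_ | _ | m)
          · rw [q'B, hB1]; simp [(hne1 k).symm]
          · rw [q'C, hC1', hm]; simp
          · by_cases hmk : m = l
            · subst hmk
              rw [q'A, hA1']
              simp [(hne1 k).symm, hl]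
            · rw [q'k m hmk, hm]
              simp [hmk]
        · refine ⟨some (some l), by simpa using hl, ?_⟩
          rintro (_ | _ | m)
          · rw [q'B, hB1]; simp [(hne1 k).symm]
          · rw [q'C, hC1', hm]; simp [Ne.symm hk, Ne.symm hlk]
          · by_cases hmk : m = k₀
            · subst hmk
              rw [q'A, hA1']
              simp [(hne1 k).symm, Ne.symm hk, Ne.symm hlk]
            · rw [q'k m hmk, hm]
              simp
  · have main := isotopic_of_vertical_shear (fun _ : Unit => ⋃ k, strand (q k)) G hGc 2 hGb
    simp only [← toS3_iUnion]
    convert main using 3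
    symm
    let F : E3 → E3 := fun x => (x.1, x.2 + G x.1)
    have hF0 (z : ℂ) (t : ℝ) (hz : p.re + 3 ≤ z.re ∨ z.im = p.im + 1 ∨ z.re ≤ p.re) :
        F (z, t) = (z, t) := by
      simp only [F]; rw [hG0 z hz, add_zero]
    have hFx (x : ℝ) : F (p + (x : ℂ), 3 / 8 + x / 24) = (p + (x : ℂ), 3 / 8 + x / 24 + g x) := by
      simp only [F]; rw [hGx]
    have hmem (k) (t : ℝ) (ht : t ∈ Icc (0 : ℝ) 1) : ((q' k t, t) : E3) ∈ ⋃ k, strand (q' k) :=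
      mem_iUnion.2 ⟨k, mem_strand ht⟩
    have hmem' (k) (t : ℝ) (ht : t ∈ Icc (0 : ℝ) 1) : ((q k t, t) : E3) ∈ ⋃ k, strand (q k) :=
      mem_iUnion.2 ⟨k, mem_strand ht⟩
    have hpx (x : ℝ) (hx : x ∈ Icc (0 : ℝ) 3) :
        ((p + (x : ℂ), 3 / 8 + x / 24) : E3) ∈ ⋃ k, strand (q k) := by
      have := hmem' k₀ (3 / 8 + x / 24) ⟨by linarith [hx.1], by linarith [hx.2]⟩
      rw [hseg _ ⟨by linarith [hx.1], by linarith [hx.2]⟩] at this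
      convert this using 5
      ring
    apply Subset.antisymm
    · rintro _ ⟨_, hx, rfl⟩
      obtain ⟨k, t, ht, rfl⟩ := mem_iUnion.1 hx
      change F (q k t, t) ∈ _
      by_cases hk : k = k₀
      · subst hk
        rcases le_total t (3 / 8) with c | c
        · rw [hF0 _ _ (Or.inr (Or.inr (hfar₀ t ⟨ht.1, c⟩)))]
          have := hmem (some (some k)) t ht
          rwa [q'A, hA1 t c] at this
        rcases le_total t (1 / 2) with c2 | c2
        · obtain ⟨x, rfl⟩ : ∃ x, t = 3 / 8 + x / 24 := ⟨24 * (t - 3 / 8), by ring⟩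
          have e : 24 * (3 / 8 + x / 24 - 3 / 8) = x := by ring
          rw [hseg _ ⟨c, c2⟩, e, hFx]
          rcases le_total x 1 with d | d
          · rw [hg1 x ⟨by linarith, d⟩]
            have := hmem (some (some k)) (3 / 8 + x / 24 + 7 / 12 * x) ⟨by linarith, by linarith⟩
            rw [q'A, hA2 _ (by linarith)] at this
            convert this using 5
            ring
          rcases le_total x 2 with d2 | d2
          · rw [hg2 x ⟨d, d2⟩]
            have := hmem none (2 - x) ⟨by linarith, by linarith⟩
            rw [q'B] at this
            convert this using 1
            simp only [qB]
            refine Prod.ext ?_ ?_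
            · simp only; push_cast; ring
            · simp only; ring
          · rw [hg3 x ⟨d2, by linarith⟩]
            have := hmem (some none) (x / 2 - 1) ⟨by linarith, by linarith⟩
            rw [q'C, hC1 _ (by linarith)] at this
            convert this using 1
            refine Prod.ext ?_ ?_
            · simp only; push_cast; ring
            · simp only; ring
        · rw [hF0 _ _ (hback t ⟨c2, ht.2⟩)]
          have := hmem (some none) t ht
          rwa [q'C, hC2 t c2] at this
      · rw [hF0 _ _ (Or.inr (Or.inr (hfar k hk t ht).le))]
        have := hmem (some (some k)) t ht
        rwa [q'k k hk] at this
    · rintro _ hx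
      obtain ⟨k, t, ht, rfl⟩ := mem_iUnion.1 hx
      change _ ∈ F '' _
      simp only
      rcases k with _ | _ | k
      · rw [q'B]
        refine ⟨_, hpx (2 - t) ⟨by linarith [ht.2], by linarith [ht.1]⟩, ?_⟩
        rw [hFx, hg2 _ ⟨by linarith [ht.2], by linarith [ht.1]⟩]
        exact Prod.ext rfl (by simp only; ring)
      · rw [q'C]
        rcases le_total t (1 / 2) with c | c
        · rw [hC1 t c]
          refine ⟨_, hpx (2 + 2 * t) ⟨by linarith [ht.1], by linarith⟩, ?_⟩
          rw [hFx, hg3 _ ⟨by linarith [ht.1], by linarith⟩]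
          exact Prod.ext rfl (by simp only; ring)
        · rw [hC2 t c]
          exact ⟨_, hmem' k₀ t ht, hF0 _ _ (hback t ⟨c, ht.2⟩)⟩
      · by_cases hk : k = k₀
        · subst hk
          rw [q'A]
          rcases le_total t (3 / 8) with c | c
          · rw [hA1 t c]
            exact ⟨_, hmem' k t ht, hF0 _ _ (Or.inr (Or.inr (hfar₀ t ⟨ht.1, c⟩)))⟩
          · rw [hA2 t c]
            refine ⟨_, hpx (8 / 5 * (t - 3 / 8)) ⟨by linarith, by linarith [ht.2]⟩, ?_⟩
            rw [hFx, hg1 _ ⟨by linarith, by linarith [ht.2]⟩]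
            exact Prod.ext rfl (by simp only; ring)
        · rw [q'k k hk]
          exact ⟨_, hmem' k t ht, hF0 _ _ (Or.inr (Or.inr (hfar k hk t ht).le))⟩

/-- A pointed plat is isotopic to one with two more strings. -/
theorem IsPointedPlat.exists_add_two {K : Type*} [Fintype K] [Nonempty K] {q : K → ℝ → ℂ}
    (h : IsPointedPlat q) :
    ∃ q' : Option (Option K) → ℝ → ℂ, IsPointedPlat q' ∧
      Isotopic (fun _ : Unit => ⋃ k, toS3 (strand (q k))) fun _ => ⋃ k, toS3 (strand (q' k)) := by
  classical
  obtain ⟨q₁, h₁, hvert, hiso₁⟩ := h.exists_vertical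
  obtain ⟨k₀, -, hk₀⟩ := Finset.exists_max_image (Finset.univ : Finset K)
    (fun k => (q₁ k (1 / 2)).re) Finset.univ_nonempty
  obtain ⟨M, hM⟩ : ∃ M, ∀ k, ∀ t ∈ Icc (0 : ℝ) 1, (q₁ k t).re ≤ M := by
    have hb (k : K) : ∃ M, ∀ t ∈ Icc (0 : ℝ) 1, ‖q₁ k t‖ ≤ M :=
      isCompact_Icc.exists_bound_of_continuousOn (h₁.continuous k).continuousOn
    choose B hB using hb
    refine ⟨Finset.univ.sup' Finset.univ_nonempty B, fun k t ht => ?_⟩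
    exact (Complex.re_le_norm _).trans ((hB k t ht).trans (Finset.le_sup' B (Finset.mem_univ k)))
  set z₀ := q₁ k₀ (1 / 2)
  have hz₀ : z₀.re ≤ M := hM k₀ _ (by constructor <;> norm_num)
  obtain ⟨E, hEc, hE0, hEpos, hEle, hEseg, hEback⟩ :=
    exists_excursion (N := M - z₀.re + 1) (by linarith)
  let Q : K → ℝ → ℝ → ℂ := fun k s t => q₁ k t + if k = k₀ then (s : ℂ) * E t else 0
  have hQc (k) : Continuous fun p : ℝ × ℝ => Q k p.1 p.2 := by
    refine ((h₁.continuous k).comp continuous_snd).add ?_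
    split_ifs
    · fun_prop
    · exact continuous_const
  have hQend (k s t) (ht : t ≤ 1 / 4 ∨ 3 / 4 ≤ t) : Q k s t = q₁ k t := by
    simp [Q, hE0 t ht]
  have hQother (k s t) (hk : k ≠ k₀) : Q k s t = q₁ k t := by simp [Q, hk]
  have key (l : K) (hl : l ≠ k₀) (s) (hs : s ∈ Icc (0 : ℝ) 1) (t)
      (ht : t ∈ Icc (1 / 4 : ℝ) (3 / 4)) : Q k₀ s t ≠ Q l s t := by
    have hne : z₀ ≠ q₁ l (1 / 2) :=
      h₁.ne (1 / 2) (by constructor <;> norm_num) k₀ l hl.symm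
    rw [hQother l s t hl, hvert l t ht]
    have e : Q k₀ s t = z₀ + s * E t := by
      simp only [Q, if_true]; rw [hvert k₀ t ht]
    rw [e]
    intro heq
    rcases hEpos t with h0 | hpos
    · rw [h0, mul_zero, add_zero] at heq
      exact hne heq
    · have h2 := congrArg Complex.re heq
      have h3 := hk₀ l (Finset.mem_univ l)
      simp only [Complex.add_re, Complex.re_ofReal_mul] at h2
      have h4 : s * (E t).re ≤ 0 := by
        have : (q₁ l (1 / 2)).re ≤ z₀.re := h3
        linarith
      have h5 : s = 0 := by
        rcases hs.1.eq_or_lt with h6 | h6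
        · exact h6.symm
        · have := mul_pos h6 hpos
          linarith
      rw [h5] at heq
      exact hne (by simpa using heq)
  have hQne (k l) (hkl : k ≠ l) (s) (hs : s ∈ Icc (0 : ℝ) 1) (t) (ht : t ∈ Ioo (0 : ℝ) 1) :
      Q k s t ≠ Q l s t := by
    by_cases hend : t ≤ 1 / 4 ∨ 3 / 4 ≤ t
    · rw [hQend k s t hend, hQend l s t hend]
      exact h₁.ne t ht k l hkl
    push Not at hend
    by_cases hk : k = k₀
    · subst hk; exact key l hkl.symm s hs t ⟨hend.1.le, hend.2.le⟩
    by_cases hl : l = k₀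
    · subst hl; exact (key k hkl s hs t ⟨hend.1.le, hend.2.le⟩).symm
    rw [hQother k s t hk, hQother l s t hl]
    exact h₁.ne t ht k l hkl
  have hiso := isotopic_of_homotopy Q hQc (1 / 4) (3 / 4)
    (fun k s _ t _ ht => by
      have h1 : t ≤ 1 / 4 ∨ 3 / 4 ≤ t := by
        by_contra hcon
        push Not at hcon
        exact ht ⟨hcon.1.le, hcon.2.le⟩
      rw [hQend k s t h1, hQend k 0 t h1])
    (fun k l hkl => ⟨fun _ => 1, fun s t => Q k s t - Q l s t, (hQc k).sub (hQc l),
      fun s hs t ht => ⟨sub_ne_zero.2 (hQne k l hkl s hs t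
        ⟨by linarith [ht.1], by linarith [ht.2]⟩), by simp⟩⟩)
  have hQ0 : (fun k => Q k 0) = q₁ := by
    funext k t; simp [Q]
  have h₂ : IsPointedPlat fun k => Q k 1 :=
    h₁.of_eq_near_ends (fun k => (hQc k).comp (continuous_const.prodMk continuous_id))
      (fun t ht k l hkl => hQne k l hkl 1 ⟨zero_le_one, le_rfl⟩ t ht) (by norm_num : (0 : ℝ) < 1 / 4)
      (fun k t ht => hQend k 1 t (Or.inl ht.2))
      (fun k t ht => hQend k 1 _ (Or.inr (by linarith [ht.2])))
  have hQk₀ (t) (ht : t ∈ Icc (1 / 4 : ℝ) (3 / 4)) : Q k₀ 1 t = z₀ + E t := by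
    simp only [Q, if_true, Complex.ofReal_one, one_mul]; rw [hvert k₀ t ht]
  obtain ⟨q', h', hiso'⟩ := h₂.exists_zigzag k₀ (z₀ + ((M - z₀.re + 1 : ℝ) : ℂ))
    (by
      intro k hk t ht
      rw [hQother k 1 t hk]
      have := hM k t ht
      simp only [Complex.add_re, Complex.ofReal_re]
      linarith)
    (by
      intro t ht
      simp only [Complex.add_re, Complex.ofReal_re]
      rcases le_total t (1 / 4) with c | c
      · rw [hQend k₀ 1 t (Or.inl c)]
        have := hM k₀ t ⟨ht.1, by linarith⟩
        linarith
      · rw [hQk₀ t ⟨c, by linarith [ht.2]⟩, Complex.add_re]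
        have := hEle t ht.2
        linarith)
    (by
      intro t ht
      rw [hQk₀ t ⟨by linarith [ht.1], by linarith [ht.2]⟩, hEseg t ht]
      push_cast; ring)
    (by
      intro t ht
      simp only [Complex.add_re, Complex.ofReal_re, Complex.add_im, Complex.ofReal_im, add_zero]
      rcases le_total t (3 / 4) with c | c
      · rw [hQk₀ t ⟨by linarith [ht.1], c⟩, Complex.add_re, Complex.add_im]
        rcases hEback t ht.1 with h1 | h1 | h1
        · left; linarith
        · right; left; linarith
        · right; right; linarith
      · right; right
        rw [hQend k₀ 1 t (Or.inr c)]
        have := hM k₀ t ⟨by linarith, ht.2⟩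
        linarith)
  refine ⟨q', h', (hiso₁.iUnion.trans ?_).trans hiso'⟩
  have := hiso.iUnion
  have e (k) : Q k 0 = q₁ k := congrFun hQ0 k
  simpa only [e] using this

/-! ### Polygons -/

/-- A disjoint union of simple closed polygons: the edge number `i` runs from the vertex `v i` to
the next vertex `v (τ i)`, and the edges without their final points are injective and pairwise
disjoint. The cycles of `τ` are the components. -/
def IsSimplePolygon {V : Type*} (τ : Equiv.Perm V) (v : V → E3) : Prop :=
  ∀ i j, ∀ s ∈ Ico (0 : ℝ) 1, ∀ t ∈ Ico (0 : ℝ) 1,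
    AffineMap.lineMap (v i) (v (τ i)) s = AffineMap.lineMap (v j) (v (τ j)) t → i = j ∧ s = t

/-- The union of the edges of a polygon. -/
def polygonCarrier {V : Type*} (τ : Equiv.Perm V) (v : V → E3) : Set E3 :=
  ⋃ i, (fun t : ℝ => AffineMap.lineMap (v i) (v (τ i)) t) '' Icc 0 1

namespace IsSimplePolygon

variable {V : Type*} {τ : Equiv.Perm V} {v : V → E3}

theorem injective (h : IsSimplePolygon τ v) : Function.Injective v := fun i j hij =>
  (h i j 0 ⟨le_rfl, one_pos⟩ 0 ⟨le_rfl, one_pos⟩ (by simpa using hij)).1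

theorem apply_ne (h : IsSimplePolygon τ v) (i : V) : v i ≠ v (τ i) := fun hi => by
  have := (h i i 0 ⟨le_rfl, one_pos⟩ (1 / 2) ⟨by norm_num, by norm_num⟩ (by rw [← hi]; simp)).2
  norm_num at this

theorem map (h : IsSimplePolygon τ v) {A : E3 →ₗ[ℝ] E3} (hA : Function.Injective A) :
    IsSimplePolygon τ (A ∘ v) := fun i j s hs t ht hst =>
  h i j s hs t ht (hA (((A.toAffineMap.apply_lineMap _ _ _).trans hst).trans
    (A.toAffineMap.apply_lineMap _ _ _).symm))

end IsSimplePolygon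

theorem polygonCarrier_map {V : Type*} (τ : Equiv.Perm V) (v : V → E3) (A : E3 →ₗ[ℝ] E3) :
    polygonCarrier τ (A ∘ v) = A '' polygonCarrier τ v := by
  simp only [polygonCarrier, image_iUnion, ← image_comp]
  refine iUnion_congr fun i => image_congr fun t _ => ?_
  exact (A.toAffineMap.apply_lineMap _ _ _).symm

/-- Every link can be moved to a disjoint union of simple closed polygons. -/
theorem Link.exists_isSimplePolygon {μ : ℕ} (L : Link μ) :
    ∃ (V : Type) (_ : Fintype V) (_ : Nonempty V) (τ : Equiv.Perm V) (v : V → E3),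
      IsSimplePolygon τ v ∧
      Isotopic (fun _ : Unit => L.carrier) fun _ => toS3 (polygonCarrier τ v) := by
  obtain ⟨P, H, hP, hdisj, hH⟩ := L.tame
  choose m p hm hinj hbd using hP
  have : Nonempty (Σ j, Fin (m j)) := ⟨⟨⟨0, L.pos⟩, ⟨0, by have := hm ⟨0, L.pos⟩; omega⟩⟩⟩
  refine ⟨Σ j, Fin (m j), inferInstance, this, Equiv.sigmaCongrRight fun j => finRotate (m j),
    fun i => p i.1 i.2, ?_, ?_⟩
  · rintro ⟨j, i⟩ ⟨j', i'⟩ s hs t ht hst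
    have hmem (j) (i : Fin (m j)) (s : ℝ) (hs : s ∈ Ico (0 : ℝ) 1) :
        (p j).edgePath ℝ i s ∈ P j := by
      rw [hbd]
      exact mem_iUnion.2 ⟨i, s, ⟨hs.1, hs.2.le⟩, rfl⟩
    change (p j).edgePath ℝ i s = (p j').edgePath ℝ i' t at hst
    obtain rfl : j = j' := by
      by_contra hne
      exact (hdisj hne).le_bot ⟨hmem j i s hs, hst ▸ hmem j' i' t ht⟩
    have := @hinj j (i, ⟨s, hs⟩) (i', ⟨t, ht⟩) hst
    simp only [Prod.mk.injEq, Subtype.mk.injEq] at this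
    exact ⟨by rw [this.1], this.2⟩
  · have h1 : polygonCarrier (Equiv.sigmaCongrRight fun j => finRotate (m j))
        (fun i : Σ j, Fin (m j) => p i.1 i.2) = ⋃ j, P j := by
      rw [polygonCarrier, iUnion_sigma]
      refine iUnion_congr fun j => ?_
      rw [hbd]
      rfl
    rw [h1, toS3_iUnion]
    exact Isotopic.iUnion ⟨H, hH⟩

/-! ### Linear general position -/

/-- A linear map that moves every point of Euclidean 3-space horizontally and then changes the
vertical scale. -/
noncomputable def slant (α : ℝ) (β : ℂ) (ε : ℝ) : E3 →ₗ[ℝ] E3 where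
  toFun x := (x.1 + (α * x.1.im + β * x.2), ε * x.2)
  map_add' x y := by
    refine Prod.ext ?_ ?_
    · simp only [Prod.fst_add, Prod.snd_add, Complex.add_im]; push_cast; ring
    · simp only [Prod.snd_add]; ring
  map_smul' c x := by
    refine Prod.ext ?_ ?_
    · simp only [Prod.smul_fst, Prod.smul_snd, Complex.real_smul, smul_eq_mul, RingHom.id_apply,
        Complex.im_ofReal_mul]
      push_cast; ring
    · simp only [Prod.smul_snd, smul_eq_mul, RingHom.id_apply]; ring

theorem slant_apply (α : ℝ) (β : ℂ) (ε : ℝ) (x : E3) :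
    slant α β ε x = (x.1 + (α * x.1.im + β * x.2), ε * x.2) := rfl

theorem slant_injective (α : ℝ) (β : ℂ) {ε : ℝ} (hε : ε ≠ 0) :
    Function.Injective (slant α β ε) := by
  rintro ⟨z, t⟩ ⟨z', t'⟩ h
  simp only [slant_apply, Prod.mk.injEq, mul_eq_mul_left_iff, hε, or_false] at h
  obtain ⟨h, rfl⟩ := h
  have him : z.im = z'.im := by simpa using congrArg Complex.im h
  rw [him] at h
  rw [add_right_cancel h]

theorem slant_bijective (α : ℝ) (β : ℂ) {ε : ℝ} (hε : ε ≠ 0) :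
    Function.Bijective (slant α β ε) :=
  ⟨slant_injective α β hε, LinearMap.surjective_of_injective (slant_injective α β hε)⟩

theorem isotopic_slant {ι : Type*} (X : ι → Set E3) (α : ℝ) (β : ℂ) {ε : ℝ} (hε : 0 < ε)
    (hε1 : ε ≤ 1) :
    Isotopic (fun i => toS3 (X i)) fun i => toS3 (slant α β ε '' X i) := by
  have hpos (s : ℝ) (hs : s ∈ Icc (0 : ℝ) 1) : ε ≤ 1 + s * (ε - 1) := by nlinarith [hs.1, hs.2]
  have main := isotopic_of_family X (fun s x => slant (s * α) (s * β) (1 + s * (ε - 1)) x)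
    ?_ ?_ ?_ (1 + |α| + |α| * ‖β‖ / ε + ‖β‖ / ε + 1 / ε) ?_
  · simpa using main
  · simp only [slant_apply]
    fun_prop
  · intro s hs
    exact slant_bijective _ _ (hε.trans_le (hpos s hs)).ne'
  · rintro ⟨z, t⟩
    simp [slant_apply]
  · rintro s hs ⟨z, t⟩
    set F : E3 := slant (s * α) (s * β) (1 + s * (ε - 1)) (z, t) with hF
    set N := ‖F‖ with hN
    have hN1 : ‖z + (((s * α : ℝ) : ℂ) * (z.im : ℂ) + s * β * (t : ℂ))‖ ≤ N := norm_fst_le F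
    have hN2 : ‖(1 + s * (ε - 1)) * t‖ ≤ N := norm_snd_le F
    have h0 : 0 ≤ N := norm_nonneg _
    have hs' : |s| ≤ 1 := abs_le.2 ⟨by linarith [hs.1], hs.2⟩
    have ht : |t| ≤ N / ε := by
      rw [le_div_iff₀ hε, mul_comm]
      rw [norm_mul, Real.norm_eq_abs, Real.norm_eq_abs, abs_of_pos (hε.trans_le (hpos s hs))] at hN2
      exact (mul_le_mul_of_nonneg_right (hpos s hs) (abs_nonneg t)).trans hN2
    have hβ : ‖(s : ℂ) * β * t‖ ≤ ‖β‖ * (N / ε) := by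
      rw [norm_mul, norm_mul, Complex.norm_real, Complex.norm_real, Real.norm_eq_abs,
        Real.norm_eq_abs]
      calc |s| * ‖β‖ * |t| ≤ 1 * ‖β‖ * (N / ε) := by gcongr
        _ = _ := by ring
    have him : |z.im| ≤ N + ‖β‖ * (N / ε) := by
      have h1 : z.im = (z + (((s * α : ℝ) : ℂ) * (z.im : ℂ) + s * β * (t : ℂ))).im
          - ((s : ℂ) * β * t).im := by
        simp only [Complex.add_im, Complex.mul_im, Complex.ofReal_im, Complex.ofReal_re]; ring
      rw [h1]
      refine (abs_sub _ _).trans (add_le_add ((Complex.abs_im_le_norm _).trans hN1)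
        ((Complex.abs_im_le_norm _).trans hβ))
    have hz : ‖z‖ ≤ N + (|α| * (N + ‖β‖ * (N / ε)) + ‖β‖ * (N / ε)) := by
      have h1 : z = (z + (((s * α : ℝ) : ℂ) * (z.im : ℂ) + s * β * (t : ℂ)))
          - (((s * α : ℝ) : ℂ) * (z.im : ℂ) + s * β * (t : ℂ)) := by ring
      have h2 : ‖((s * α : ℝ) : ℂ) * (z.im : ℂ)‖ ≤ |α| * (N + ‖β‖ * (N / ε)) := by
        rw [norm_mul, Complex.norm_real, Complex.norm_real, Real.norm_eq_abs, Real.norm_eq_abs,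
          abs_mul]
        calc |s| * |α| * |z.im| ≤ 1 * |α| * (N + ‖β‖ * (N / ε)) := by gcongr
          _ = _ := by ring
      calc ‖z‖ = _ := congrArg norm h1
        _ ≤ _ := norm_sub_le _ _
        _ ≤ _ := add_le_add hN1 ((norm_add_le _ _).trans (add_le_add h2 hβ))
    have hε' : 0 < 1 / ε := by positivity
    have key : (1 + |α| + |α| * ‖β‖ / ε + ‖β‖ / ε + 1 / ε) * (1 + N) =
        N + (|α| * (N + ‖β‖ * (N / ε)) + ‖β‖ * (N / ε)) + N / ε +
          (1 + |α| + |α| * ‖β‖ / ε + ‖β‖ / ε + 1 / ε) := by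
      field_simp; ring
    have hC : 0 ≤ 1 + |α| + |α| * ‖β‖ / ε + ‖β‖ / ε + 1 / ε := by positivity
    have hX : 0 ≤ N + (|α| * (N + ‖β‖ * (N / ε)) + ‖β‖ * (N / ε)) := by positivity
    have hY : 0 ≤ N / ε := by positivity
    have : ‖((z, t) : E3)‖ = max ‖z‖ |t| := rfl
    rw [this, key]
    exact max_le (by linarith) (by linarith)

/-- Some real number is a zero of none of finitely many given non-zero polynomials of degree at most
two. -/
theorem exists_forall_quadratic_ne_zero {ι : Type*} [Finite ι] (a b c : ι → ℝ)
    (h : ∀ i, a i ≠ 0 ∨ b i ≠ 0 ∨ c i ≠ 0) : ∃ x : ℝ, ∀ i, a i + b i * x + c i * x ^ 2 ≠ 0 := by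
  let P (i : ι) : Polynomial ℝ := .C (c i) * .X ^ 2 + .C (b i) * .X + .C (a i)
  have hP (i) : P i ≠ 0 := by
    intro h0
    have h2 : (P i).coeff 0 = a i := by simp [P]
    have h3 : (P i).coeff 1 = b i := by simp [P, Polynomial.coeff_C]
    have h4 : (P i).coeff 2 = c i := by simp [P]
    rw [h0, Polynomial.coeff_zero] at h2 h3 h4
    rcases h i with h | h | h
    exacts [h h2.symm, h h3.symm, h h4.symm]
  have hfin : (⋃ i, {x | (P i).IsRoot x}).Finite :=
    finite_iUnion fun i => Polynomial.finite_setOfPred_isRoot (hP i)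
  obtain ⟨x, hx⟩ := hfin.infinite_compl.nonempty
  refine ⟨x, fun i hi => hx (mem_iUnion.2 ⟨i, ?_⟩)⟩
  simp only [mem_ofPred_eq, Polynomial.IsRoot, P, Polynomial.eval_add, Polynomial.eval_mul,
    Polynomial.eval_C, Polynomial.eval_pow, Polynomial.eval_X]
  linarith

/-- The shears `(x, y, t) ↦ (x + b y + b² t, y, t)`, with `b` outside a finite set, make the first
coordinate vary along every edge. -/
theorem IsSimplePolygon.exists_re_ne {V : Type*} [Finite V] {τ : Equiv.Perm V} {v : V → E3}
    (h : IsSimplePolygon τ v) :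
    ∃ w : V → E3, IsSimplePolygon τ w ∧ (∀ i, (w i).1.re ≠ (w (τ i)).1.re) ∧
      Isotopic (fun _ : Unit => toS3 (polygonCarrier τ v)) fun _ => toS3 (polygonCarrier τ w) := by
  obtain ⟨b, hb⟩ := exists_forall_quadratic_ne_zero (fun i => (v i).1.re - (v (τ i)).1.re)
    (fun i => (v i).1.im - (v (τ i)).1.im) (fun i => (v i).2 - (v (τ i)).2) fun i => by
      by_contra! h0
      exact h.apply_ne i (Prod.ext (Complex.ext (sub_eq_zero.1 h0.1) (sub_eq_zero.1 h0.2.1))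
        (sub_eq_zero.1 h0.2.2))
  refine ⟨slant b ((b ^ 2 : ℝ) : ℂ) 1 ∘ v, h.map (slant_injective _ _ one_ne_zero), fun i hi => ?_, ?_⟩
  · apply hb i
    simp only [Function.comp_apply, slant_apply, Complex.add_re, Complex.re_ofReal_mul,
      Complex.ofReal_re] at hi
    linarith
  · simp only [polygonCarrier_map]
    exact isotopic_slant _ b _ one_pos le_rfl

/-- A linear isotopy that preserves the first coordinate separates the projections of the vertices
to the plane. -/
theorem IsSimplePolygon.exists_fst_injective {V : Type*} [Finite V] {τ : Equiv.Perm V} {v : V → E3}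
    (h : IsSimplePolygon τ v) :
    ∃ w : V → E3, IsSimplePolygon τ w ∧ (∀ i, (w i).1.re = (v i).1.re) ∧
      (Function.Injective fun i => (w i).1) ∧
      Isotopic (fun _ : Unit => toS3 (polygonCarrier τ v)) fun _ => toS3 (polygonCarrier τ w) := by
  obtain ⟨b, hb⟩ := exists_forall_quadratic_ne_zero
    (ι := {p : V × V // (v p.1).1.im ≠ (v p.2).1.im ∨ (v p.1).2 ≠ (v p.2).2})
    (fun p => (v p.1.1).1.im - (v p.1.2).1.im) (fun p => (v p.1.1).2 - (v p.1.2).2) 0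
    fun p => p.2.imp sub_ne_zero.2 fun h => Or.inl (sub_ne_zero.2 h)
  refine ⟨slant 0 (b * Complex.I) 1 ∘ v, h.map (slant_injective _ _ one_ne_zero), fun i => ?_,
    fun i j hij => ?_, ?_⟩
  · simp [slant_apply]
  · by_contra hne
    have hre := congrArg Complex.re hij
    have him := congrArg Complex.im hij
    simp [slant_apply] at hre him
    refine hb ⟨(i, j), ?_⟩ ?_
    · by_contra! h0
      exact hne (h.injective (Prod.ext (Complex.ext hre h0.1) h0.2))
    · simp only [Pi.zero_apply]
      linarith
  · simp only [polygonCarrier_map]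
    exact isotopic_slant _ 0 _ one_pos le_rfl

/-! ### Subdivision of polygons -/

/-- The successor map of a polygon after a new vertex is inserted behind the vertex `i`. -/
noncomputable def insertNext {V : Type*} [DecidableEq V] (τ : Equiv.Perm V) (i : V) :
    Equiv.Perm (Option V) :=
  (Equiv.swap none (some i)).trans τ.optionCongr

section insertNext

variable {V : Type*} [DecidableEq V] (τ : Equiv.Perm V) (i : V)

theorem insertNext_none : insertNext τ i none = some (τ i) := by
  simp [insertNext]

theorem insertNext_self : insertNext τ i (some i) = none := by
  simp [insertNext]

theorem insertNext_of_ne {j : V} (h : j ≠ i) : insertNext τ i (some j) = some (τ j) := by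
  simp [insertNext, Equiv.swap_apply_of_ne_of_ne, h]

/-- The edge number `k` of the polygon with a new vertex is a part of the old edge
`insertEdge i k`. -/
def insertEdge (k : Option V) : V := k.elim i id

/-- The position on the old edge of a point of an edge of the polygon with a new vertex. -/
noncomputable def insertTime (a : ℝ) (k : Option V) (t : ℝ) : ℝ :=
  k.elim (a + (1 - a) * t) fun j => if j = i then a * t else t

theorem lineMap_insert (v : V → E3) (a : ℝ) (k : Option V) (t : ℝ) :
    AffineMap.lineMap (k.elim (AffineMap.lineMap (v i) (v (τ i)) a) v)
      ((insertNext τ i k).elim (AffineMap.lineMap (v i) (v (τ i)) a) v) t =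
    AffineMap.lineMap (v (insertEdge i k)) (v (τ (insertEdge i k))) (insertTime i a k t) := by
  rcases k with _ | j
  · rw [insertNext_none]
    simp only [Option.elim, insertEdge, insertTime, AffineMap.lineMap_apply_module']
    module
  · by_cases hj : j = i
    · subst hj
      rw [insertNext_self]
      simp only [Option.elim, insertEdge, insertTime, AffineMap.lineMap_apply_module', id, if_true]
      module
    · rw [insertNext_of_ne τ i hj]
      simp [insertEdge, insertTime, hj]

theorem insertTime_mem {a : ℝ} (ha : a ∈ Ioo (0 : ℝ) 1) (k : Option V) {t : ℝ}
    (ht : t ∈ Ico (0 : ℝ) 1) : insertTime i a k t ∈ Ico (0 : ℝ) 1 := by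
  obtain ⟨h0, h1⟩ := ha
  obtain ⟨h2, h3⟩ := ht
  rcases k with _ | j
  · simp only [insertTime, Option.elim]
    constructor <;> nlinarith
  · simp only [insertTime, Option.elim]
    split_ifs
    · constructor <;> nlinarith
    · exact ⟨h2, h3⟩

theorem insertTime_inj {a : ℝ} (ha : a ∈ Ioo (0 : ℝ) 1) {k l : Option V} {s t : ℝ}
    (hs : s ∈ Ico (0 : ℝ) 1) (ht : t ∈ Ico (0 : ℝ) 1) (hkl : insertEdge i k = insertEdge i l)
    (hst : insertTime i a k s = insertTime i a l t) : k = l ∧ s = t := by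
  obtain ⟨h0, h1⟩ := ha
  obtain ⟨h2, h3⟩ := hs
  obtain ⟨h4, h5⟩ := ht
  rcases k with _ | j <;> rcases l with _ | j'
  · refine ⟨rfl, ?_⟩
    simp only [insertTime, Option.elim] at hst
    exact mul_left_cancel₀ (sub_pos.2 h1).ne' (add_left_cancel hst)
  · simp only [insertEdge, Option.elim, id] at hkl
    subst hkl
    simp only [insertTime, Option.elim, if_true] at hst
    nlinarith
  · simp only [insertEdge, Option.elim, id] at hkl
    subst hkl
    simp only [insertTime, Option.elim, if_true] at hst
    nlinarith
  · simp only [insertEdge, Option.elim, id] at hkl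
    subst hkl
    refine ⟨rfl, ?_⟩
    simp only [insertTime, Option.elim] at hst
    split_ifs at hst
    · exact mul_left_cancel₀ h0.ne' hst
    · exact hst

theorem IsSimplePolygon.insert {v : V → E3} (h : IsSimplePolygon τ v) {a : ℝ}
    (ha : a ∈ Ioo (0 : ℝ) 1) :
    IsSimplePolygon (insertNext τ i)
      (fun k => k.elim (AffineMap.lineMap (v i) (v (τ i)) a) v) := by
  intro k l s hs t ht hst
  rw [lineMap_insert, lineMap_insert] at hst
  obtain ⟨h1, h2⟩ := h _ _ _ (insertTime_mem i ha k hs) _ (insertTime_mem i ha l ht) hst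
  exact insertTime_inj i ha hs ht h1 h2

theorem polygonCarrier_insert (v : V → E3) {a : ℝ} (ha : a ∈ Ioo (0 : ℝ) 1) :
    polygonCarrier (insertNext τ i) (fun k => k.elim (AffineMap.lineMap (v i) (v (τ i)) a) v) =
      polygonCarrier τ v := by
  obtain ⟨h0, h1⟩ := ha
  refine Subset.antisymm (iUnion_subset fun k => ?_) (iUnion_subset fun j => ?_)
  · rintro _ ⟨t, ⟨h2, h3⟩, rfl⟩
    refine mem_iUnion.2 ⟨insertEdge i k, insertTime i a k t, ?_, (lineMap_insert τ i v a k t).symm⟩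
    rcases k with _ | j
    · simp only [insertTime, Option.elim]
      constructor <;> nlinarith
    · simp only [insertTime, Option.elim]
      split_ifs
      · constructor <;> nlinarith
      · exact ⟨h2, h3⟩
  · rintro _ ⟨t, ⟨h2, h3⟩, rfl⟩
    by_cases hj : j = i
    · subst hj
      rcases le_total t a with hta | hta
      · refine mem_iUnion.2 ⟨some j, t / a, ⟨by positivity, (div_le_one h0).2 hta⟩,
          (lineMap_insert τ j v a _ _).trans ?_⟩
        simp [insertEdge, insertTime, mul_div_cancel₀ _ h0.ne']
      · have h4 : 0 < 1 - a := sub_pos.2 h1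
        refine mem_iUnion.2 ⟨none, (t - a) / (1 - a),
          ⟨div_nonneg (sub_nonneg.2 hta) h4.le, (div_le_one h4).2 (by linarith)⟩,
          (lineMap_insert τ j v a _ _).trans ?_⟩
        simp [insertEdge, insertTime, mul_div_cancel₀ _ h4.ne']
    · refine mem_iUnion.2 ⟨some j, t, ⟨h2, h3⟩, (lineMap_insert τ i v a _ _).trans ?_⟩
      simp [insertEdge, insertTime, hj]

end insertNext

theorem mem_uIoo_iff {x y g : ℝ} : g ∈ uIoo x y ↔ x < g ∧ g < y ∨ y < g ∧ g < x := by
  rcases le_total x y with h | h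
  · rw [uIoo_of_le h, mem_Ioo]; grind
  · rw [uIoo_of_ge h, mem_Ioo]; grind

open Classical in
/-- The number of points of `G` strictly between `x` and `y`. -/
noncomputable def countBetween (G : Finset ℝ) (x y : ℝ) : ℕ :=
  (G.filter fun g => g ∈ uIoo x y).card

theorem countBetween_add_lt {G : Finset ℝ} {x y g : ℝ} (hg : g ∈ G) (hgxy : g ∈ uIoo x y) :
    countBetween G x g + countBetween G g y < countBetween G x y := by
  classical
  have hd : Disjoint (G.filter fun k => k ∈ uIoo x g) (G.filter fun k => k ∈ uIoo g y) := by
    refine Finset.disjoint_filter.2 fun k _ h1 h2 => ?_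
    rw [mem_uIoo_iff] at *
    grind
  rw [countBetween, countBetween, countBetween, ← Finset.card_union_of_disjoint hd]
  refine Finset.card_lt_card (Finset.ssubset_iff.2 ⟨g, ?_, ?_⟩)
  · simp [mem_uIoo_iff]
  · intro k hk
    simp only [Finset.mem_insert, Finset.mem_union, Finset.mem_filter, mem_uIoo_iff] at *
    grind

/-- A polygon can be subdivided in such a way that along every edge the first coordinate runs
between two neighbouring points of a finite set. -/
theorem IsSimplePolygon.exists_subdivision (G : Finset ℝ) (N : ℕ) {V : Type} [Fintype V]
    [Nonempty V] {τ : Equiv.Perm V} {v : V → E3} (h : IsSimplePolygon τ v)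
    (hne : ∀ i, (v i).1.re ≠ (v (τ i)).1.re) (hG : ∀ i, (v i).1.re ∈ G)
    (hN : ∑ i, countBetween G (v i).1.re (v (τ i)).1.re ≤ N) :
    ∃ (W : Type) (_ : Fintype W) (_ : Nonempty W) (τ' : Equiv.Perm W) (w : W → E3),
      IsSimplePolygon τ' w ∧ (∀ i, (w i).1.re ≠ (w (τ' i)).1.re) ∧ (∀ i, (w i).1.re ∈ G) ∧
      (∀ i, ∀ g ∈ G, g ∉ uIoo (w i).1.re (w (τ' i)).1.re) ∧
      polygonCarrier τ' w = polygonCarrier τ v := by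
  classical
  induction N generalizing V with
  | zero =>
    refine ⟨V, inferInstance, inferInstance, τ, v, h, hne, hG, fun i g hg hgi => ?_, rfl⟩
    have h1 := (Finset.sum_eq_zero_iff.1 (Nat.le_zero.1 hN)) i (Finset.mem_univ i)
    rw [countBetween, Finset.card_eq_zero, Finset.filter_eq_empty_iff] at h1
    exact h1 hg hgi
  | succ N ih =>
    by_cases hdone : ∀ i, ∀ g ∈ G, g ∉ uIoo (v i).1.re (v (τ i)).1.re
    · exact ⟨V, inferInstance, inferInstance, τ, v, h, hne, hG, hdone, rfl⟩
    push Not at hdone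
    obtain ⟨i, g, hg, hgi⟩ := hdone
    set x := (v i).1.re with hx
    set y := (v (τ i)).1.re with hy
    have hxy : y - x ≠ 0 := sub_ne_zero.2 (hne i).symm
    obtain ⟨a, ha, hag⟩ : ∃ a ∈ Ioo (0 : ℝ) 1, x + a * (y - x) = g := by
      refine ⟨(g - x) / (y - x), ?_, by field_simp; ring⟩
      rw [mem_uIoo_iff] at hgi
      rcases hgi with ⟨h1, h2⟩ | ⟨h1, h2⟩
      · exact ⟨div_pos (by linarith) (by linarith), (div_lt_one (by linarith)).2 (by linarith)⟩
      · exact ⟨div_pos_of_neg_of_neg (by linarith) (by linarith),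
          (div_lt_one_of_neg (by linarith)).2 (by linarith)⟩
    have hre : (AffineMap.lineMap (v i) (v (τ i)) a).1.re = g := by
      rw [← hag, AffineMap.fst_lineMap, AffineMap.lineMap_apply_module']
      simp [hx, hy]; ring
    have hgx : x ≠ g ∧ g ≠ y := by
      rw [mem_uIoo_iff] at hgi
      grind
    have hne' : ∀ k : Option V, (k.elim (AffineMap.lineMap (v i) (v (τ i)) a) v).1.re ≠
        ((insertNext τ i k).elim (AffineMap.lineMap (v i) (v (τ i)) a) v).1.re := by
      rintro (_ | j)
      · simp only [insertNext_none, Option.elim, hre]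
        exact hgx.2
      · by_cases hj : j = i
        · subst hj
          simp only [insertNext_self, Option.elim, hre]
          exact hgx.1
        · simp only [insertNext_of_ne τ i hj, Option.elim]
          exact hne j
    have hG' : ∀ k : Option V, (k.elim (AffineMap.lineMap (v i) (v (τ i)) a) v).1.re ∈ G := by
      rintro (_ | j)
      · simpa only [Option.elim, hre] using hg
      · exact hG j
    obtain ⟨W, hW, hW', τ', w, h1, h2, h3, h4, h5⟩ := ih (h.insert τ i ha) hne' hG' (by
      rw [Fintype.sum_option]
      have h6 := Finset.add_sum_erase Finset.univ
        (fun j => countBetween G (v j).1.re (v (τ j)).1.re) (Finset.mem_univ i)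
      rw [← Finset.add_sum_erase Finset.univ _ (Finset.mem_univ i)]
      have h7 : ∀ j ∈ Finset.univ.erase i, countBetween G
          ((some j).elim (AffineMap.lineMap (v i) (v (τ i)) a) v).1.re
          ((insertNext τ i (some j)).elim (AffineMap.lineMap (v i) (v (τ i)) a) v).1.re =
          countBetween G (v j).1.re (v (τ j)).1.re := fun j hj => by
        rw [insertNext_of_ne τ i (Finset.ne_of_mem_erase hj)]
        rfl
      rw [Finset.sum_congr rfl h7]
      simp only [insertNext_none, insertNext_self, Option.elim, hre]
      have h8 := countBetween_add_lt hg hgi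
      rw [hx, hy] at h8
      omega)
    exact ⟨W, hW, hW', τ', w, h1, h2, h3, h4, h5.trans (polygonCarrier_insert τ i v ha)⟩

/-! ### A zigzag function -/

/-- A continuous function that takes the values `0` and `1` alternately at the points of a finite
set and is affine between neighbouring ones. -/
theorem exists_zigzag_function (G : Finset ℝ) :
    ∃ h : ℝ → ℝ, Continuous h ∧ (∃ C, ∀ x, |h x| ≤ C) ∧ (∀ g ∈ G, h g = 0 ∨ h g = 1) ∧
      (∀ m ∈ G, (∀ g ∈ G, g ≤ m) → ∀ x ≥ m, h x = h m) ∧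
      ∀ a ∈ G, ∀ b ∈ G, a < b → (∀ g ∈ G, g ∉ Ioo a b) →
        h b = 1 - h a ∧ ∀ u ∈ Icc (0 : ℝ) 1, h (a + u * (b - a)) = h a + u * (h b - h a) := by
  classical
  induction G using Finset.induction_on_max with
  | empty => exact ⟨0, continuous_const, ⟨0, by simp⟩, by simp, by simp, by simp⟩
  | insert m G hm ih =>
    rcases G.eq_empty_or_nonempty with rfl | hne
    · refine ⟨0, continuous_const, ⟨0, by simp⟩, by simp, by simp, ?_⟩
      intro a ha b hb hab
      simp only [insert_empty_eq, Finset.mem_singleton] at ha hb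
      exact absurd hab (by rw [ha, hb]; exact lt_irrefl m)
    obtain ⟨h, hcont, ⟨C, hC⟩, hval, hmax, hadj⟩ := ih
    set p := G.max' hne with hp
    have hpG : p ∈ G := G.max'_mem hne
    have hple : ∀ g ∈ G, g ≤ p := fun g hg => G.le_max' g hg
    have hpm : p < m := hm p hpG
    set φ : ℝ → ℝ := fun x => max 0 (min 1 ((x - p) / (m - p))) with hφ
    have hφ0 (x) (hx : x ≤ p) : φ x = 0 := by
      refine max_eq_left ((min_le_right _ _).trans ?_)
      exact div_nonpos_of_nonpos_of_nonneg (by linarith) (by linarith)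
    have hφ1 (x) (hx : m ≤ x) : φ x = 1 := by
      have : 1 ≤ (x - p) / (m - p) := (one_le_div (by linarith)).2 (by linarith)
      simp [hφ, min_eq_left this]
    have hφu (u : ℝ) (hu : u ∈ Icc (0 : ℝ) 1) : φ (p + u * (m - p)) = u := by
      have : (p + u * (m - p) - p) / (m - p) = u := by
        have : m - p ≠ 0 := by linarith
        field_simp; ring
      simp only [hφ, this, min_eq_right hu.2, max_eq_right hu.1]
    have hφb (x) : |φ x| ≤ 1 := by
      rw [abs_of_nonneg (le_max_left _ _)]
      exact max_le zero_le_one (min_le_left _ _)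
    have hφc : Continuous φ := by fun_prop
    have hlow (x) (hx : x ≤ p) : h x + (1 - 2 * h p) * φ x = h x := by rw [hφ0 x hx]; ring
    have hhp (x) (hx : p ≤ x) : h x = h p := hmax p hpG hple x hx
    have hhigh : h m + (1 - 2 * h p) * φ m = 1 - h p := by
      rw [hφ1 m le_rfl, hhp m hpm.le]; ring
    refine ⟨fun x => h x + (1 - 2 * h p) * φ x, by fun_prop, ⟨C + |1 - 2 * h p|, fun x => ?_⟩,
      fun g hg => ?_, fun g hg hgmax x hx => ?_, fun a ha b hb hab hno => ?_⟩
    · refine (abs_add_le _ _).trans (add_le_add (hC x) ?_)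
      rw [abs_mul]
      exact mul_le_of_le_one_right (abs_nonneg _) (hφb x)
    · rcases Finset.mem_insert.1 hg with rfl | hg
      · simp only [hhigh]
        rcases hval p hpG with h0 | h0 <;> simp [h0]
      · simp only [hlow g (hple g hg)]
        exact hval g hg
    · obtain rfl : g = m := by
        rcases Finset.mem_insert.1 hg with rfl | hg
        · rfl
        · exact absurd (hgmax m (Finset.mem_insert_self _ _)) (not_le.2 (hm g hg))
      simp only [hφ1 x hx, hφ1 g le_rfl, hhp x (hpm.le.trans hx), hhp g hpm.le]
    · have hno' : ∀ g ∈ G, g ∉ Ioo a b := fun g hg => hno g (Finset.mem_insert_of_mem hg)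
      have haG : a ∈ G := by
        rcases Finset.mem_insert.1 ha with rfl | ha
        · rcases Finset.mem_insert.1 hb with rfl | hb
          · exact absurd hab (lt_irrefl _)
          · exact absurd hab (not_lt.2 (hm b hb).le)
        · exact ha
      rcases Finset.mem_insert.1 hb with rfl | hbG
      · have hap : a = p := by
          by_contra hne'
          exact hno' p hpG ⟨lt_of_le_of_ne (hple a haG) hne', hpm⟩
        rw [hap]
        refine ⟨?_, fun u hu => ?_⟩
        · beta_reduce
          rw [hhigh, hlow p le_rfl]
        · beta_reduce
          rw [hhigh, hlow p le_rfl, hφu u hu,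
            hhp _ (show p ≤ p + u * (b - p) by nlinarith [hu.1])]
          ring
      · obtain ⟨h1, h2⟩ := hadj a haG b hbG hab hno'
        refine ⟨?_, fun u hu => ?_⟩
        · simp only [hlow a (hple a haG), hlow b (hple b hbG)]
          exact h1
        · have : a + u * (b - a) ≤ p := by nlinarith [hple b hbG, hu.2]
          simp only [hlow a (hple a haG), hlow b (hple b hbG), hlow _ this]
          exact h2 u hu

/-! ### Accordions -/

/-- A Lipschitz function with prescribed values in neighbourhoods of finitely many points. -/
theorem exists_plateau {V : Type*} [Fintype V] {p : V → ℂ} (hp : Function.Injective p)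
    (a : V → ℝ) :
    ∃ c : ℂ → ℝ, (∃ M, 0 ≤ M ∧ ∀ z w, |c z - c w| ≤ M * ‖z - w‖) ∧ (∃ C, ∀ z, |c z| ≤ C) ∧
      ∀ i, ∀ᶠ z in 𝓝 (p i), c z = a i := by
  classical
  obtain ⟨r, hr0, hr⟩ : ∃ r > 0, ∀ i j, i ≠ j → 3 * r < ‖p i - p j‖ := by
    have h1 : ∀ᶠ r in 𝓝[>] (0 : ℝ), ∀ i j, i ≠ j → 3 * r < ‖p i - p j‖ := by
      refine eventually_all.2 fun i => eventually_all.2 fun j => ?_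
      by_cases hij : i = j
      · simp [hij]
      · have h2 : (0 : ℝ) < ‖p i - p j‖ / 3 := by
          have := norm_pos_iff.2 (sub_ne_zero.2 (hp.ne hij))
          positivity
        filter_upwards [nhdsWithin_le_nhds (eventually_lt_nhds h2)] with r hr _
        linarith
    obtain ⟨r, h2, h3⟩ := (h1.and self_mem_nhdsWithin).exists
    exact ⟨r, h3, h2⟩
  set φ : V → ℂ → ℝ := fun j z => max 0 (min 1 (2 - ‖z - p j‖ / r)) with hφ
  have hφ1 (j z) (hz : ‖z - p j‖ < r) : φ j z = 1 := by
    have : 1 ≤ 2 - ‖z - p j‖ / r := by linarith [(div_le_one hr0).2 hz.le]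
    simp [hφ, min_eq_left this]
  have hφ0 (j z) (hz : 2 * r ≤ ‖z - p j‖) : φ j z = 0 := by
    have : 2 - ‖z - p j‖ / r ≤ 0 := by linarith [(le_div_iff₀ hr0).2 hz]
    exact max_eq_left ((min_le_right _ _).trans this)
  have hφL (j z w) : |φ j z - φ j w| ≤ ‖z - w‖ / r := by
    have h1 : |φ j z - φ j w| ≤ |(2 - ‖z - p j‖ / r) - (2 - ‖w - p j‖ / r)| := by
      simp only [hφ]
      exact (abs_max_sub_max_le_max 0 _ 0 _).trans (by
        rw [sub_self, abs_zero]
        refine max_le (abs_nonneg _) ((abs_min_sub_min_le_max 1 _ 1 _).trans ?_)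
        rw [sub_self, abs_zero]
        exact max_le (abs_nonneg _) le_rfl)
    refine h1.trans ?_
    have h2 : (2 - ‖z - p j‖ / r) - (2 - ‖w - p j‖ / r) = (‖w - p j‖ - ‖z - p j‖) / r := by ring
    rw [h2, abs_div, abs_of_pos hr0]
    gcongr
    refine (abs_norm_sub_norm_le _ _).trans (le_of_eq ?_)
    rw [sub_sub_sub_cancel_right, norm_sub_rev]
  refine ⟨fun z => ∑ j, a j * φ j z, ⟨∑ j, |a j| / r, by positivity, fun z w => ?_⟩,
    ⟨∑ j, |a j|, fun z => ?_⟩, fun i => ?_⟩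
  · rw [← Finset.sum_sub_distrib, Finset.sum_mul]
    refine (Finset.abs_sum_le_sum_abs _ _).trans (Finset.sum_le_sum fun j _ => ?_)
    rw [← mul_sub, abs_mul]
    calc |a j| * |φ j z - φ j w| ≤ |a j| * (‖z - w‖ / r) := by gcongr; exact hφL j z w
      _ = _ := by ring
  · refine (Finset.abs_sum_le_sum_abs _ _).trans (Finset.sum_le_sum fun j _ => ?_)
    rw [abs_mul, abs_of_nonneg (le_max_left 0 _ : 0 ≤ φ j z)]
    exact mul_le_of_le_one_right (abs_nonneg _) (max_le zero_le_one (min_le_left _ _))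
  · filter_upwards [Metric.ball_mem_nhds (p i) hr0] with z hz
    rw [mem_ball_iff_norm] at hz
    rw [Finset.sum_eq_single i (fun j _ hj => ?_) (by simp), hφ1 i z hz, mul_one]
    rw [hφ0 j z ?_, mul_zero]
    have h1 := norm_sub_le_norm_sub_add_norm_sub (p i) z (p j)
    rw [norm_sub_rev (p i) z] at h1
    linarith [hr i j hj.symm]

/-- A continuous function with slopes at least `1 / 2` is an order isomorphism. -/
theorem exists_orderIso_of_slope {f : ℝ → ℝ} (hf : Continuous f)
    (h : ∀ u u', u ≤ u' → (u' - u) / 2 ≤ f u' - f u) : ∃ e : ℝ ≃o ℝ, ∀ u, e u = f u := by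
  have hmono : StrictMono f := fun u u' huu => by linarith [h u u' huu.le]
  have htop : Tendsto f atTop atTop := by
    refine tendsto_atTop_mono' _ ?_
      (tendsto_atTop_add_const_left atTop (f 0) (tendsto_id.atTop_div_const two_pos))
    filter_upwards [eventually_ge_atTop 0] with u hu
    have := h 0 u hu
    simp only [id]
    linarith
  have hbot : Tendsto f atBot atBot := by
    refine tendsto_atBot_mono' _ ?_
      (tendsto_atBot_add_const_left atBot (f 0) (tendsto_id.atBot_div_const two_pos))
    filter_upwards [eventually_le_atBot 0] with u hu
    have := h u 0 hu
    simp only [id]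
    linarith
  exact ⟨hmono.orderIsoOfSurjective f (hf.surjective htop hbot), fun u => rfl⟩

/-- A finite union of segments is isotopic to a pointed plat if some function of the first
coordinate grows from `0` to `1` along every segment, if the segments are disjoint but for their
end points, in which they meet in pairs, and if these end points have different projections to the
plane. -/
theorem exists_isPointedPlat_of_segments {V K : Type*} [Fintype V] [Fintype K] {v : V → E3}
    (hv : Function.Injective fun i => (v i).1) (a b : K → V) {h : ℝ → ℝ} (hcont : Continuous h)
    {C : ℝ} (hC : ∀ x, |h x| ≤ C)
    (hseg : ∀ k, ∀ u ∈ Icc (0 : ℝ) 1, h (AffineMap.lineMap (v (a k)) (v (b k)) u).1.re = u)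
    (hdisj : ∀ k l, ∀ u ∈ Ioo (0 : ℝ) 1, ∀ u' ∈ Ioo (0 : ℝ) 1,
      AffineMap.lineMap (v (a k)) (v (b k)) u = AffineMap.lineMap (v (a l)) (v (b l)) u' → k = l)
    (ha : ∀ k, ∃ l, l ≠ k ∧ ∀ m, a m = a k ↔ m = k ∨ m = l)
    (hb : ∀ k, ∃ l, l ≠ k ∧ ∀ m, b m = b k ↔ m = k ∨ m = l) :
    ∃ q : K → ℝ → ℂ, IsPointedPlat q ∧
      Isotopic (fun _ : Unit => toS3 (⋃ k,
        (fun u : ℝ => AffineMap.lineMap (v (a k)) (v (b k)) u) '' Icc 0 1))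
        fun _ => ⋃ k, toS3 (strand (q k)) := by
  classical
  -- The vertical coordinate is scaled down, to a slope that cannot compete with that of `h`, and the
  -- function `c` corrects the levels of the end points to exactly `0` and `1`. Since `c` is constant
  -- near their projections, the segments remain straight there.
  obtain ⟨c, ⟨M, hM0, hM⟩, ⟨C', hC'⟩, hc⟩ := exists_plateau hv fun i => (v i).2
  have hcc : Continuous c := by
    refine continuous_iff_continuousAt.2 fun z => ?_
    refine tendsto_iff_dist_tendsto_zero.2 (squeeze_zero (fun _ => dist_nonneg)
      (fun w => (hM w z)) ?_)
    have : Continuous fun w : ℂ => M * ‖w - z‖ := by fun_prop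
    simpa using this.tendsto z
  set z : K → ℝ → ℂ := fun k u => (v (a k)).1 + u * ((v (b k)).1 - (v (a k)).1) with hz
  set t : K → ℝ → ℝ := fun k u => (v (a k)).2 + u * ((v (b k)).2 - (v (a k)).2) with ht
  have hline (k) (u : ℝ) : AffineMap.lineMap (v (a k)) (v (b k)) u = (z k u, t k u) := by
    rw [AffineMap.lineMap_apply_module']
    refine Prod.ext ?_ ?_
    · simp [hz, add_comm]
    · simp [ht, add_comm]
  have hzc (k) : Continuous (z k) := by fun_prop
  simp only [hline] at hseg hdisj ⊢
  set D : K → ℝ := fun k => |(v (b k)).2 - (v (a k)).2| + M * ‖(v (b k)).1 - (v (a k)).1‖ with hD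
  have hD0 (k) : 0 ≤ D k := by positivity
  set ε : ℝ := 1 / (2 * (1 + ∑ k, D k)) with hε
  have hS : 0 ≤ ∑ k, D k := Finset.sum_nonneg fun k _ => hD0 k
  have hε0 : 0 < ε := by positivity
  have hε1 : ε ≤ 1 := by
    rw [hε, div_le_one (by positivity)]
    linarith
  have hεD (k) : ε * D k ≤ 1 / 2 := by
    have h1 := Finset.single_le_sum (fun k _ => hD0 k) (Finset.mem_univ k)
    rw [hε, div_mul_eq_mul_div, one_mul, div_le_div_iff₀ (by positivity) two_pos]
    linarith
  -- The level of the point at the time `u` of the segment number `k`, after the shear.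
  set f : K → ℝ → ℝ := fun k u => u + ε * (t k u - c (z k u)) with hf
  have hfc (k) : Continuous (f k) := by fun_prop
  have hslope (k) (u u' : ℝ) (huu : u ≤ u') : (u' - u) / 2 ≤ f k u' - f k u := by
    have h1 : t k u' - t k u = (u' - u) * ((v (b k)).2 - (v (a k)).2) := by simp only [ht]; ring
    have h2 : z k u' - z k u = (u' - u : ℝ) * ((v (b k)).1 - (v (a k)).1) := by
      simp only [hz]; push_cast; ring
    have h3 := hM (z k u') (z k u)
    rw [h2, norm_mul, Complex.norm_real, Real.norm_eq_abs, abs_of_nonneg (sub_nonneg.2 huu)] at h3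
    have h4 : |(t k u' - t k u) - (c (z k u') - c (z k u))| ≤ (u' - u) * D k := by
      refine (abs_sub _ _).trans ?_
      rw [h1, abs_mul, abs_of_nonneg (sub_nonneg.2 huu)]
      simp only [hD]
      linarith
    have h5 := neg_le_of_abs_le h4
    have h6 : ε * ((u' - u) * D k) ≤ (u' - u) / 2 := by
      nlinarith [mul_le_mul_of_nonneg_left (hεD k) (sub_nonneg.2 huu)]
    simp only [hf]
    nlinarith [mul_le_mul_of_nonneg_left h5 hε0.le]
  choose e he using fun k => exists_orderIso_of_slope (hfc k) (hslope k)
  have hz0 (k) : z k 0 = (v (a k)).1 := by simp [hz]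
  have hz1 (k) : z k 1 = (v (b k)).1 := by simp [hz]
  have ht0 (k) : t k 0 = (v (a k)).2 := by simp [ht]
  have ht1 (k) : t k 1 = (v (b k)).2 := by simp [ht]
  have hf0 (k) : f k 0 = 0 := by
    simp [hf, ht0, hz0, (hc (a k)).self_of_nhds]
  have hf1 (k) : f k 1 = 1 := by
    simp [hf, ht1, hz1, (hc (b k)).self_of_nhds]
  have he0 (k) : (e k).symm 0 = 0 := by rw [OrderIso.symm_apply_eq, he, hf0]
  have he1 (k) : (e k).symm 1 = 1 := by rw [OrderIso.symm_apply_eq, he, hf1]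
  have hec (k) : Continuous (e k).symm := (e k).symm.continuous
  have hmem (k) (τ) (hτ : τ ∈ Ioo (0 : ℝ) 1) : (e k).symm τ ∈ Ioo (0 : ℝ) 1 := by
    rw [← he0 k, ← he1 k]
    exact ⟨(e k).symm.strictMono hτ.1, (e k).symm.strictMono hτ.2⟩
  have hef (k) (τ : ℝ) : f k ((e k).symm τ) = τ := by rw [← he, OrderIso.apply_symm_apply]
  have hslope_pos (k) : 0 < 1 + ε * ((v (b k)).2 - (v (a k)).2) := by
    have h1 : |(v (b k)).2 - (v (a k)).2| ≤ D k := le_add_of_nonneg_right (by positivity)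
    nlinarith [neg_le_of_abs_le (h1), hεD k]
  refine ⟨fun k τ => z k ((e k).symm τ), ⟨fun k => (hzc k).comp (hec k), ?_, ?_, ?_, ?_, ?_⟩, ?_⟩
  · intro τ hτ k l hkl hq
    apply hkl
    have hk := hmem k τ hτ
    have hl := hmem l τ hτ
    -- The function `h` recovers the time from the projection to the plane, so the two points have
    -- equal times, and since their levels agree they had equal heights before the shear.
    have h1 : (e k).symm τ = (e l).symm τ := by
      rw [← hseg k _ (Ioo_subset_Icc_self hk), ← hseg l _ (Ioo_subset_Icc_self hl)]
      rw [show z k ((e k).symm τ) = z l ((e l).symm τ) from hq]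
    refine hdisj k l _ hk _ hl (Prod.ext hq ?_)
    have h2 := (hef k τ).trans (hef l τ).symm
    simp only [hf] at h2 hq
    rw [hq, h1] at h2
    have h3 := mul_left_cancel₀ hε0.ne' (add_left_cancel h2)
    rw [← h1] at h3 ⊢
    linarith
  · have h1 : ∀ᶠ τ in 𝓝 (0 : ℝ), ∀ k, c (z k ((e k).symm τ)) = (v (a k)).2 := by
      refine eventually_all.2 fun k => ?_
      have h2 : Tendsto (fun τ => z k ((e k).symm τ)) (𝓝 0) (𝓝 (v (a k)).1) := by
        simpa only [he0, hz0] using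
          (show Continuous fun τ => z k ((e k).symm τ) from (hzc k).comp (hec k)).tendsto 0
      exact h2.eventually (hc (a k))
    obtain ⟨δ, hδ, h2⟩ := Metric.eventually_nhds_iff.1 h1
    refine ⟨δ / 2, by positivity, fun k => ((v (b k)).1 - (v (a k)).1) /
      ((1 + ε * ((v (b k)).2 - (v (a k)).2) : ℝ) : ℂ), fun k τ hτ => ?_⟩
    have h3 := h2 (y := τ) (by
      rw [Real.dist_eq, sub_zero, abs_of_nonneg hτ.1]; linarith [hτ.2]) k
    have h4 := hef k τ
    simp only [hf] at h4
    rw [h3] at h4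
    have h5 : (e k).symm τ = τ / (1 + ε * ((v (b k)).2 - (v (a k)).2)) := by
      rw [eq_div_iff (hslope_pos k).ne']
      simp only [ht] at h4
      linarith
    simp only [he0, hz0]
    simp only [h5, hz]
    push_cast
    ring
  · have h1 : ∀ᶠ τ in 𝓝 (0 : ℝ), ∀ k, c (z k ((e k).symm (1 - τ))) = (v (b k)).2 := by
      refine eventually_all.2 fun k => ?_
      have h2 : Tendsto (fun τ => z k ((e k).symm (1 - τ))) (𝓝 0) (𝓝 (v (b k)).1) := by
        have : Continuous fun τ => z k ((e k).symm (1 - τ)) :=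
          ((hzc k).comp (hec k)).comp (continuous_const.sub continuous_id)
        simpa [he1, hz1] using this.tendsto 0
      exact h2.eventually (hc (b k))
    obtain ⟨δ, hδ, h2⟩ := Metric.eventually_nhds_iff.1 h1
    refine ⟨δ / 2, by positivity, fun k => -(((v (b k)).1 - (v (a k)).1) /
      ((1 + ε * ((v (b k)).2 - (v (a k)).2) : ℝ) : ℂ)), fun k τ hτ => ?_⟩
    have h3 := h2 (y := τ) (by
      rw [Real.dist_eq, sub_zero, abs_of_nonneg hτ.1]; linarith [hτ.2]) k
    have h4 := hef k (1 - τ)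
    simp only [hf] at h4
    rw [h3] at h4
    have h5 : (e k).symm (1 - τ) = 1 - τ / (1 + ε * ((v (b k)).2 - (v (a k)).2)) := by
      rw [eq_sub_iff_add_eq, ← eq_sub_iff_add_eq', div_eq_iff (hslope_pos k).ne']
      simp only [ht] at h4
      linarith
    simp only [he1, hz1]
    simp only [h5, hz]
    push_cast
    ring
  · intro k
    obtain ⟨l, hl, h1⟩ := ha k
    refine ⟨l, hl, fun m => ?_⟩
    simp only [he0, hz0]
    rw [← h1 m]
    exact hv.eq_iff
  · intro k
    obtain ⟨l, hl, h1⟩ := hb k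
    refine ⟨l, hl, fun m => ?_⟩
    simp only [he1, hz1]
    rw [← h1 m]
    exact hv.eq_iff
  · have hG : Continuous fun w : ℂ => h w.re - ε * c w := by fun_prop
    have key := (isotopic_slant (fun _ : Unit => ⋃ k, (fun u : ℝ => ((z k u, t k u) : E3)) '' Icc 0 1)
      0 0 hε0 hε1).trans (isotopic_of_vertical_shear _ _ hG (C + ε * C') fun w => by
        refine (abs_sub _ _).trans (add_le_add (hC _) ?_)
        rw [abs_mul, abs_of_pos hε0]
        exact mul_le_mul_of_nonneg_left (hC' w) hε0.le)
    convert key using 2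
    rw [← toS3_iUnion, image_iUnion, image_iUnion]
    congr 1
    refine iUnion_congr fun k => ?_
    have h1 : Icc (0 : ℝ) 1 = e k '' Icc 0 1 := by
      rw [OrderIso.image_Icc, he, he, hf0, hf1]
    rw [strand]
    conv_lhs => rw [h1]
    simp only [← image_comp]
    refine image_congr fun u hu => ?_
    simp only [Function.comp_apply, OrderIso.symm_apply_apply]
    rw [slant_apply, he]
    have h2 := hseg k u hu
    refine Prod.ext (by simp) ?_
    simp only [hf, Complex.ofReal_zero, zero_mul, add_zero, h2]
    ring

/-- If the vertices of a polygon belong to two classes alternately, then every vertex of one of the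
classes is an end point of exactly two edges. -/
theorem exists_partner {V : Type*} (τ : Equiv.Perm V) {lev : V → Prop}
    [DecidablePred lev]
    (hlev : ∀ i, lev (τ i) ↔ ¬ lev i) (k : V) :
    ∃ l, l ≠ k ∧ ∀ m, (if lev m then m else τ m) = (if lev k then k else τ k) ↔ m = k ∨ m = l := by
  by_cases hk : lev k
  · have h1 : ¬ lev (τ.symm k) := by
      rw [← hlev, τ.apply_symm_apply]
      exact hk
    refine ⟨τ.symm k, fun h => h1 (by rwa [h]), fun m => ?_⟩
    rw [if_pos hk]
    split_ifs with hm
    · exact ⟨Or.inl, fun h => h.resolve_right fun h' => h1 (h' ▸ hm)⟩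
    · rw [← τ.eq_symm_apply]
      exact ⟨Or.inr, fun h => h.resolve_left fun h' => hm (h' ▸ hk)⟩
  · have h1 : lev (τ k) := (hlev k).2 hk
    refine ⟨τ k, fun h => hk (h ▸ h1), fun m => ?_⟩
    rw [if_neg hk]
    split_ifs with hm
    · exact ⟨Or.inr, fun h => h.resolve_left fun h' => hk (h' ▸ hm)⟩
    · rw [τ.injective.eq_iff]
      exact ⟨Or.inl, fun h => h.resolve_right fun h' => hm (h' ▸ h1)⟩

/-- A polygon becomes a pointed plat if it is folded like an accordion: every edge is subdivided
where its first coordinate takes one of finitely many values, and then the vertical coordinate is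
changed in such a way that these values lie on the levels `0` and `1` alternately. -/
theorem IsSimplePolygon.exists_isPointedPlat {V : Type} [Fintype V] [Nonempty V]
    {τ : Equiv.Perm V} {v : V → E3} (h : IsSimplePolygon τ v) :
    ∃ (K : Type) (_ : Fintype K) (_ : Nonempty K) (q : K → ℝ → ℂ), IsPointedPlat q ∧
      Isotopic (fun _ : Unit => toS3 (polygonCarrier τ v)) fun _ => ⋃ k, toS3 (strand (q k)) := by
  classical
  obtain ⟨v₁, h₁, hne₁, hiso₁⟩ := h.exists_re_ne
  obtain ⟨W, hW, hW', τ', w₂, h₂, hne₂, hG₂, hno₂, hcar⟩ := h₁.exists_subdivision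
    (Finset.univ.image fun i => (v₁ i).1.re) _ hne₁
    (fun i => Finset.mem_image_of_mem _ (Finset.mem_univ i)) le_rfl
  obtain ⟨w, hw, hre, hinj, hiso₃⟩ := h₂.exists_fst_injective
  set G := Finset.univ.image fun i => (v₁ i).1.re
  simp only [← hre] at hne₂ hG₂ hno₂
  obtain ⟨g, hcont, ⟨C, hC⟩, hval, -, hadj⟩ := exists_zigzag_function G
  have hstep (i : W) : g (w (τ' i)).1.re = 1 - g (w i).1.re ∧ ∀ u ∈ Icc (0 : ℝ) 1,
      g ((w i).1.re + u * ((w (τ' i)).1.re - (w i).1.re)) =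
        g (w i).1.re + u * (g (w (τ' i)).1.re - g (w i).1.re) := by
    rcases lt_or_gt_of_ne (hne₂ i) with hlt | hlt
    · refine hadj _ (hG₂ i) _ (hG₂ _) hlt fun x hx => ?_
      have := hno₂ i x hx
      rwa [uIoo_of_lt hlt] at this
    · obtain ⟨h5, h6⟩ := hadj _ (hG₂ _) _ (hG₂ i) hlt fun x hx => by
        have := hno₂ i x hx
        rwa [uIoo_of_gt hlt] at this
      refine ⟨by linarith, fun u hu => ?_⟩
      have h7 := h6 (1 - u) ⟨by linarith [hu.2], by linarith [hu.1]⟩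
      have h8 : (w (τ' i)).1.re + (1 - u) * ((w i).1.re - (w (τ' i)).1.re) =
          (w i).1.re + u * ((w (τ' i)).1.re - (w i).1.re) := by ring
      rw [← h8, h7]
      ring
  set lev : W → Prop := fun i => g (w i).1.re = 0 with hlevdef
  have hlev1 (i) (hi : ¬ lev i) : g (w i).1.re = 1 := (hval _ (hG₂ i)).resolve_left hi
  have hlev (i) : lev (τ' i) ↔ ¬ lev i := by
    simp only [hlevdef, (hstep i).1]
    constructor
    · intro h0 h1
      rw [h1] at h0
      norm_num at h0
    · intro h0
      rw [hlev1 i h0, sub_self]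
  have hline (i : W) (u : ℝ) : (AffineMap.lineMap (w i) (w (τ' i)) u).1.re =
      (w i).1.re + u * ((w (τ' i)).1.re - (w i).1.re) := by
    rw [AffineMap.lineMap_apply_module']
    simp [add_comm]
  set a : W → W := fun i => if lev i then i else τ' i with hadef
  set b : W → W := fun i => if ¬ lev i then i else τ' i with hbdef
  have hab (i) : (lev i ∧ a i = i ∧ b i = τ' i) ∨ (¬ lev i ∧ a i = τ' i ∧ b i = i) := by
    by_cases hi : lev i
    · exact Or.inl ⟨hi, if_pos hi, if_neg (not_not.2 hi)⟩
    · exact Or.inr ⟨hi, if_neg hi, if_pos hi⟩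
  have hseg (i : W) : ∀ u ∈ Icc (0 : ℝ) 1,
      g (AffineMap.lineMap (w (a i)) (w (b i)) u).1.re = u := by
    intro u hu
    rcases hab i with ⟨hi, h1, h2⟩ | ⟨hi, h1, h2⟩
    · rw [h1, h2, hline, (hstep i).2 u hu, (hstep i).1, show g (w i).1.re = 0 from hi]
      ring
    · rw [h1, h2, ← AffineMap.lineMap_apply_one_sub, hline,
        (hstep i).2 (1 - u) ⟨by linarith [hu.2], by linarith [hu.1]⟩, (hstep i).1, hlev1 i hi]
      ring
  have hdisj : ∀ i j, ∀ u ∈ Ioo (0 : ℝ) 1, ∀ u' ∈ Ioo (0 : ℝ) 1,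
      AffineMap.lineMap (w (a i)) (w (b i)) u = AffineMap.lineMap (w (a j)) (w (b j)) u' →
        i = j := by
    have h5 (i : W) (u : ℝ) (hu : u ∈ Ioo (0 : ℝ) 1) : ∃ s ∈ Ico (0 : ℝ) 1,
        AffineMap.lineMap (w (a i)) (w (b i)) u = AffineMap.lineMap (w i) (w (τ' i)) s := by
      rcases hab i with ⟨-, h1, h2⟩ | ⟨-, h1, h2⟩
      · exact ⟨u, Ioo_subset_Ico_self hu, by rw [h1, h2]⟩
      · exact ⟨1 - u, ⟨by linarith [hu.2], by linarith [hu.1]⟩, by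
          rw [h1, h2, AffineMap.lineMap_apply_one_sub]⟩
    intro i j u hu u' hu' huu
    obtain ⟨s, hs, h6⟩ := h5 i u hu
    obtain ⟨s', hs', h7⟩ := h5 j u' hu'
    rw [h6, h7] at huu
    exact (hw i j s hs s' hs' huu).1
  obtain ⟨q, hq, hiso⟩ := exists_isPointedPlat_of_segments hinj a b hcont hC hseg hdisj
    (exists_partner τ' hlev) (exists_partner (lev := fun i => ¬ lev i) τ' fun i => not_congr (hlev i))
  refine ⟨W, hW, hW', q, hq, hiso₁.trans ?_⟩
  rw [← hcar]
  refine hiso₃.trans ?_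
  convert hiso using 2
  rw [polygonCarrier]
  refine congrArg toS3 (iUnion_congr fun i => ?_)
  rcases hab i with ⟨-, h1, h2⟩ | ⟨-, h1, h2⟩
  · rw [h1, h2]
  · rw [h1, h2]
    ext x
    constructor
    · rintro ⟨u, hu, rfl⟩
      exact ⟨1 - u, ⟨by linarith [hu.2], by linarith [hu.1]⟩, AffineMap.lineMap_apply_one_sub _ _ _⟩
    · rintro ⟨u, hu, rfl⟩
      exact ⟨1 - u, ⟨by linarith [hu.2], by linarith [hu.1]⟩, AffineMap.lineMap_apply_one_sub _ _ _⟩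

/-! ### Colouring and sorting the strings -/

/-- Two fixed point free involutions have a common colouring with two colours: neither of the
involutions maps a point into its own orbit under their composite, and both of them exchange the
same pairs of such orbits. -/
theorem exists_two_colouring {K : Type*} {a b : K → K} (ha : ∀ k, a (a k) = k)
    (hb : ∀ k, b (b k) = k) (ha' : ∀ k, a k ≠ k) (hb' : ∀ k, b k ≠ k) :
    ∃ c : K → Bool, (∀ k, c (a k) = !c k) ∧ ∀ k, c (b k) = !c k := by
  classical
  let A : Equiv.Perm K := ⟨a, a, ha, ha⟩
  let B : Equiv.Perm K := ⟨b, b, hb, hb⟩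
  let f : Equiv.Perm K := A * B
  have hAA : A * A = 1 := Equiv.ext ha
  have hBB : B * B = 1 := Equiv.ext hb
  have hAinv : A⁻¹ = A := inv_eq_of_mul_eq_one_left hAA
  have hBinv : B⁻¹ = B := inv_eq_of_mul_eq_one_left hBB
  have hfinv : f⁻¹ = B * A := by rw [mul_inv_rev, hAinv, hBinv]
  have hconj : A * f * A⁻¹ = f⁻¹ := by
    rw [hfinv, hAinv]
    calc A * (A * B) * A = (A * A) * B * A := by group
      _ = B * A := by rw [hAA, one_mul]
  have hpow (i : ℤ) (k : K) : a ((f ^ i) k) = (f ^ (-i)) (a k) := by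
    have h1 : A * f ^ i * A⁻¹ = f ^ (-i) := by
      rw [← conj_zpow, hconj, inv_zpow, zpow_neg]
    have h2 : A * f ^ i = f ^ (-i) * A := by rw [← h1]; group
    exact congrArg (fun g : Equiv.Perm K => g k) h2
  have hne (k : K) : ¬ f.SameCycle k (a k) := by
    rintro ⟨i, hi⟩
    rcases Int.even_or_odd' i with ⟨j, rfl | rfl⟩
    · apply ha' ((f ^ j) k)
      rw [hpow, ← hi, ← Equiv.Perm.mul_apply, ← zpow_add]
      congr 2; ring
    · have h1 : a ((f ^ (j + 1)) k) = (f ^ j) k := by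
        rw [hpow, ← hi, ← Equiv.Perm.mul_apply, ← zpow_add]
        congr 2; ring
      have h2 : (f ^ j) k = f⁻¹ ((f ^ (j + 1)) k) := by
        rw [← zpow_neg_one, ← Equiv.Perm.mul_apply, ← zpow_add]
        congr 2; ring
      rw [hfinv] at h2
      have h3 : b (a ((f ^ (j + 1)) k)) = (f ^ j) k := h2.symm
      rw [h1] at h3
      exact hb' _ h3
  let o : K → Quotient (Equiv.Perm.SameCycle.setoid f) := fun k => Quotient.mk _ k
  have hoa (k : K) : o k ≠ o (a k) := fun h => hne k (Quotient.exact h)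
  have hof (k : K) : o (f k) = o k := Quotient.sound (Equiv.Perm.sameCycle_apply_left.2 (Equiv.Perm.SameCycle.refl f k))
  have hob (k : K) : o (b k) = o (a k) := by
    rw [← hof (b k)]
    change o (a (b (b k))) = _
    rw [hb]
  let R := @WellOrderingRel (Quotient (Equiv.Perm.SameCycle.setoid f))
  have key (x y) (hxy : x ≠ y) : decide (R y x) = !decide (R x y) := by
    rcases trichotomous_of R x y with h | h | h
    · have h' : ¬ R y x := fun h' => asymm_of R h h'
      simp [h, h']
    · exact absurd h hxy
    · have h' : ¬ R x y := fun h' => asymm_of R h h'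
      simp [h, h']
  refine ⟨fun k => decide (R (o k) (o (a k))), fun k => ?_, fun k => ?_⟩
  · simp only
    rw [ha]; exact key _ _ (hoa k)
  · have h1 : o (a (b k)) = o k := hof k
    simp only
    rw [hob, h1]; exact key _ _ (hoa k)

/-- For a non-decreasing function on an initial segment of the natural numbers, the fibre over `j`
is the interval that begins at the number of arguments with smaller values. -/
theorem eq_iff_of_monotone {n μ : ℕ} {f : Fin n → Fin μ} (hf : Monotone f) (i : Fin n)
    (j : Fin μ) :
    f i = j ↔
      ∑ j' ∈ Finset.Iio j, (Finset.univ.filter fun i => f i = j').card ≤ (i : ℕ) ∧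
      (i : ℕ) < ∑ j' ∈ Finset.Iic j, (Finset.univ.filter fun i => f i = j').card := by
  have hsum (s : Finset (Fin μ)) : ∑ j' ∈ s, (Finset.univ.filter fun i => f i = j').card =
      (Finset.univ.filter fun i => f i ∈ s).card := by
    rw [Finset.card_eq_sum_card_fiberwise (s := Finset.univ.filter fun i => f i ∈ s) (t := s)
      (f := f) (by intro x hx; simpa using hx)]
    refine Finset.sum_congr rfl fun j' hj' => ?_
    congr 1
    ext x
    simp only [Finset.mem_filter, Finset.mem_univ, true_and]
    exact ⟨fun h => ⟨h ▸ hj', h⟩, fun h => h.2⟩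
  have hle (p : Fin μ → Prop) [DecidablePred p] (hp : ∀ x y, x ≤ y → p y → p x) :
      p (f i) ↔ (i : ℕ) < (Finset.univ.filter fun i => p (f i)).card := by
    constructor
    · intro h
      have hsub : Finset.Iic i ⊆ Finset.univ.filter fun i => p (f i) := by
        intro x hx
        simp only [Finset.mem_filter, Finset.mem_univ, true_and]
        exact hp _ _ (hf (Finset.mem_Iic.1 hx)) h
      have := Finset.card_le_card hsub
      rw [Fin.card_Iic] at this
      omega
    · intro h
      by_contra hn
      have hsub : (Finset.univ.filter fun i => p (f i)) ⊆ Finset.Iio i := by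
        intro x hx
        simp only [Finset.mem_filter, Finset.mem_univ, true_and] at hx
        rw [Finset.mem_Iio]
        by_contra hxi
        exact hn (hp _ _ (hf (not_lt.1 hxi)) hx)
      have := Finset.card_le_card hsub
      rw [Fin.card_Iio] at this
      omega
  rw [hsum, hsum]
  simp only [Finset.mem_Iio, Finset.mem_Iic]
  rw [← hle (fun x => x ≤ j) (fun x y hxy hy => hxy.trans hy), ← not_lt,
    ← hle (fun x => x < j) (fun x y hxy hy => hxy.trans_lt hy)]
  constructor
  · rintro rfl; exact ⟨lt_irrefl _, le_rfl⟩
  · rintro ⟨h1, h2⟩; exact le_antisymm h2 (not_lt.1 h1)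

/-! ### Special plat presentations from pointed plats -/

theorem Link.isClosed_component {μ : ℕ} (L : Link μ) (j : Fin μ) : IsClosed (L.component j) := by
  obtain ⟨P, H, hpoly, -, hH⟩ := L.tame
  obtain ⟨m, p, -, -, hp⟩ := hpoly j
  have hcomp : IsCompact (P j) := by
    rw [hp, Polygon.boundary]
    refine isCompact_iUnion fun i => ?_
    rw [Polygon.edgeSet_eq_image_edgePath]
    refine isCompact_Icc.image ?_
    exact AffineMap.lineMap_continuous
  have h1 : IsClosed (toS3 (P j)) := (hcomp.image OnePoint.continuous_coe).isClosed
  rw [← hH j] at h1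
  exact H.final.isClosed_image.1 h1

theorem Link.disjoint_component {μ : ℕ} (L : Link μ) {j j' : Fin μ} (h : j ≠ j') :
    Disjoint (L.component j) (L.component j') := by
  obtain ⟨P, H, -, hdisj, hH⟩ := L.tame
  have h1 : Disjoint (toS3 (P j)) (toS3 (P j')) :=
    (disjoint_image_iff OnePoint.coe_injective).2 (hdisj h)
  rw [← hH j, ← hH j'] at h1
  exact (disjoint_image_iff H.final.injective).1 h1

theorem isPreconnected_toS3_strand {q : ℝ → ℂ} (hq : Continuous q) :
    IsPreconnected (toS3 (strand q)) := by
  refine IsPreconnected.image ?_ _ OnePoint.continuous_coe.continuousOn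
  exact isPreconnected_Icc.image _ (hq.prodMk continuous_id).continuousOn

/-- A connected set that is covered by finitely many disjoint closed sets lies in one of them. -/
theorem exists_subset_of_isPreconnected {X ι : Type*} [TopologicalSpace X] [Finite ι] {S : Set X}
    (hS : IsPreconnected S) (hne : S.Nonempty) {C : ι → Set X} (hC : ∀ j, IsClosed (C j))
    (hd : ∀ j j', j ≠ j' → Disjoint (C j) (C j')) (hcov : S ⊆ ⋃ j, C j) : ∃ j, S ⊆ C j := by
  obtain ⟨x, hx⟩ := hne
  obtain ⟨j, hj⟩ := mem_iUnion.1 (hcov hx)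
  refine ⟨j, ?_⟩
  have hcl : IsClosed (⋃ i : {i // i ≠ j}, C i) := isClosed_iUnion_of_finite fun i => hC i
  have hdis : Disjoint (C j) (⋃ i : {i // i ≠ j}, C i) :=
    disjoint_iUnion_right.2 fun i => hd j i i.2.symm
  have hsub : S ⊆ C j ∪ ⋃ i : {i // i ≠ j}, C i := by
    intro y hy
    obtain ⟨i, hi⟩ := mem_iUnion.1 (hcov hy)
    by_cases hij : i = j
    · exact Or.inl (hij ▸ hi)
    · exact Or.inr (mem_iUnion.2 ⟨⟨i, hij⟩, hi⟩)
  rcases isPreconnected_iff_subset_of_disjoint_closed.1 hS _ _ (hC j) hcl hsub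
    (by rw [hdis.inter_eq, inter_empty]) with h | h
  · exact h
  · exact (disjoint_left.1 hdis hj (h hx)).elim

/-- A pointed plat with straightened tips, placed according to the numbering of the strings at the
level `0` and to the numbering `bot` at the level `1`, is a plat up to the change of levels. -/
theorem IsPointedPlat.exists_isWedgePlat {n : ℕ} (hn : 0 < n) {q : Fin (2 * n) → ℝ → ℂ}
    (h : IsPointedPlat q) (h0 : ∀ k l, q k 0 = q l 0 ↔ (k : ℕ) / 2 = l / 2)
    (bot : Fin (2 * n) → Fin (2 * n)) (hbot : Function.Injective bot)
    (h1 : ∀ k l, q k 1 = q l 1 ↔ (bot k : ℕ) / 2 = bot l / 2) :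
    ∃ (q' : Fin (2 * n) → ℝ → ℂ) (δ₁ δ₂ : ℝ) (β : GeometricBraid (2 * n)),
      IsWedgePlat q' δ₁ δ₂ β bot ∧
      Isotopic (fun k => toS3 (strand (q k))) fun k => toS3 (strand (q' k)) := by
  have : Nonempty (Fin (2 * n)) := ⟨⟨0, by omega⟩⟩
  have hside (k : ℕ) : ‖((arcSide k : ℝ) : ℂ)‖ = 1 := by
    rw [Complex.norm_real, Real.norm_eq_abs]
    simp only [arcSide]; split_ifs <;> norm_num
  have hfar (k l : ℕ) (hkl : k / 2 ≠ l / 2) :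
      2 ≤ ‖((arcCenter k : ℝ) : ℂ) - ((arcCenter l : ℝ) : ℂ)‖ := by
    rw [← Complex.ofReal_sub, Complex.norm_real]
    exact two_le_arcCenter_sub hkl
  have hsides (k l : ℕ) (hkl : k ≠ l) (hkl' : k / 2 = l / 2) :
      ((arcSide k : ℝ) : ℂ) ≠ ((arcSide l : ℝ) : ℂ) := by
    intro heq
    have := Complex.ofReal_injective heq
    simp only [arcSide] at this
    split_ifs at this <;> first | omega | norm_num at this
  obtain ⟨q₁, hq₁, heq₁, ⟨δ₁, hδ₁, htop⟩, hiso₁⟩ := h.exists_straight_zero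
    (fun k => ((arcCenter k : ℝ) : ℂ)) (fun k => ((arcSide k : ℝ) : ℂ)) (fun k => hside k)
    (fun k l hkl => by rw [arcCenter_eq_iff.2 ((h0 k l).1 hkl)])
    (fun k l hkl => hfar k l fun h' => hkl ((h0 k l).2 h'))
    (fun k l hkl hkl' => hsides k l (fun h' => hkl (Fin.ext h')) ((h0 k l).1 hkl'))
  have h1' (k l) : q₁ k (1 - 0) = q₁ l (1 - 0) ↔ (bot k : ℕ) / 2 = bot l / 2 := by
    rw [← h1 k l, sub_zero, heq₁ k 1 (by norm_num), heq₁ l 1 (by norm_num)]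
  obtain ⟨q₂, hq₂, heq₂, ⟨δ₂, hδ₂, hbt⟩, hiso₂⟩ := hq₁.flip.exists_straight_zero
    (fun k => ((arcCenter (bot k) : ℝ) : ℂ)) (fun k => ((arcSide (bot k) : ℝ) : ℂ))
    (fun k => hside (bot k))
    (fun k l hkl => by rw [arcCenter_eq_iff.2 ((h1' k l).1 hkl)])
    (fun k l hkl => hfar _ _ fun h' => hkl ((h1' k l).2 h'))
    (fun k l hkl hkl' => hsides _ _ (fun h' => hkl (hbot (Fin.ext h'))) ((h1' k l).1 hkl'))
  have hlt : δ₁ + δ₂ < 1 := by linarith [hδ₁.2, hδ₂.2]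
  have htop' (k : Fin (2 * n)) (t : ℝ) (ht : t ∈ Icc 0 δ₁) :
      q₂ k (1 - t) = ((arcCenter k + t / (2 * δ₁) * arcSide k : ℝ) : ℂ) := by
    rw [heq₂ k _ (by linarith [ht.2, hδ₁.2]), sub_sub_cancel, htop k t ht]
    push_cast; ring
  have hbt' (k : Fin (2 * n)) (t : ℝ) (ht : t ∈ Icc 0 δ₂) :
      q₂ k t = ((arcCenter (bot k) + t / (2 * δ₂) * arcSide (bot k) : ℝ) : ℂ) := by
    rw [hbt k t ht]
    push_cast; ring
  have hend (k : ℕ) (δ : ℝ) (hδ : 0 < δ) :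
      ((arcCenter k + δ / (2 * δ) * arcSide k : ℝ) : ℂ) = endpoint k := by
    have : δ / (2 * δ) = 1 / 2 := by field_simp
    rw [this, arcCenter_add_arcSide, endpoint]; simp
  have hone (k : Fin (2 * n)) :
      q₂ k (1 - (δ₁ + (1 - δ₁ - δ₂) * ((1 : I) : ℝ))) = endpoint (bot k) := by
    have e : 1 - (δ₁ + (1 - δ₁ - δ₂) * ((1 : I) : ℝ)) = δ₂ := by
      rw [Icc.coe_one]; ring
    rw [e, hbt' k δ₂ ⟨hδ₂.1.le, le_rfl⟩, hend _ _ hδ₂.1]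
  let β : GeometricBraid (2 * n) :=
    { path := fun k t => q₂ k (1 - (δ₁ + (1 - δ₁ - δ₂) * t))
      continuous_path := fun k => (hq₂.continuous k).comp (by fun_prop)
      path_ne := fun t k l hkl => by
        refine hq₂.ne _ ⟨?_, ?_⟩ k l hkl
        · nlinarith [t.2.1, t.2.2, hδ₂.1]
        · nlinarith [t.2.1, t.2.2, hδ₁.1]
      path_zero := fun k => by
        have e : 1 - (δ₁ + (1 - δ₁ - δ₂) * ((0 : I) : ℝ)) = 1 - δ₁ := by
          rw [Icc.coe_zero]; ring
        rw [e, htop' k δ₁ ⟨hδ₁.1.le, le_rfl⟩, hend _ _ hδ₁.1]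
      range_path_one := by
        simp only [hone]
        exact (Finite.surjective_of_injective hbot).range_comp (fun k : Fin (2 * n) => endpoint k) }
  refine ⟨fun k t => q₂ k (1 - t), δ₁, δ₂, β, ⟨hδ₁.1, hδ₂.1, hlt,
    Finite.surjective_of_injective hbot, htop', fun k t => rfl, fun k t ht => ?_⟩, ?_⟩
  · rw [sub_sub_cancel, hbt' k t ht]
  · have := hiso₂.flip
    simp only [sub_sub_cancel] at this
    exact hiso₁.trans this

/-- A link that is isotopic to a pointed plat with `2n` strings has a special `2n`-plat
presentation. The strings are given two colours, such that any two strings that meet have different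
colours. The strings of the first colour, sorted by the components of the link, receive the odd
places, at the top as well as at the bottom; each of the other strings is placed next to the string
that it meets. -/
theorem Link.exists_isSpecial {μ n : ℕ} (L : Link μ) (hn : 0 < n) {K : Type*} [Fintype K]
    (hcard : Fintype.card K = 2 * n) {q : K → ℝ → ℂ} (h : IsPointedPlat q)
    (hiso : Isotopic (fun _ : Unit => L.carrier) fun _ => ⋃ k, toS3 (strand (q k))) :
    ∃ P : PlatPresentation L n, P.IsSpecial := by
  classical
  choose a ha' ha using h.meet_zero
  choose b hb' hb using h.meet_one
  have haa (k) : a (a k) = k := by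
    have h1 := (ha (a k) k).1 ((ha k (a k)).2 (Or.inr rfl)).symm
    exact (h1.resolve_left fun h' => ha' k h'.symm).symm
  have hbb (k) : b (b k) = k := by
    have h1 := (hb (b k) k).1 ((hb k (b k)).2 (Or.inr rfl)).symm
    exact (h1.resolve_left fun h' => hb' k h'.symm).symm
  obtain ⟨H, hH⟩ := hiso
  have hH : H.final '' L.carrier = ⋃ k, toS3 (strand (q k)) := hH ()
  -- the components to which the strings belong
  let C : Fin μ → Set S3 := fun j => H.final '' L.component j
  have hCcl (j) : IsClosed (C j) := H.final.isClosed_image.2 (L.isClosed_component j)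
  have hCd (j j') (hj : j ≠ j') : Disjoint (C j) (C j') :=
    (disjoint_image_iff H.final.injective).2 (L.disjoint_component hj)
  have hCcov : (⋃ j, C j) = ⋃ k, toS3 (strand (q k)) := by
    rw [← hH, Link.carrier, image_iUnion]
  have hmem0 (k : K) {t : ℝ} (ht : t ∈ Icc (0 : ℝ) 1) :
      (((q k t, t) : E3) : S3) ∈ toS3 (strand (q k)) := ⟨_, mem_strand ht, rfl⟩
  have hcomp (k : K) : ∃ j, toS3 (strand (q k)) ⊆ C j := by
    refine exists_subset_of_isPreconnected (isPreconnected_toS3_strand (h.continuous k))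
      ⟨_, hmem0 k ⟨le_rfl, zero_le_one⟩⟩ hCcl hCd ?_
    rw [hCcov]
    exact subset_iUnion (fun k => toS3 (strand (q k))) k
  choose comp hcomp using hcomp
  have hcomp_eq (k l : K) (t : ℝ) (ht : t ∈ Icc (0 : ℝ) 1) (hkl : q k t = q l t) :
      comp k = comp l := by
    by_contra hne
    refine disjoint_left.1 (hCd _ _ hne) (hcomp k (hmem0 k ht)) ?_
    rw [hkl]
    exact hcomp l (hmem0 l ht)
  have hcompa (k) : comp (a k) = comp k :=
    hcomp_eq _ _ 0 ⟨le_rfl, zero_le_one⟩ ((ha k (a k)).2 (Or.inr rfl))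
  have hcompb (k) : comp (b k) = comp k :=
    hcomp_eq _ _ 1 ⟨zero_le_one, le_rfl⟩ ((hb k (b k)).2 (Or.inr rfl))
  obtain ⟨col, hcola, hcolb⟩ := exists_two_colouring haa hbb ha' hb'
  -- the strings of the first colour, sorted by their components
  let T := {k : K // col k = true}
  have hTcard : Fintype.card T = n := by
    have e : T ≃ {k : K // ¬ col k = true} :=
      { toFun := fun k => ⟨a k.1, by rw [hcola, k.2]; simp⟩
        invFun := fun k => ⟨a k.1, by rw [hcola, Bool.eq_false_of_not_eq_true k.2]; rfl⟩
        left_inv := fun k => Subtype.ext (haa _)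
        right_inv := fun k => Subtype.ext (haa _) }
    have h1 := Fintype.card_congr e
    have h2 := Fintype.card_subtype_compl (fun k : K => col k = true)
    have h3 := Fintype.card_subtype_le (fun k : K => col k = true)
    change Fintype.card {k : K // col k = true} = n
    change Fintype.card {k : K // col k = true} = _ at h1
    omega
  obtain ⟨e, he⟩ : ∃ e : Fin n ≃ T, Monotone fun i => comp (e i) := by
    let e₀ : Fin n ≃ T := (Fintype.equivFinOfCardEq hTcard).symm
    refine ⟨(Tuple.sort fun i => comp (e₀ i)).trans e₀, ?_⟩
    exact Tuple.monotone_sort fun i => comp (e₀ i)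
  -- the numbering of all strings at the top
  let half : Fin (2 * n) → Fin n := fun m => ⟨(m : ℕ) / 2, by omega⟩
  let κ₀ : Fin (2 * n) → K := fun m => if (m : ℕ) % 2 = 0 then e (half m) else a (e (half m))
  have hcolκ (m : Fin (2 * n)) : col (κ₀ m) = decide ((m : ℕ) % 2 = 0) := by
    simp only [κ₀]
    split_ifs with hm
    · simpa [hm] using (e (half m)).2
    · rw [hcola, (e (half m)).2]; simp [hm]
  have hκinj : Function.Injective κ₀ := by
    intro m m' hmm
    have h1 : decide ((m : ℕ) % 2 = 0) = decide ((m' : ℕ) % 2 = 0) := by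
      rw [← hcolκ, ← hcolκ, hmm]
    have h2 : (m : ℕ) % 2 = 0 ↔ (m' : ℕ) % 2 = 0 := by simpa using h1
    have h3 : half m = half m' := by
      apply e.injective
      apply Subtype.ext
      simp only [κ₀] at hmm
      by_cases hm : (m : ℕ) % 2 = 0
      · rwa [if_pos hm, if_pos (h2.1 hm)] at hmm
      · rw [if_neg hm, if_neg fun h' => hm (h2.2 h')] at hmm
        rw [← haa (e (half m)), hmm, haa]
    have h4 : (m : ℕ) / 2 = (m' : ℕ) / 2 := congrArg Fin.val h3
    apply Fin.ext
    omega
  have hκbij : Function.Bijective κ₀ :=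
    (Fintype.bijective_iff_injective_and_card κ₀).2 ⟨hκinj, by rw [Fintype.card_fin, hcard]⟩
  let κ : Fin (2 * n) ≃ K := Equiv.ofBijective κ₀ hκbij
  have hκ (m) : κ m = κ₀ m := rfl
  have hcompκ (m) : comp (κ m) = comp (e (half m)) := by
    rw [hκ]
    simp only [κ₀]
    split_ifs
    · rfl
    · rw [hcompa]
  -- the numbering of all strings at the bottom
  have hbot (m : Fin (2 * n)) : ∃ l : Fin (2 * n), (l : ℕ) % 2 = (m : ℕ) % 2 ∧
      ((m : ℕ) % 2 = 0 → l = m) ∧ ((m : ℕ) % 2 = 1 → b (κ m) = e (half l)) := by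
    by_cases hm : (m : ℕ) % 2 = 0
    · exact ⟨m, rfl, fun _ => rfl, fun h' => by omega⟩
    · have hT : col (b (κ m)) = true := by rw [hcolb, hκ, hcolκ]; simp [hm]
      let i := e.symm ⟨b (κ m), hT⟩
      have hi := i.2
      refine ⟨⟨2 * i + 1, by omega⟩, by simp only; omega, fun h' => absurd h' hm, fun _ => ?_⟩
      have : half ⟨2 * i + 1, by omega⟩ = i := Fin.ext (by simp only [half]; omega)
      rw [this]
      simp only [i, Equiv.apply_symm_apply]
  choose bot hbotpar hboteven hbotodd using hbot
  -- the string of the first colour at the same bottom arc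
  let first : Fin (2 * n) → K := fun m => if (m : ℕ) % 2 = 0 then κ m else b (κ m)
  have hfirst (m) : first m = e (half (bot m)) := by
    simp only [first]
    split_ifs with hm
    · rw [hboteven m hm, hκ]
      simp only [κ₀, if_pos hm]
    · exact hbotodd m (by omega)
  have hbothalf (m m') : (bot m : ℕ) / 2 = bot m' / 2 ↔ first m = first m' := by
    rw [hfirst, hfirst]
    constructor
    · intro h'
      have : half (bot m) = half (bot m') := Fin.ext h'
      rw [this]
    · intro h'
      exact congrArg Fin.val (e.injective (Subtype.ext h'))
  have hbotinj : Function.Injective bot := by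
    intro m m' hmm
    have h1 : (m : ℕ) % 2 = (m' : ℕ) % 2 := by rw [← hbotpar m, hmm, hbotpar]
    have h2 := (hbothalf m m').1 (by rw [hmm])
    simp only [first] at h2
    apply κ.injective
    by_cases hm : (m : ℕ) % 2 = 0
    · rwa [if_pos hm, if_pos (by omega)] at h2
    · rw [if_neg hm, if_neg (by omega)] at h2
      rw [← hbb (κ m), h2, hbb]
  have hzero (m m') : q (κ m) 0 = q (κ m') 0 ↔ (m : ℕ) / 2 = m' / 2 := by
    have hrep (m : Fin (2 * n)) : q (κ m) 0 = q (e (half m)) 0 := by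
      rw [hκ]
      simp only [κ₀]
      split_ifs
      · rfl
      · exact (ha _ _).2 (Or.inr rfl)
    rw [hrep, hrep, ha]
    constructor
    · rintro (h' | h')
      · exact congrArg Fin.val (e.injective (Subtype.ext h'))
      · exfalso
        have := (e (half m)).2
        rw [h', hcola, (e (half m')).2] at this
        simp at this
    · intro h'
      have : half m = half m' := Fin.ext h'
      exact Or.inl (by rw [this])
  have hone (m m') : q (κ m) 1 = q (κ m') 1 ↔ (bot m : ℕ) / 2 = bot m' / 2 := by
    have hrep (m : Fin (2 * n)) : q (κ m) 1 = q (first m) 1 := by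
      simp only [first]
      split_ifs
      · rfl
      · exact ((hb _ _).2 (Or.inr rfl)).symm
    rw [hrep, hrep, hb, hbothalf]
    refine or_iff_left fun h' => ?_
    have h1 := congrArg col h'
    rw [hcolb, hfirst, hfirst, (e _).2, (e _).2] at h1
    simp at h1
  obtain ⟨q', δ₁, δ₂, β, hw, G, hG⟩ := (h.reindex κ).exists_isWedgePlat hn hzero bot hbotinj hone
  obtain ⟨F, hF⟩ := isotopic_levelChange (fun X : Set E3 => X) hw.pos₁ hw.pos₂ hw.add_lt
  have hfinal (X : Set S3) : ((H.comp G).comp F.inv).final '' X =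
      F.final.symm '' (G.final '' (H.final '' X)) := by
    rw [← image_comp, ← image_comp]; rfl
  have hFsymm (X : Set E3) : F.final.symm '' toS3 (levelChange δ₁ δ₂ '' X) = toS3 X := by
    have h1 : F.final '' toS3 X = toS3 (levelChange δ₁ δ₂ '' X) := hF X
    rw [← h1]
    exact F.final.toEquiv.symm_image_image _
  have hcarrier : ((H.comp G).comp F.inv).final '' L.carrier = toS3 β.plat := by
    rw [hfinal, hH, ← κ.surjective.iUnion_comp, image_iUnion]
    simp only [hG]
    rw [← toS3_iUnion, ← hw.image_plat, hFsymm]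
  let P : PlatPresentation L n := ⟨β, (H.comp G).comp F.inv, hcarrier⟩
  have hPcomp (j) : P.component j = F.final.symm '' (G.final '' C j) := hfinal _
  have hPdisj (j j') (hj : j ≠ j') : Disjoint (P.component j) (P.component j') :=
    (disjoint_image_iff (P.isotopy.final).injective).2 (L.disjoint_component hj)
  -- an arc whose image is covered by strings of one component belongs to this component
  have harc (X : Set E3) (hX : X.Nonempty) (i : Fin n) (p : Fin (2 * n) → Prop)
      (hp : ∀ m, p m → comp (κ m) = comp (e i))
      (hsub : levelChange δ₁ δ₂ '' X ⊆ ⋃ k : {k // p k}, strand (q' k)) (j : Fin μ) :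
      toS3 X ⊆ P.component j ↔ comp (e i) = j := by
    have h1 : toS3 X ⊆ P.component (comp (e i)) := by
      rw [hPcomp, ← hFsymm X]
      refine image_mono ?_
      refine (image_mono hsub).trans ?_
      change toS3 (⋃ k : {k // p k}, strand (q' k)) ⊆ _
      rw [toS3_iUnion]
      refine iUnion_subset fun k => ?_
      have h2 : G.final '' toS3 (strand (q (κ k))) = toS3 (strand (q' k)) := hG k
      rw [← h2]
      refine image_mono ?_
      rw [← hp k k.2]
      exact hcomp (κ k)
    constructor
    · intro h2
      by_contra hne
      obtain ⟨x, hx⟩ := hX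
      exact disjoint_left.1 (hPdisj _ _ hne) (h1 ⟨x, hx, rfl⟩) (h2 ⟨x, hx, rfl⟩)
    · rintro rfl; exact h1
  have htopne (i : ℕ) : (topArc i).Nonempty :=
    ⟨(((2 * i + 1 / 2 : ℝ) : ℂ), -(1 / 2)), Complex.ofReal_im _, by norm_num, by
      simp only [Complex.ofReal_re]; norm_num⟩
  have hbotne (i : ℕ) : (bottomArc i).Nonempty :=
    ⟨(((2 * i + 1 / 2 : ℝ) : ℂ), 3 / 2), Complex.ofReal_im _, by norm_num, by
      simp only [Complex.ofReal_re]; norm_num⟩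
  have hcompbot (m) : comp (κ m) = comp (e (half (bot m))) := by
    rw [← hfirst]
    simp only [first]
    split_ifs
    · rfl
    · rw [hcompb]
  refine ⟨P, ⟨fun j => (Finset.univ.filter fun i => comp (e i) = j).card, ?_, fun j i => ?_⟩,
    fun i => ?_⟩
  · rw [← Finset.card_eq_sum_card_fiberwise (fun i _ => Finset.mem_coe.2 (Finset.mem_univ _))]
    simp
  · rw [← eq_iff_of_monotone he i j]
    constructor
    · refine harc _ (htopne i) i (fun m => (m : ℕ) / 2 = i) (fun m hm => ?_)
        (hw.image_topArc_subset i) j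
      rw [hcompκ, show half m = i from Fin.ext hm]
    · refine harc _ (hbotne i) i (fun m => (bot m : ℕ) / 2 = i) (fun m hm => ?_)
        (hw.image_bottomArc_subset i) j
      rw [hcompbot, show half (bot m) = i from Fin.ext hm]
  · have hi := i.2
    have hpath (m : Fin (2 * n)) : β.path m 1 = endpoint (bot m) := by
      rw [← hw.braid_eq m 1]
      have e1 : δ₁ + (1 - δ₁ - δ₂) * ((1 : I) : ℝ) = 1 - δ₂ := by rw [Icc.coe_one]; ring
      have e2 : δ₂ / (2 * δ₂) = 1 / 2 := by have := hw.pos₂; field_simp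
      rw [e1, hw.bottom_eq m δ₂ ⟨hw.pos₂.le, le_rfl⟩, e2, arcCenter_add_arcSide, endpoint]
      simp
    constructor
    · refine ⟨i, ?_⟩
      change _ = β.path _ 1
      rw [hpath, hboteven _ (by simp only; omega)]
    · have hpar := hbotpar ⟨2 * (i : ℕ) + 1, by omega⟩
      simp only at hpar
      have hlt := (bot ⟨2 * (i : ℕ) + 1, by omega⟩).2
      refine ⟨half (bot ⟨2 * (i : ℕ) + 1, by omega⟩), ?_⟩
      change _ = β.path _ 1
      rw [hpath]
      simp only [half]
      congr 1
      omega

/-! ### Counting strings -/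

/-- The strings of a pointed plat meet in pairs, and so their number is even. -/
theorem IsPointedPlat.two_dvd_card {K : Type*} [Fintype K] {q : K → ℝ → ℂ}
    (h : IsPointedPlat q) : 2 ∣ Fintype.card K := by
  classical
  choose a ha' ha using h.meet_zero
  have haa (k) : a (a k) = k := by
    have h1 := (ha (a k) k).1 ((ha k (a k)).2 (Or.inr rfl)).symm
    exact (h1.resolve_left fun h' => ha' k h'.symm).symm
  let A : Equiv.Perm K := ⟨a, a, haa, haa⟩
  have h1 : A.support = Finset.univ := by
    ext k
    simp only [Equiv.Perm.mem_support, Finset.mem_univ, iff_true]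
    exact ha' k
  rw [← Finset.card_univ, ← h1]
  exact Equiv.Perm.two_dvd_card_support (Equiv.ext fun k => haa k)

/-- Every link has a plat presentation. -/
theorem Link.exists_platPresentation {μ : ℕ} (L : Link μ) :
    ∃ n, 0 < n ∧ Nonempty (PlatPresentation L n) := by
  obtain ⟨V, hV, hV', τ, v, hv, hiso₁⟩ := L.exists_isSimplePolygon
  obtain ⟨K, hK, hK', q, hq, hiso₂⟩ := hv.exists_isPointedPlat
  obtain ⟨n, hn⟩ := hq.two_dvd_card
  have hpos : 0 < n := by
    have := Fintype.card_pos (α := K)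
    omega
  obtain ⟨P, -⟩ := L.exists_isSpecial hpos hn hq (hiso₁.trans hiso₂)
  exact ⟨n, hpos, ⟨P⟩⟩

/-- The number of strings of a pointed plat can be increased by any even number. -/
theorem IsPointedPlat.exists_add_two_mul {K : Type} [Fintype K] [Nonempty K] {q : K → ℝ → ℂ}
    (h : IsPointedPlat q) (d : ℕ) :
    ∃ (K' : Type) (_ : Fintype K') (_ : Nonempty K') (q' : K' → ℝ → ℂ), IsPointedPlat q' ∧
      Fintype.card K' = Fintype.card K + 2 * d ∧
      Isotopic (fun _ : Unit => ⋃ k, toS3 (strand (q k))) fun _ => ⋃ k, toS3 (strand (q' k)) := by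
  induction d with
  | zero => exact ⟨K, inferInstance, inferInstance, q, h, rfl, Isotopic.refl _⟩
  | succ d ih =>
    obtain ⟨K', _, _, q', h', hcard, hiso⟩ := ih
    obtain ⟨q'', h'', hiso'⟩ := h'.exists_add_two
    refine ⟨Option (Option K'), inferInstance, inferInstance, q'', h'', ?_, hiso.trans hiso'⟩
    rw [Fintype.card_option, Fintype.card_option, hcard]
    ring

end PlatLink

theorem proposition1 {μ : ℕ} (L : PlatLink.Link μ) (n : ℕ) (hn : L.bridgeNumber ≤ n) :
    ∃ P : PlatLink.PlatPresentation L n, P.IsSpecial := by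
  obtain ⟨hpos, ⟨P⟩⟩ : 0 < L.bridgeNumber ∧
      Nonempty (PlatLink.PlatPresentation L L.bridgeNumber) :=
    Nat.sInf_mem L.exists_platPresentation
  obtain ⟨q, hq, hiso⟩ := P.braid.exists_isPointedPlat
  have : Nonempty (Fin (2 * L.bridgeNumber)) := ⟨⟨0, by omega⟩⟩
  obtain ⟨K, _, _, q', hq', hcard, hiso'⟩ := hq.exists_add_two_mul (n - L.bridgeNumber)
  refine L.exists_isSpecial (hpos.trans_le hn) ?_ hq'
    (PlatLink.Isotopic.trans ⟨P.isotopy, fun _ => P.image_eq⟩ (hiso.trans hiso'))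
  rw [hcard, Fintype.card_fin]
  omega
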